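/- **Definitions.** Let $\delta,\kappa>0$ with $\kappa<\delta/2$. A bipartite graph $\Gamma$ with left vertex set $[p]$ and right vertex set $[q]$ (write $j\to i$ if $j\in[p]$ and $i\in[q]$ are adjacent) is *$(\delta,\kappa)$-broadly connected* if 1. $\deg(i)\ge \delta p$ for all $i\in[q]$; 2. $\deg(j)\ge \delta q$ for all $j\in[p]$; 3. for every $J\subset[p]$, the set $I(J)=\{i\in[q] : j\to i \text{ for at least } \lfloor(\delta/2)|J|\rfloor \text{ numbers } j\in J\}$ satisfies $|I(J)|\ge\min\big((1+\kappa)|J|,\,q\big)$. For a $p\times q$ matrix $A=(a_{j,i})$, let $\Gamma_A$ be the bipartite graph with left vertex set $[p]$ (the rows) and right vertex set $[q]$ (the columns) in which $j\to i$ whenever $a_{j,i}\ne0$. $\|\cdot\|$ denotes the Euclidean operator norm and $s_k(\cdot)$ the $k$-th largest singular value. **Theorem.** Let $r,\delta,\kappa>0$ with $\kappa<\delta/2$. There exist constants $c,c',C>0$ and $n_0\in\mathbb N$, depending only on $r,\delta,\kappa$, such that the following holds. Let $n\ge n_0$, let $n/2<m\le n-4$, and let $W$ be an $n\times m$ random matrix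 with independent normal entries $w_{i,j}\sim N(b_{i,j},a_{i,j}^2)$. Write $A=(a_{i,j})$, and assume that 1. $a_{i,j}\in\{0\}\cup[r,1]$ for all $i,j$; 2. the graph $\Gamma_A$ is $(\delta,\kappa)$-broadly connected; 3. $\|\mathbb E W\|\le K\sqrt n$ for some $K\ge1$. Then for every $t>0$ $$\mathbb P\left(s_m(W)\le c\,t\,K^{-C}\,\frac{n-m}{\sqrt n}\right)\le t^{(n-m)/4}+e^{-c'n}.$$ -/

import Mathlib

open MeasureTheory ProbabilityTheory

namespace SingularGaussian

noncomputable section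

/-- The set `I(J)` of broadly connected neighbours of a set `J` of left vertices, in the bipartite
graph with left part `[m]`, right part `[n]` and edge relation `E`. -/
def broadNeighbors {m n : ℕ} (δ : ℝ) (E : Fin m → Fin n → Prop) (J : Finset (Fin m)) :
    Set (Fin n) :=
  {i | ⌊(δ / 2) * (J.card : ℝ)⌋₊ ≤ Set.ncard {j | j ∈ J ∧ E j i}}

/-- `(δ, κ)`-broadly connected `m × n` bipartite graphs. -/
structure BroadlyConnected {m n : ℕ} (δ κ : ℝ) (E : Fin m → Fin n → Prop) : Prop where
  deg_right : ∀ i : Fin n, δ * m ≤ (Set.ncard {j | E j i} : ℝ)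
  deg_left : ∀ j : Fin m, δ * n ≤ (Set.ncard {i | E j i} : ℝ)
  expansion : ∀ J : Finset (Fin m),
    min ((1 + κ) * (J.card : ℝ)) (n : ℝ) ≤ (Set.ncard (broadNeighbors δ E J) : ℝ)

/-- The bipartite graph `Γ_A` of an `m × n` matrix: rows are the left vertices, columns are the
right vertices, and `j → i` when `A j i ≠ 0`. -/
def matrixGraph {m n : ℕ} (A : Matrix (Fin m) (Fin n) ℝ) : Fin m → Fin n → Prop :=
  fun j i => A j i ≠ 0

/-- The operator norm of a matrix between Euclidean spaces. -/
def opNorm {m n : ℕ} (A : Matrix (Fin m) (Fin n) ℝ) : ℝ :=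
  ‖(Matrix.toEuclideanLin A).toContinuousLinearMap‖

/-- The `k`-th largest singular value `s_k(A)`, for `k ≥ 1` (Mathlib's sequence starts at `0`). -/
def singularValue {m n : ℕ} (A : Matrix (Fin m) (Fin n) ℝ) (k : ℕ) : ℝ :=
  (Matrix.toEuclideanLin A).singularValues (k - 1)

/-- The entrywise expectation of a random matrix. -/
def expectedMatrix {Ω : Type*} [MeasurableSpace Ω] (P : Measure Ω) {n m : ℕ}
    (W : Ω → Matrix (Fin n) (Fin m) ℝ) : Matrix (Fin n) (Fin m) ℝ :=
  fun i j => ∫ ω, W ω i j ∂P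

/-- `W` has independent entries and the entry `(i, j)` has law `N(b i j, (a i j)²)`
(a point mass at `b i j` when `a i j = 0`). -/
structure IsIndepGaussianMatrix {Ω : Type*} [MeasurableSpace Ω] (P : Measure Ω) {n m : ℕ}
    (W : Ω → Matrix (Fin n) (Fin m) ℝ) (b a : Matrix (Fin n) (Fin m) ℝ) : Prop where
  indep : iIndepFun (fun (p : Fin n × Fin m) ω => W ω p.1 p.2) P
  law : ∀ i j, HasLaw (fun ω => W ω i j) (gaussianReal (b i j) (Real.toNNReal (a i j ^ 2))) P

end

end SingularGaussian

/-! Write d = n - m and suppose first that d ≤ εn. If W x is small for a unit vector x, a union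
bound over nearly sparse vectors shows that x has more than ηn coordinates of size at least τ/√n.
Every set J of q = ⌊d/2⌋ such coordinates has ‖x_J‖ ≥ τ√(q/n). Counting these sets reduces the
problem, at the cost of a factor (2/η)^q, to a fixed block J of columns: some unit vector of the
block is mapped close to the span of the other columns (`measureReal_smin_le_of_blocks`).

For fixed J, condition on the other m - q columns and project onto a subspace of dimension D = d + q
orthogonal to them. The projected block is Gaussian of size D × q with D ≥ 3q. A net argument bounds
the probability that it shrinks some unit vector below t√D by A^D t^(D/2 - q), and D/2 - q = (d -
q)/2 ≥ d/4 is the exponent of the theorem (`GaussFam.block_bound`). The mean of the block may be far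
larger than √D; the net is therefore taken for a norm which also measures the mean, and this does
not raise its dimension.

This needs the projected block to have covariance bounded below. A unit vector y of the block gives
variance at least ρ/2 to at least (ρ/2)n rows, so the vectors normal to the other columns must have
mass on every set of that many rows: none may be close to a (1 - ρ/2)n-sparse vector. Broad
connectedness enters here. A vector with un large coordinates is seen by at least (u + 2γ)n columns,
and this number of independent small ball factors beats the entropy of (u + γ)n-sparse vectors at a
small enough scale. So the excluded sparsity rises from un to (u + γ)n, and a bounded number of
steps leads from ρ/4 to 1 - ρ/2 (`exists_sparse_level`).

If d > εn, Gaussian columns without zero variances are adjoined until the difference lies between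
εn/2 and εn. This can only lower the least singular value, and the almost square bound at a fixed t
is already exponentially small. -/

namespace SingularGaussian

/-! ### Small balls and tails of Gaussian vectors -/

/-- A finite family of independent real Gaussian variables with means `b i` and standard
deviations `|a i|`. -/
structure GaussFam {Ω : Type*} [MeasurableSpace Ω] (P : Measure Ω) {ι : Type*}
    (X : ι → Ω → ℝ) (b a : ι → ℝ) : Prop where
  meas : ∀ i, Measurable (X i)
  indep : iIndepFun X P
  law : ∀ i, P.map (X i) = gaussianReal (b i) (Real.toNNReal (a i ^ 2))

variable {Ω : Type*} [MeasurableSpace Ω] {P : Measure Ω}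

lemma GaussFam.precomp {ι ι' : Type*} {X : ι → Ω → ℝ} {b a : ι → ℝ} (h : GaussFam P X b a)
    {g : ι' → ι} (hg : Function.Injective g) :
    GaussFam P (fun i => X (g i)) (fun i => b (g i)) (fun i => a (g i)) :=
  ⟨fun _ => h.meas _, h.indep.precomp hg, fun _ => h.law _⟩

/-- The means contribute factors of modulus one, so only the variances remain. This makes the small
ball estimates uniform in the mean. -/
lemma GaussFam.norm_integral_cexp {ι : Type*} [Fintype ι] {X : ι → Ω → ℝ} {b a : ι → ℝ}
    (h : GaussFam P X b a) (θ : ι → ℝ) :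
    ‖∫ ω, Complex.exp (((∑ i, θ i * X i ω : ℝ) : ℂ) * Complex.I) ∂P‖
      = Real.exp (-(∑ i, a i ^ 2 * θ i ^ 2) / 2) := by
  have e : ∀ ω, Complex.exp (((∑ i, θ i * X i ω : ℝ) : ℂ) * Complex.I)
      = ∏ i, Complex.exp ((θ i : ℂ) * (X i ω : ℂ) * Complex.I) := by
    intro ω
    rw [← Complex.exp_sum]
    push_cast
    rw [Finset.sum_mul]
  simp_rw [e]
  rw [h.indep.integral_fun_prod_comp (f := fun i (x : ℝ) => Complex.exp ((θ i : ℂ) * (x : ℂ) * Complex.I))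
    (fun i => (h.meas i).aemeasurable)
    (fun _ => by fun_prop), norm_prod]
  have k : ∀ i, ‖∫ ω, Complex.exp ((θ i : ℂ) * (X i ω : ℂ) * Complex.I) ∂P‖
      = Real.exp (-(a i ^ 2 * θ i ^ 2) / 2) := by
    intro i
    have := integral_map (μ := P) (h.meas i).aemeasurable
      (f := fun x : ℝ => Complex.exp ((θ i : ℂ) * (x : ℂ) * Complex.I)) (by fun_prop)
    rw [← this, h.law i, ← charFun_apply_real, charFun_gaussianReal, Complex.norm_exp]
    congr 1
    have : (a i ^ 2).toNNReal = (a i ^ 2 : ℝ) := Real.coe_toNNReal _ (sq_nonneg _)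
    rw [this]
    simp only [Complex.sub_re, Complex.mul_re, Complex.ofReal_re, Complex.I_re, mul_zero,
      Complex.ofReal_im, Complex.I_im, mul_one, zero_sub, Complex.mul_im]
    norm_cast
    simp
    ring
  simp_rw [k]
  rw [← Real.exp_sum, ← Finset.sum_neg_distrib, Finset.sum_div]

/-- Exponential moment bound for the squared norm of a Gaussian vector. -/
lemma GaussFam.integral_exp_neg_sq_le [IsProbabilityMeasure P] {ι F : Type*} [Fintype ι]
    [NormedAddCommGroup F] [InnerProductSpace ℝ F] [FiniteDimensional ℝ F]
    {X : ι → Ω → ℝ} {b a : ι → ℝ}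
    (h : GaussFam P X b a) (c : ι → F) {v β : ℝ} (hv : 0 < v) (hβ : 0 < β)
    (hc : ∀ u : F, v ^ 2 * ‖u‖ ^ 2 ≤ ∑ i, a i ^ 2 * (inner ℝ u (c i)) ^ 2) :
    ∫ ω, Real.exp (-‖∑ i, X i ω • c i‖ ^ 2 / (4 * β)) ∂P
      ≤ (2 * β / v ^ 2) ^ (Module.finrank ℝ F / 2 : ℝ) := by
  borelize F
  set D : ℝ := Module.finrank ℝ F / 2 with hD
  set T : Ω → F := fun ω => ∑ i, X i ω • c i with hT
  have hTm : Measurable T := by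
    refine Finset.measurable_sum _ fun i _ => ?_
    exact (h.meas i).smul_const (c i)
  have hβ' : 0 < ((β : ℝ) : ℂ).re := by simpa using hβ
  -- exp(-‖T‖²/(4β)) is, up to normalisation, the Fourier transform of exp(-β‖u‖²) at T. After
  -- Fubini only the modulus of the characteristic function of T has to be bounded.
  have key : ∀ ω, ∫ u : F, Complex.exp (-(β : ℂ) * ‖u‖ ^ 2 + Complex.I * (inner ℝ (T ω) u : ℝ))
      = ((Real.pi / β) ^ D * Real.exp (-‖T ω‖ ^ 2 / (4 * β)) : ℝ) := by
    intro ω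
    rw [GaussianFourier.integral_cexp_neg_mul_sq_norm_add hβ', Complex.I_sq]
    push_cast
    rw [Complex.ofReal_cpow (by positivity)]
    push_cast [hD]
    congr 2
    ring
  have hint : Integrable (fun p : Ω × F =>
      Complex.exp (-(β : ℂ) * ‖p.2‖ ^ 2 + Complex.I * (inner ℝ (T p.1) p.2 : ℝ)))
      (P.prod volume) := by
    have h1 : Integrable (fun u : F => Real.exp (-β * ‖u‖ ^ 2)) := by
      have := (GaussianFourier.integrable_cexp_neg_mul_sq_norm_add hβ' 0 (0 : F)).norm
      refine this.congr (Filter.Eventually.of_forall fun u => ?_)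
      simp only [Complex.norm_exp]
      congr 1
      norm_cast
      simp
    have h2 := (integrable_const (1 : ℝ) (μ := P)).mul_prod h1
    refine h2.mono' ?_ (Filter.Eventually.of_forall fun p => ?_)
    · refine Measurable.aestronglyMeasurable ?_
      have : Measurable fun p : Ω × F => inner ℝ (T p.1) p.2 :=
        (hTm.comp measurable_fst).inner measurable_snd
      fun_prop
    · rw [Complex.norm_exp, one_mul]
      apply le_of_eq
      congr 1
      rw [← Complex.ofReal_pow, ← Complex.ofReal_neg, ← Complex.ofReal_mul, Complex.add_re,
        Complex.ofReal_re]
      simp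
  have hswap := integral_integral_swap (f := fun ω u =>
    Complex.exp (-(β : ℂ) * ‖u‖ ^ 2 + Complex.I * (inner ℝ (T ω) u : ℝ))) hint
  simp_rw [key] at hswap
  rw [integral_complex_ofReal, integral_const_mul] at hswap
  have hbound : ∀ u : F,
      ‖∫ ω, Complex.exp (-(β : ℂ) * ‖u‖ ^ 2 + Complex.I * (inner ℝ (T ω) u : ℝ)) ∂P‖
        ≤ Real.exp (-(β + v ^ 2 / 2) * ‖u‖ ^ 2) := by
    intro u
    have e : ∀ ω, Complex.exp (-(β : ℂ) * ‖u‖ ^ 2 + Complex.I * (inner ℝ (T ω) u : ℝ))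
        = (Real.exp (-β * ‖u‖ ^ 2) : ℝ) *
          Complex.exp (((∑ i, inner ℝ u (c i) * X i ω : ℝ) : ℂ) * Complex.I) := by
      intro ω
      rw [Complex.exp_add]
      have e1 : inner ℝ (T ω) u = ∑ i, inner ℝ u (c i) * X i ω := by
        rw [hT, sum_inner]
        refine Finset.sum_congr rfl fun i _ => ?_
        rw [real_inner_smul_left, real_inner_comm, mul_comm]
      rw [e1, mul_comm Complex.I]
      push_cast
      rfl
    simp_rw [e]
    rw [integral_const_mul, norm_mul, h.norm_integral_cexp, Complex.norm_real,
      Real.norm_of_nonneg (Real.exp_nonneg _), ← Real.exp_add]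
    apply Real.exp_le_exp.mpr
    have := hc u
    linarith
  have hb2 : 0 < β + v ^ 2 / 2 := by positivity
  have hI : Integrable (fun u : F => Real.exp (-(β + v ^ 2 / 2) * ‖u‖ ^ 2)) := by
    have hb3 : 0 < (((β + v ^ 2 / 2 : ℝ)) : ℂ).re := by
      rw [Complex.ofReal_re]; exact hb2
    have := (GaussianFourier.integrable_cexp_neg_mul_sq_norm_add hb3 0 (0 : F)).norm
    refine this.congr (Filter.Eventually.of_forall fun u => ?_)
    simp only [Complex.norm_exp]
    congr 1
    norm_cast
    simp
  have hle := norm_integral_le_of_norm_le hI (Filter.Eventually.of_forall hbound)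
  rw [← hswap, GaussianFourier.integral_rexp_neg_mul_sq_norm hb2, Complex.norm_real,
    Real.norm_of_nonneg (mul_nonneg (by positivity) (integral_nonneg fun _ => (Real.exp_pos _).le))] at hle
  have hpos : 0 < (Real.pi / β) ^ D := by positivity
  have h3 : (Real.pi / (β + v ^ 2 / 2)) ^ D
      ≤ (Real.pi / β) ^ D * (2 * β / v ^ 2) ^ D := by
    rw [← Real.mul_rpow (by positivity) (by positivity)]
    apply Real.rpow_le_rpow (by positivity) _ (by positivity)
    have : Real.pi / β * (2 * β / v ^ 2) = Real.pi / (v ^ 2 / 2) := by field_simp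
    rw [this]
    apply div_le_div_of_nonneg_left (by positivity) (by positivity) (by linarith)
  exact le_of_mul_le_mul_left (hle.trans h3) hpos

/-- Small ball estimate for a Gaussian vector whose covariance is at least `v ^ 2`. -/
lemma GaussFam.small_ball [IsProbabilityMeasure P] {ι F : Type*} [Fintype ι]
    [NormedAddCommGroup F] [InnerProductSpace ℝ F] [FiniteDimensional ℝ F]
    {X : ι → Ω → ℝ} {b a : ι → ℝ}
    (h : GaussFam P X b a) (c : ι → F) {v s : ℝ} (hv : 0 < v) (hs : 0 < s)
    (hc : ∀ u : F, v ^ 2 * ‖u‖ ^ 2 ≤ ∑ i, a i ^ 2 * (inner ℝ u (c i)) ^ 2) :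
    P.real {ω | ‖∑ i, X i ω • c i‖ ≤ s * √(Module.finrank ℝ F)}
      ≤ (2 * s / v) ^ Module.finrank ℝ F := by
  set D := Module.finrank ℝ F with hD
  borelize F
  have hTm : Measurable fun ω => ∑ i, X i ω • c i := by
    refine Finset.measurable_sum _ fun i _ => ?_
    exact (h.meas i).smul_const (c i)
  -- With β = s²/2 the moment bound becomes (s/v)^D, and on the event the integrand is at least
  -- exp(-D/2).
  have h1 := h.integral_exp_neg_sq_le c hv (β := s ^ 2 / 2) (by positivity) hc
  have hint : Integrable (fun ω => Real.exp (-‖∑ i, X i ω • c i‖ ^ 2 / (4 * (s ^ 2 / 2)))) P := by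
    refine (integrable_const (1 : ℝ)).mono' ?_ (Filter.Eventually.of_forall fun ω => ?_)
    · exact Measurable.aestronglyMeasurable (by fun_prop)
    · rw [Real.norm_of_nonneg (Real.exp_nonneg _), Real.exp_le_one_iff]
      rw [neg_div]
      have : 0 ≤ ‖∑ i, X i ω • c i‖ ^ 2 / (4 * (s ^ 2 / 2)) := by positivity
      linarith
  have h2 := mul_meas_ge_le_integral_of_nonneg (μ := P)
    (Filter.Eventually.of_forall fun ω => (Real.exp_pos _).le) hint (Real.exp (-(D : ℝ) / 2))
  have hsub : P.real {ω | ‖∑ i, X i ω • c i‖ ≤ s * √(D : ℝ)} ≤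
      P.real {ω | Real.exp (-(D : ℝ) / 2)
        ≤ Real.exp (-‖∑ i, X i ω • c i‖ ^ 2 / (4 * (s ^ 2 / 2)))} := by
    refine measureReal_mono fun ω hω => ?_
    simp only [Set.mem_ofPred_eq] at hω ⊢
    apply Real.exp_le_exp.mpr
    have h3 : ‖∑ i, X i ω • c i‖ ^ 2 ≤ s ^ 2 * D := by
      calc _ ≤ (s * √(D : ℝ)) ^ 2 := by gcongr
        _ = _ := by rw [mul_pow, Real.sq_sqrt (by positivity)]
    rw [neg_div, neg_div, neg_le_neg_iff, div_le_iff₀ (by positivity)]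
    nlinarith
  have h4 : (2 * (s ^ 2 / 2) / v ^ 2) ^ ((D : ℝ) / 2) = (s / v) ^ D := by
    rw [show 2 * (s ^ 2 / 2) / v ^ 2 = (s / v) ^ (2 : ℝ) by
        rw [Real.rpow_two]; field_simp, ← Real.rpow_mul (by positivity),
      ← Real.rpow_natCast]
    congr 1; ring
  rw [h4] at h1
  have h5 : Real.exp (-(D : ℝ) / 2) * P.real {ω | ‖∑ i, X i ω • c i‖ ≤ s * √(D : ℝ)}
      ≤ (s / v) ^ D :=
    (mul_le_mul_of_nonneg_left hsub (Real.exp_pos _).le).trans (h2.trans h1)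
  -- Markov's inequality costs exp(D/2), absorbed by 2^D since √e ≤ 2.
  have h6 : Real.exp (-(D : ℝ) / 2) * 2 ^ D ≥ 1 := by
    have : (2 : ℝ) ^ D = Real.exp (Real.log 2 * D) := by
      rw [Real.exp_mul, Real.exp_log (by norm_num), Real.rpow_natCast]
    rw [this, ← Real.exp_add, ge_iff_le, Real.one_le_exp_iff]
    have := Real.log_two_gt_d9
    have hD0 : (0 : ℝ) ≤ D := by positivity
    nlinarith
  have h7 : (2 * s / v) ^ D = 2 ^ D * (s / v) ^ D := by rw [← mul_pow]; congr 1; ring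
  rw [h7]
  have hq : 0 ≤ P.real {ω | ‖∑ i, X i ω • c i‖ ≤ s * √(D : ℝ)} := measureReal_nonneg
  calc _ ≤ (Real.exp (-(D : ℝ) / 2) * 2 ^ D) * P.real {ω | ‖∑ i, X i ω • c i‖ ≤ s * √(D : ℝ)} :=
        le_mul_of_one_le_left hq h6
    _ = 2 ^ D * (Real.exp (-(D : ℝ) / 2) * P.real {ω | ‖∑ i, X i ω • c i‖ ≤ s * √(D : ℝ)}) := by
        ring
    _ ≤ _ := by gcongr

/-- One-sided Gaussian tail for linear combinations. -/
lemma GaussFam.tail [IsProbabilityMeasure P] {ι : Type*} [Fintype ι]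
    {X : ι → Ω → ℝ} {b a : ι → ℝ} (h : GaussFam P X b a) (c : ι → ℝ)
    (hc : ∑ i, a i ^ 2 * c i ^ 2 ≤ 1) {s : ℝ} (hs : 0 ≤ s) :
    P.real {ω | s ≤ ∑ i, c i * (X i ω - b i)} ≤ Real.exp (-s ^ 2 / 2) := by
  have hind : iIndepFun (fun i ω => c i * (X i ω - b i)) P :=
    h.indep.comp (fun i x => c i * (x - b i)) (fun _ => by fun_prop)
  have hm : ∀ i, Measurable fun ω => c i * (X i ω - b i) := fun i =>
    ((h.meas i).sub_const _).const_mul _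
  -- Chernoff's bound with parameter s, optimal for unit variance.
  have h1 := measure_ge_le_exp_mul_mgf (μ := P) (X := ∑ i, fun ω => c i * (X i ω - b i)) (t := s) s hs
  have hl : ∀ i, P.map (fun ω => c i * (X i ω - b i)) =
      gaussianReal 0 (NNReal.mk (c i ^ 2) (sq_nonneg _) * Real.toNNReal (a i ^ 2)) := by
    intro i
    have hX : HasLaw (X i) (gaussianReal (b i) (Real.toNNReal (a i ^ 2))) P :=
      ⟨(h.meas i).aemeasurable, h.law i⟩
    have h3 := (gaussianReal_const_mul (gaussianReal_sub_const hX (b i)) (c i)).map_eq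
    simpa using h3
  have hmgf : mgf (∑ i, fun ω => c i * (X i ω - b i)) P s
      = Real.exp (s ^ 2 / 2 * ∑ i, a i ^ 2 * c i ^ 2) := by
    rw [hind.mgf_sum hm, Finset.mul_sum, Real.exp_sum]
    refine Finset.prod_congr rfl fun i _ => ?_
    rw [mgf_gaussianReal (hl i)]
    congr 1
    rw [NNReal.coe_mul, Real.coe_toNNReal _ (sq_nonneg _), NNReal.coe_mk]
    ring
  have hint : Integrable (fun ω => Real.exp (s * (∑ i, fun ω => c i * (X i ω - b i)) ω)) P := by
    rw [← mgf_pos_iff, hmgf]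
    exact Real.exp_pos _
  have h2 := h1 hint
  rw [hmgf, ← Real.exp_add] at h2
  simp only [Finset.sum_apply] at h2
  refine h2.trans (Real.exp_le_exp.mpr ?_)
  nlinarith [sq_nonneg s]

end SingularGaussian

namespace SingularGaussian

/-! ### Nets and volumetric entropy bounds -/

section Nets

variable {E F : Type*} [NormedAddCommGroup E] [NormedSpace ℝ E] [NormedAddCommGroup F]
  [NormedSpace ℝ F]

open Metric in
/-- Volumetric bound for separated sets in the unit ball. -/
lemma card_le_of_separated_unit_ball [FiniteDimensional ℝ E] {θ : ℝ} (hθ : 0 < θ) (hθ1 : θ ≤ 1)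
    (s : Finset E) (hs : ∀ c ∈ s, ‖c‖ ≤ 1) (h : ∀ c ∈ s, ∀ d ∈ s, c ≠ d → θ ≤ ‖c - d‖) :
    (s.card : ℝ) ≤ (3 / θ) ^ Module.finrank ℝ E := by
  borelize E
  let μ : Measure E := Measure.addHaar
  have hδ : 0 < θ / 2 := by positivity
  have hρ : 0 < 1 + θ / 2 := by positivity
  have D : Set.Pairwise (s : Set E) (Function.onFun Disjoint fun c => ball (c : E) (θ / 2)) := by
    rintro c hc d hd hcd
    apply ball_disjoint_ball
    rw [dist_eq_norm, add_halves]
    exact h c hc d hd hcd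
  have hsub : (⋃ c ∈ s, ball (c : E) (θ / 2)) ⊆ ball (0 : E) (1 + θ / 2) := by
    refine Set.iUnion₂_subset fun x hx => ball_subset_ball' ?_
    rw [dist_zero_right]
    linarith [hs x hx]
  have I : (s.card : ENNReal) * ENNReal.ofReal ((θ / 2) ^ Module.finrank ℝ E) * μ (ball 0 1) ≤
      ENNReal.ofReal ((1 + θ / 2) ^ Module.finrank ℝ E) * μ (ball 0 1) :=
    calc
      _ = μ (⋃ c ∈ s, ball (c : E) (θ / 2)) := by
        rw [measure_biUnion_finset D fun c _ => measurableSet_ball]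
        simp only [μ.addHaar_ball_of_pos _ hδ, Finset.sum_const, nsmul_eq_mul, mul_assoc]
      _ ≤ μ (ball (0 : E) (1 + θ / 2)) := measure_mono hsub
      _ = _ := by simp only [μ.addHaar_ball_of_pos _ hρ]
  have J : (s.card : ENNReal) * ENNReal.ofReal ((θ / 2) ^ Module.finrank ℝ E) ≤
      ENNReal.ofReal ((1 + θ / 2) ^ Module.finrank ℝ E) :=
    (ENNReal.mul_le_mul_iff_left (measure_ball_pos _ _ zero_lt_one).ne' measure_ball_lt_top.ne).1 I
  have K := ENNReal.toReal_le_of_le_ofReal (by positivity) J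
  rw [ENNReal.toReal_mul, ENNReal.toReal_natCast, ENNReal.toReal_ofReal (by positivity)] at K
  rw [← le_div_iff₀ (by positivity), ← div_pow] at K
  refine K.trans (pow_le_pow_left₀ (by positivity) ?_ _)
  rw [div_le_div_iff₀ hδ hθ]
  nlinarith

/-- A separated subset of `V` that is not a net can be enlarged, and volume comparison bounds its
size, so the enlargement must stop. The net points lie in `V` itself, so estimates valid on `V`
apply to them. -/
lemma exists_net [FiniteDimensional ℝ E] (V : Set E) (hV : ∀ x ∈ V, ‖x‖ ≤ 1) {θ : ℝ} (hθ : 0 < θ)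
    (hθ1 : θ ≤ 1) :
    ∃ N : Finset E, (∀ x ∈ N, x ∈ V) ∧ (∀ x ∈ V, ∃ y ∈ N, ‖x - y‖ ≤ θ) ∧
      (N.card : ℝ) ≤ (3 / θ) ^ Module.finrank ℝ E := by
  classical
  by_contra hcon
  push Not at hcon
  have key : ∀ k : ℕ, ∃ N : Finset E, N.card = k ∧ (∀ x ∈ N, x ∈ V) ∧
      ∀ c ∈ N, ∀ d ∈ N, c ≠ d → θ ≤ ‖c - d‖ := by
    intro k
    induction k with
    | zero => exact ⟨∅, by simp⟩
    | succ k ih =>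
      obtain ⟨N, hN, hNV, hNs⟩ := ih
      have hb := card_le_of_separated_unit_ball hθ hθ1 N (fun c hc => hV c (hNV c hc)) hNs
      have : ∃ x ∈ V, ∀ y ∈ N, θ < ‖x - y‖ := by
        by_contra hc
        push Not at hc
        exact absurd hb (not_le.mpr (hcon N hNV hc))
      obtain ⟨x, hx, hxy⟩ := this
      have hxN : x ∉ N := fun hxN => by
        have := hxy x hxN
        simp at this
        linarith
      refine ⟨insert x N, by rw [Finset.card_insert_of_notMem hxN, hN], ?_, ?_⟩
      · simpa [hx] using hNV
      · intro c hc d hd hcd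
        rcases Finset.mem_insert.mp hc with hc' | hc' <;>
          rcases Finset.mem_insert.mp hd with hd' | hd'
        · exact absurd (hc'.trans hd'.symm) hcd
        · rw [hc']; exact (hxy d hd').le
        · rw [hd', norm_sub_rev]; exact (hxy c hc').le
        · exact hNs c hc' d hd' hcd
  obtain ⟨k, hk⟩ := exists_nat_gt ((3 / θ) ^ Module.finrank ℝ E)
  obtain ⟨N, hN, hNV, hNs⟩ := key k
  have hb := card_le_of_separated_unit_ball hθ hθ1 N (fun c hc => hV c (hNV c hc)) hNs
  rw [hN] at hb
  linarith

/-- Nets with respect to the seminorm `‖Φ ·‖`. -/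
lemma exists_net_comap (Φ : E →ₗ[ℝ] F) [FiniteDimensional ℝ (LinearMap.range Φ)]
    (V : Set E) (hV : ∀ x ∈ V, ‖Φ x‖ ≤ 1) {θ : ℝ} (hθ : 0 < θ) (hθ1 : θ ≤ 1) :
    ∃ N : Finset E, (∀ x ∈ N, x ∈ V) ∧ (∀ x ∈ V, ∃ y ∈ N, ‖Φ (x - y)‖ ≤ θ) ∧
      (N.card : ℝ) ≤ (3 / θ) ^ Module.finrank ℝ (LinearMap.range Φ) := by
  classical
  obtain ⟨N, hNV, hN, hcard⟩ := exists_net (Φ.rangeRestrict '' V)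
    (by rintro _ ⟨x, hx, rfl⟩; exact hV x hx) hθ hθ1
  choose! g hg hgΦ using hNV
  refine ⟨N.image g, ?_, ?_, le_trans (by exact_mod_cast Finset.card_image_le) hcard⟩
  · intro x hx
    obtain ⟨y, hy, rfl⟩ := Finset.mem_image.mp hx
    exact hg y hy
  · intro x hx
    obtain ⟨y, hy, hxy⟩ := hN _ ⟨x, hx, rfl⟩
    refine ⟨g y, Finset.mem_image_of_mem _ hy, ?_⟩
    rw [← hgΦ y hy] at hxy
    rw [map_sub]
    exact hxy

end Nets

/-! ### Nearly sparse vectors -/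

section Sparse

variable {β : Type*} [Fintype β] [DecidableEq β]

/-- `x` is within `τ` of a vector supported on at most `k` coordinates. -/
def NearSparse (k τ : ℝ) (x : EuclideanSpace ℝ β) : Prop :=
  ∃ S : Finset β, (S.card : ℝ) ≤ k ∧ ∑ i ∈ Sᶜ, x i ^ 2 ≤ τ ^ 2

/-- Restriction of a vector to a set of coordinates. -/
def coordRestrict {β : Type*} (S : Finset β) : EuclideanSpace ℝ β →ₗ[ℝ] EuclideanSpace ℝ S where
  toFun x := WithLp.toLp 2 fun i => x i
  map_add' _ _ := rfl
  map_smul' _ _ := rfl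

omit [Fintype β] [DecidableEq β] in
lemma norm_sq_coordRestrict (S : Finset β) (x : EuclideanSpace ℝ β) :
    ‖coordRestrict S x‖ ^ 2 = ∑ i ∈ S, x i ^ 2 := by
  rw [EuclideanSpace.norm_sq_eq, ← Finset.sum_coe_sort S]
  refine Finset.sum_congr rfl fun i _ => ?_
  rw [Real.norm_eq_abs, sq_abs]
  rfl

lemma norm_sq_eq_add_compl (S : Finset β) (x : EuclideanSpace ℝ β) :
    ‖x‖ ^ 2 = ‖coordRestrict S x‖ ^ 2 + ‖coordRestrict Sᶜ x‖ ^ 2 := by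
  rw [norm_sq_coordRestrict, norm_sq_coordRestrict, Finset.sum_add_sum_compl,
    EuclideanSpace.norm_sq_eq]
  simp

lemma norm_le_add_compl (S : Finset β) (x : EuclideanSpace ℝ β) :
    ‖x‖ ≤ ‖coordRestrict S x‖ + ‖coordRestrict Sᶜ x‖ := by
  refine abs_le_of_sq_le_sq' ?_ (by positivity) |>.2
  rw [norm_sq_eq_add_compl S x]
  nlinarith [norm_nonneg (coordRestrict S x), norm_nonneg (coordRestrict Sᶜ x)]

lemma norm_coordRestrict_le (S : Finset β) (x : EuclideanSpace ℝ β) : ‖coordRestrict S x‖ ≤ ‖x‖ := by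
  refine abs_le_of_sq_le_sq' ?_ (by positivity) |>.2
  rw [norm_sq_eq_add_compl S x]
  nlinarith [norm_nonneg (coordRestrict Sᶜ x)]

/-- Restriction to a fixed support has rank at most k, which gives at most (3/τ)^k net points; there
are 2^|β| supports. -/
lemma exists_net_of_nearSparse {k τ : ℝ} (hτ : 0 < τ) (hτ1 : τ ≤ 1)
    (V : Set (EuclideanSpace ℝ β)) (hV : ∀ x ∈ V, ‖x‖ ≤ 1) (hVk : ∀ x ∈ V, NearSparse k τ x) :
    ∃ N : Finset (EuclideanSpace ℝ β), (∀ x ∈ N, x ∈ V) ∧ (∀ x ∈ V, ∃ y ∈ N, ‖x - y‖ ≤ 3 * τ) ∧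
      (N.card : ℝ) ≤ 2 ^ Fintype.card β * (3 / τ) ^ k := by
  classical
  have h1 : 1 ≤ 3 / τ := by rw [le_div_iff₀ hτ]; linarith
  have key : ∀ S : Finset β, ∃ N : Finset (EuclideanSpace ℝ β), (∀ x ∈ N, x ∈ V) ∧
      (∀ x ∈ V, ((S.card : ℝ) ≤ k ∧ ∑ i ∈ Sᶜ, x i ^ 2 ≤ τ ^ 2) → ∃ y ∈ N, ‖x - y‖ ≤ 3 * τ) ∧
      (N.card : ℝ) ≤ (3 / τ) ^ k := by
    intro S
    by_cases hS : (S.card : ℝ) ≤ k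
    · obtain ⟨N, h2, h3, h4⟩ := exists_net_comap (coordRestrict S)
        {x ∈ V | ∑ i ∈ Sᶜ, x i ^ 2 ≤ τ ^ 2}
        (fun x hx => (norm_coordRestrict_le S x).trans (hV x hx.1)) hτ hτ1
      refine ⟨N, fun x hx => (h2 x hx).1, ?_, h4.trans ?_⟩
      · rintro x hx ⟨-, hx2⟩
        obtain ⟨y, hy, hxy⟩ := h3 x ⟨hx, hx2⟩
        refine ⟨y, hy, ?_⟩
        have hr : ∀ z : EuclideanSpace ℝ β, ∑ i ∈ Sᶜ, z i ^ 2 ≤ τ ^ 2 →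
            ‖coordRestrict Sᶜ z‖ ≤ τ := fun z hz => by
          rw [← norm_sq_coordRestrict] at hz
          exact abs_le_of_sq_le_sq' hz hτ.le |>.2
        have := norm_le_add_compl S (x - y)
        -- Off `S` each of x and y has norm at most τ; the net error τ on `S` makes it 3τ.
        have h5 : ‖coordRestrict Sᶜ (x - y)‖ ≤ 2 * τ := by
          rw [map_sub]
          refine (norm_sub_le _ _).trans ?_
          linarith [hr x hx2, hr y (h2 y hy).2]
        linarith
      · rw [← Real.rpow_natCast]
        apply Real.rpow_le_rpow_of_exponent_le h1
        refine le_trans ?_ hS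
        have := Submodule.finrank_le (LinearMap.range (coordRestrict S))
        rw [finrank_euclideanSpace, Fintype.card_coe] at this
        exact_mod_cast this
    · exact ⟨∅, by simp, fun x _ h => absurd h.1 hS, by simp; positivity⟩
  choose N hN1 hN2 hN3 using key
  refine ⟨Finset.univ.biUnion N, ?_, ?_, ?_⟩
  · intro x hx
    obtain ⟨S, -, hS⟩ := Finset.mem_biUnion.mp hx
    exact hN1 S x hS
  · intro x hx
    obtain ⟨S, hS⟩ := hVk x hx
    obtain ⟨y, hy, hxy⟩ := hN2 S x hx hS
    exact ⟨y, Finset.mem_biUnion.mpr ⟨S, Finset.mem_univ _, hy⟩, hxy⟩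
  · calc ((Finset.univ.biUnion N).card : ℝ) ≤ ∑ S : Finset β, ((N S).card : ℝ) := by
          exact_mod_cast Finset.card_biUnion_le
      _ ≤ ∑ _S : Finset β, (3 / τ) ^ k := Finset.sum_le_sum fun S _ => hN3 S
      _ = _ := by simp

end Sparse

/-! ### Operator norm through nets -/

section OpNorm

variable {E F : Type*} [NormedAddCommGroup E] [InnerProductSpace ℝ E]
  [NormedAddCommGroup F] [InnerProductSpace ℝ F]

/-- Replacing either unit vector by a net point costs at most ‖G‖/4, so ‖G‖ ≤ s + ‖G‖/2. -/
lemma opNorm_le_of_nets (G : E →L[ℝ] F) (N₁ : Set E) (N₂ : Set F)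
    (h₁ : ∀ x : E, ‖x‖ = 1 → ∃ y ∈ N₁, ‖x - y‖ ≤ 1 / 4)
    (h₂' : ∀ y ∈ N₂, ‖y‖ = 1)
    (h₂ : ∀ x : F, ‖x‖ = 1 → ∃ y ∈ N₂, ‖x - y‖ ≤ 1 / 4) {s : ℝ} (hs : 0 ≤ s)
    (h : ∀ x ∈ N₁, ∀ y ∈ N₂, inner ℝ y (G x) ≤ s) : ‖G‖ ≤ 2 * s := by
  have h3 : ‖G‖ ≤ s + ‖G‖ / 2 := by
    refine ContinuousLinearMap.opNorm_le_of_unit_norm (by positivity) fun x hx => ?_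
    by_cases hG : G x = 0
    · rw [hG, norm_zero]; positivity
    have hG' : 0 < ‖G x‖ := norm_pos_iff.mpr hG
    set u : F := ‖G x‖⁻¹ • G x with hu
    have hu1 : ‖u‖ = 1 := by
      rw [hu, norm_smul, norm_inv, norm_norm, inv_mul_cancel₀ hG'.ne']
    obtain ⟨x', hx', hxx'⟩ := h₁ x hx
    obtain ⟨u', hu', huu'⟩ := h₂ u hu1
    have e1 : ‖G x‖ = inner ℝ u (G x) := by
      rw [hu, real_inner_smul_left, real_inner_self_eq_norm_sq, sq, inv_mul_cancel_left₀ hG'.ne']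
    have e2 : inner ℝ u (G x) = inner ℝ u' (G x') + inner ℝ u' (G (x - x')) + inner ℝ (u - u') (G x) := by
      rw [map_sub, inner_sub_right, inner_sub_left]; ring
    have b1 := h x' hx' u' hu'
    have b2 : inner ℝ u' (G (x - x')) ≤ ‖G‖ / 4 := by
      refine (real_inner_le_norm _ _).trans ?_
      rw [h₂' u' hu', one_mul]
      refine (G.le_opNorm _).trans ?_
      nlinarith [norm_nonneg G]
    have b3 : inner ℝ (u - u') (G x) ≤ ‖G‖ / 4 := by
      refine (real_inner_le_norm _ _).trans ?_
      have := G.le_opNorm x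
      rw [hx, mul_one] at this
      nlinarith [norm_nonneg G, norm_nonneg (G x), norm_nonneg (u - u')]
    linarith
  linarith

end OpNorm

/-! ### Compressed Gaussian matrices -/

section GaussMatrix

variable {Ω : Type*} [MeasurableSpace Ω] {P : Measure Ω} [IsProbabilityMeasure P]
  {α β : Type*} [Fintype α] [Fintype β] [DecidableEq β]
  {F : Type*} [NormedAddCommGroup F] [InnerProductSpace ℝ F] [FiniteDimensional ℝ F]

/-- The compression `U† ∘ A` of a matrix to the range of an isometry `U`. -/
noncomputable def compress (U : F →ₗᵢ[ℝ] EuclideanSpace ℝ α) (A : Matrix α β ℝ) :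
    EuclideanSpace ℝ β →L[ℝ] F :=
  (LinearMap.adjoint U.toLinearMap ∘ₗ Matrix.toEuclideanLin A).toContinuousLinearMap

lemma inner_compress (U : F →ₗᵢ[ℝ] EuclideanSpace ℝ α) (A : Matrix α β ℝ)
    (x : EuclideanSpace ℝ β) (u : F) :
    inner ℝ u (compress U A x) = ∑ p : α × β, (U u p.1 * x p.2) * A p.1 p.2 := by
  have : inner ℝ u (compress U A x) = inner ℝ (U u) (Matrix.toEuclideanLin A x) := by
    simp only [compress, LinearMap.coe_toContinuousLinearMap', LinearMap.comp_apply]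
    exact LinearMap.adjoint_inner_right _ _ _
  rw [this, PiLp.inner_apply, Fintype.sum_prod_type]
  refine Finset.sum_congr rfl fun i _ => ?_
  simp only [Matrix.toLpLin_apply, Matrix.mulVec, dotProduct]
  simp only [RCLike.inner_apply, conj_trivial, Finset.sum_mul]
  refine Finset.sum_congr rfl fun j _ => by ring

lemma norm_compress_apply_le (U : F →ₗᵢ[ℝ] EuclideanSpace ℝ α) (A : Matrix α β ℝ)
    (x : EuclideanSpace ℝ β) : ‖compress U A x‖ ≤ ‖Matrix.toEuclideanLin A x‖ := by
  have h : ‖compress U A x‖ ^ 2 = inner ℝ (U (compress U A x)) (Matrix.toEuclideanLin A x) := by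
    rw [← real_inner_self_eq_norm_sq]
    exact LinearMap.adjoint_inner_right U.toLinearMap _ _
  have h2 := real_inner_le_norm (U (compress U A x)) (Matrix.toEuclideanLin A x)
  rw [U.norm_map, ← h, sq] at h2
  by_contra hc
  push Not at hc
  nlinarith [norm_nonneg (Matrix.toEuclideanLin A x)]

/-- The image of a fixed vector is linear in the entries, with coefficients independent of the
matrix: the form required by `GaussFam.small_ball`. -/
lemma compress_apply_eq_sum (U : F →ₗᵢ[ℝ] EuclideanSpace ℝ α)
    (x : EuclideanSpace ℝ β) :
    ∃ c : α × β → F, (∀ p u, inner ℝ u (c p) = U u p.1 * x p.2) ∧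
      ∀ A : Matrix α β ℝ, compress U A x = ∑ p, A p.1 p.2 • c p := by
  classical
  have hs : ∀ p : α × β, ∀ u, inner ℝ u (x p.2 • LinearMap.adjoint U.toLinearMap
      (EuclideanSpace.single p.1 (1 : ℝ))) = U u p.1 * x p.2 := by
    intro p u
    rw [real_inner_smul_right, LinearMap.adjoint_inner_right, mul_comm]
    simp [PiLp.inner_apply]
  refine ⟨fun p => x p.2 • LinearMap.adjoint U.toLinearMap
    (EuclideanSpace.single p.1 (1 : ℝ)), hs, fun A => ?_⟩
  refine ext_inner_left ℝ fun u => ?_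
  rw [inner_compress, inner_sum]
  refine Finset.sum_congr rfl fun p _ => ?_
  rw [real_inner_smul_right, hs, mul_comm]

/-- Tail bound for the norm of a compressed centred Gaussian matrix. -/
lemma GaussFam.norm_compress_tail {X : α × β → Ω → ℝ} {b a : α × β → ℝ} (hX : GaussFam P X b a)
    (ha : ∀ p, a p ^ 2 ≤ 1) (U : F →ₗᵢ[ℝ] EuclideanSpace ℝ α) {s : ℝ} (hs : 0 ≤ s) :
    P.real {ω | 2 * s < ‖compress U (Matrix.of fun i j => X (i, j) ω - b (i, j))‖}
      ≤ 12 ^ (Module.finrank ℝ F + Fintype.card β) * Real.exp (-s ^ 2 / 2) := by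
  obtain ⟨N₁, h1, h2, h3⟩ := exists_net {x : EuclideanSpace ℝ β | ‖x‖ = 1} (fun x hx => le_of_eq hx)
    (θ := 1 / 4) (by norm_num) (by norm_num)
  obtain ⟨N₂, k1, k2, k3⟩ := exists_net {x : F | ‖x‖ = 1} (fun x hx => le_of_eq hx)
    (θ := 1 / 4) (by norm_num) (by norm_num)
  set Z : Ω → EuclideanSpace ℝ β →L[ℝ] F := fun ω =>
    compress U (Matrix.of fun i j => X (i, j) ω - b (i, j)) with hZ
  have hsub : {ω | 2 * s < ‖Z ω‖} ⊆
      ⋃ p ∈ N₁ ×ˢ N₂, {ω | s ≤ ∑ i : α × β, (U p.2 i.1 * p.1 i.2) * (X i ω - b i)} := by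
    intro ω hω
    by_contra hc
    simp only [Set.mem_iUnion, Set.mem_ofPred_eq, not_exists, not_le, Finset.mem_product] at hc
    refine absurd (opNorm_le_of_nets (Z ω) N₁ N₂ h2 k1 k2 hs ?_) (not_le.mpr hω)
    intro x hx y hy
    have := hc (x, y) ⟨hx, hy⟩
    rw [hZ, inner_compress]
    exact this.le
  calc P.real {ω | 2 * s < ‖Z ω‖} ≤ P.real (⋃ p ∈ N₁ ×ˢ N₂,
        {ω | s ≤ ∑ i : α × β, (U p.2 i.1 * p.1 i.2) * (X i ω - b i)}) := measureReal_mono hsub (measure_ne_top _ _)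
    _ ≤ ∑ p ∈ N₁ ×ˢ N₂, P.real {ω | s ≤ ∑ i : α × β, (U p.2 i.1 * p.1 i.2) * (X i ω - b i)} :=
        measureReal_biUnion_finset_le _ _
    _ ≤ ∑ p ∈ N₁ ×ˢ N₂, Real.exp (-s ^ 2 / 2) := by
        refine Finset.sum_le_sum fun p hp => ?_
        rw [Finset.mem_product] at hp
        refine hX.tail _ ?_ hs
        have e1 : ‖p.1‖ = 1 := h1 _ hp.1
        have e2 : ‖U p.2‖ = 1 := by rw [U.norm_map]; exact k1 _ hp.2
        calc ∑ i : α × β, a i ^ 2 * (U p.2 i.1 * p.1 i.2) ^ 2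
            ≤ ∑ i : α × β, (U p.2 i.1) ^ 2 * (p.1 i.2) ^ 2 := by
              refine Finset.sum_le_sum fun i _ => ?_
              rw [mul_pow]
              exact mul_le_of_le_one_left (by positivity) (ha i)
          _ = (∑ i, (U p.2 i) ^ 2) * ∑ j, (p.1 j) ^ 2 := by
              rw [Fintype.sum_prod_type, Finset.sum_mul_sum]
          _ = ‖U p.2‖ ^ 2 * ‖p.1‖ ^ 2 := by
              rw [EuclideanSpace.norm_sq_eq, EuclideanSpace.norm_sq_eq]; simp
          _ ≤ 1 := by rw [e1, e2]; norm_num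
    _ = (N₁.card : ℝ) * N₂.card * Real.exp (-s ^ 2 / 2) := by
        rw [Finset.sum_const, Finset.card_product, nsmul_eq_mul]; push_cast; ring
    _ ≤ _ := by
        rw [finrank_euclideanSpace] at h3
        norm_num at h3 k3
        rw [pow_add, mul_comm ((12 : ℝ) ^ Module.finrank ℝ F)]
        gcongr

end GaussMatrix

end SingularGaussian

/-! ### Union bound over nearly sparse vectors -/

namespace SingularGaussian

/-- The Euclidean operator norm of a matrix with arbitrary finite index types. -/
noncomputable def matNorm {α β : Type*} [Fintype α] [Fintype β] [DecidableEq β]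
    (A : Matrix α β ℝ) : ℝ :=
  ‖(Matrix.toEuclideanLin A).toContinuousLinearMap‖

lemma norm_toEuclideanLin_le {α β : Type*} [Fintype α] [Fintype β] [DecidableEq β]
    (A : Matrix α β ℝ) (x : EuclideanSpace ℝ β) :
    ‖Matrix.toEuclideanLin A x‖ ≤ matNorm A * ‖x‖ :=
  (Matrix.toEuclideanLin A).toContinuousLinearMap.le_opNorm x

/-- Otherwise the coordinates above the threshold would be the support of a sparse approximation:
the others, at most n in number, contribute at most n · σ²/n. -/
lemma card_le_of_not_nearSparse {β : Type*} [Fintype β] [DecidableEq β] {k σ : ℝ} {n : ℕ}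
    (hn : 0 < n) (hβ : Fintype.card β ≤ n) {x : EuclideanSpace ℝ β} (hx : ¬ NearSparse k σ x) :
    k < ((Finset.univ.filter fun j => σ ^ 2 / n ≤ x j ^ 2).card : ℝ) := by
  by_contra hc
  push Not at hc
  refine hx ⟨_, hc, ?_⟩
  set S := Finset.univ.filter fun j => σ ^ 2 / n ≤ x j ^ 2
  calc ∑ i ∈ Sᶜ, x i ^ 2 ≤ ∑ i ∈ Sᶜ, σ ^ 2 / n := by
        refine Finset.sum_le_sum fun i hi => ?_
        simp only [S, Finset.mem_compl, Finset.mem_filter, Finset.mem_univ, true_and, not_le] at hi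
        exact hi.le
    _ = Sᶜ.card * (σ ^ 2 / n) := by rw [Finset.sum_const, nsmul_eq_mul]
    _ ≤ n * (σ ^ 2 / n) := by
        gcongr
        exact (Finset.card_le_univ _).trans hβ
    _ = σ ^ 2 := by field_simp

section GaussMatrix

variable {Ω : Type*} [MeasurableSpace Ω] {P : Measure Ω} [IsProbabilityMeasure P]
  {α β : Type*} [Fintype α] [Fintype β] [DecidableEq β]
  {F : Type*} [NormedAddCommGroup F] [InnerProductSpace ℝ F] [FiniteDimensional ℝ F]

/-- The random matrix assembled from a family of random variables. -/
def randMat (X : α × β → Ω → ℝ) (ω : Ω) : Matrix α β ℝ := Matrix.of fun i j => X (i, j) ω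

lemma GaussFam.small_ball_compress {X : α × β → Ω → ℝ} {b a : α × β → ℝ} (hX : GaussFam P X b a)
    (U : F →ₗᵢ[ℝ] EuclideanSpace ℝ α) (x : EuclideanSpace ℝ β) {v s : ℝ} (hv : 0 < v) (hs : 0 < s)
    (h : ∀ u : F, v ^ 2 * ‖u‖ ^ 2 ≤ ∑ p : α × β, a p ^ 2 * (U u p.1 * x p.2) ^ 2) :
    P.real {ω | ‖compress U (randMat X ω) x‖ ≤ s * √(Module.finrank ℝ F)}
      ≤ (2 * s / v) ^ Module.finrank ℝ F := by
  obtain ⟨c, hc1, hc2⟩ := compress_apply_eq_sum U x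
  have := hX.small_ball c hv hs (fun u => by simpa only [hc1] using h u)
  simp_rw [hc2]
  exact this

/-- Small ball estimate for `‖W x‖` using only the rows in `T`. -/
lemma GaussFam.small_ball_rows {X : α × β → Ω → ℝ} {b a : α × β → ℝ} (hX : GaussFam P X b a)
    (x : EuclideanSpace ℝ β) {v s : ℝ} (hv : 0 < v) (hs : 0 < s) (T : Finset α)
    (h : ∀ i ∈ T, v ^ 2 ≤ ∑ j, a (i, j) ^ 2 * x j ^ 2) :
    P.real {ω | ‖Matrix.toEuclideanLin (randMat X ω) x‖ ≤ s * √(T.card : ℝ)}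
      ≤ (2 * s / v) ^ T.card := by
  classical
  have hg : Function.Injective (fun p : T × β => ((p.1 : α), p.2)) := by
    rintro ⟨i, j⟩ ⟨i', j'⟩ h
    simp only [Prod.mk.injEq] at h
    exact Prod.ext (Subtype.ext h.1) h.2
  have h1 := (hX.precomp hg).small_ball_compress
    (LinearIsometry.id (R := ℝ) (E := EuclideanSpace ℝ T)) x hv hs (fun u => by
      rw [Fintype.sum_prod_type, EuclideanSpace.norm_sq_eq, Finset.mul_sum]
      refine Finset.sum_le_sum fun i _ => ?_
      have := h i i.2
      simp only [LinearIsometry.id_apply, mul_pow, Real.norm_eq_abs, sq_abs]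
      calc v ^ 2 * u i ^ 2 ≤ (∑ j, a (i, j) ^ 2 * x j ^ 2) * u i ^ 2 := by gcongr
        _ = _ := by
          rw [Finset.sum_mul]
          exact Finset.sum_congr rfl fun j _ => by ring)
  rw [finrank_euclideanSpace, Fintype.card_coe] at h1
  refine le_trans (measureReal_mono (fun ω hω => ?_) (measure_ne_top _ _)) h1
  simp only [Set.mem_ofPred_eq] at hω ⊢
  refine (norm_compress_apply_le _ _ _).trans (le_trans ?_ hω)
  have : Matrix.toEuclideanLin (randMat (fun p : T × β => X ((p.1 : α), p.2)) ω) x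
      = coordRestrict T (Matrix.toEuclideanLin (randMat X ω) x) := by
    ext i
    rfl
  rw [this]
  exact norm_coordRestrict_le _ _

/-- Union bound over a net of nearly sparse vectors. -/
lemma GaussFam.sparse_union {X : α × β → Ω → ℝ} {b a : α × β → ℝ} (hX : GaussFam P X b a)
    {n : ℕ} (hn : 0 < n) (hβ : Fintype.card β ≤ n) {γ v L k τ B : ℝ} (hγ : 0 < γ) (hγ1 : γ ≤ 1)
    (hv : 0 < v) (hv1 : v ≤ 1) (hL : 1 ≤ L) (hk : 0 ≤ k) (hkn : k ≤ n) (hτ : 0 < τ)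
    (hB : B = 8 * L / (√γ * v)) (hτB : B * τ ≤ (6 * Real.exp 1 * B) ^ (-(1 / γ)))
    (V : Set (EuclideanSpace ℝ β)) (hV : ∀ x ∈ V, ‖x‖ = 1) (hVk : ∀ x ∈ V, NearSparse k τ x)
    (hT : ∀ x ∈ V, ∃ T : Finset α, k + γ * n ≤ T.card ∧
      ∀ i ∈ T, v ^ 2 ≤ ∑ j, a (i, j) ^ 2 * x j ^ 2) :
    P.real {ω | matNorm (randMat X ω) ≤ L * √n ∧
      ∃ x ∈ V, ‖Matrix.toEuclideanLin (randMat X ω) x‖ ≤ τ * L * √n} ≤ Real.exp (-n) := by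
  have hn' : (0 : ℝ) < n := by exact_mod_cast hn
  have hsγ : 0 < √γ := Real.sqrt_pos.mpr hγ
  have hsγ1 : √γ ≤ 1 := Real.sqrt_le_one.mpr hγ1
  have hB8 : 8 ≤ B := by
    rw [hB, le_div_iff₀ (by positivity)]
    nlinarith [mul_le_one₀ hsγ1 hv.le hv1]
  have hB0 : 0 < B := by linarith
  have he : 1 ≤ Real.exp 1 := Real.one_le_exp (by norm_num)
  have h6 : 1 ≤ 6 * Real.exp 1 * B := by nlinarith
  have hBτ1 : B * τ ≤ 1 := hτB.trans
    (Real.rpow_le_one_of_one_le_of_nonpos h6 (by rw [neg_nonpos]; positivity))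
  have hτ1 : τ ≤ 1 := by nlinarith
  obtain ⟨N, hN1, hN2, hN3⟩ := exists_net_of_nearSparse hτ hτ1 V (fun x hx => (hV x hx).le) hVk
  -- The factor 4 is τ for the vector of `V` plus 3τ for the net error.
  have hpt : ∀ x ∈ N, P.real {ω | ‖Matrix.toEuclideanLin (randMat X ω) x‖ ≤ 4 * τ * L * √n}
      ≤ (B * τ) ^ (k + γ * n) := by
    intro x hx
    obtain ⟨T, hT1, hT2⟩ := hT x (hN1 x hx)
    have hTγ : γ * n ≤ T.card := by linarith
    have hT0 : (0 : ℝ) < T.card := lt_of_lt_of_le (by positivity) hTγ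
    have hsT : 0 < √(T.card : ℝ) := Real.sqrt_pos.mpr hT0
    have h1 := hX.small_ball_rows x hv (s := 4 * τ * L * √n / √(T.card : ℝ)) (by positivity) T hT2
    rw [div_mul_cancel₀ _ hsT.ne'] at h1
    refine h1.trans ?_
    have h2 : 2 * (4 * τ * L * √n / √(T.card : ℝ)) / v ≤ B * τ := by
      have h3 : √γ * √n ≤ √(T.card : ℝ) := by
        rw [← Real.sqrt_mul hγ.le]; exact Real.sqrt_le_sqrt hTγ
      rw [hB]
      have h4 : 0 < √γ * √n := mul_pos hsγ (Real.sqrt_pos.mpr hn')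
      have h5 : (0 : ℝ) < √n := Real.sqrt_pos.mpr hn'
      calc 2 * (4 * τ * L * √n / √(T.card : ℝ)) / v
          ≤ 2 * (4 * τ * L * √n / (√γ * √n)) / v := by gcongr
        _ = _ := by field_simp; ring
    calc _ ≤ (B * τ) ^ T.card := by gcongr
      _ = (B * τ) ^ (T.card : ℝ) := (Real.rpow_natCast _ _).symm
      _ ≤ _ := Real.rpow_le_rpow_of_exponent_ge (by positivity) hBτ1 hT1
  have hsub : {ω | matNorm (randMat X ω) ≤ L * √n ∧
      ∃ x ∈ V, ‖Matrix.toEuclideanLin (randMat X ω) x‖ ≤ τ * L * √n} ⊆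
      ⋃ x ∈ N, {ω | ‖Matrix.toEuclideanLin (randMat X ω) x‖ ≤ 4 * τ * L * √n} := by
    rintro ω ⟨h1, x, hx, h2⟩
    obtain ⟨y, hy, hxy⟩ := hN2 x hx
    refine Set.mem_biUnion hy ?_
    have h3 : Matrix.toEuclideanLin (randMat X ω) y = Matrix.toEuclideanLin (randMat X ω) x
        - Matrix.toEuclideanLin (randMat X ω) (x - y) := by rw [map_sub]; abel
    have h4 : ‖Matrix.toEuclideanLin (randMat X ω) (x - y)‖ ≤ L * √n * (3 * τ) :=
      (norm_toEuclideanLin_le _ _).trans (mul_le_mul h1 hxy (norm_nonneg _) (by positivity))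
    simp only [Set.mem_ofPred_eq]
    rw [h3]
    refine (norm_sub_le _ _).trans ?_
    linarith
  have hpos : 0 ≤ (B * τ) ^ (k + γ * n) := by positivity
  calc _ ≤ P.real (⋃ x ∈ N, {ω | ‖Matrix.toEuclideanLin (randMat X ω) x‖ ≤ 4 * τ * L * √n}) :=
        measureReal_mono hsub (measure_ne_top _ _)
    _ ≤ ∑ x ∈ N, P.real {ω | ‖Matrix.toEuclideanLin (randMat X ω) x‖ ≤ 4 * τ * L * √n} :=
        measureReal_biUnion_finset_le _ _
    _ ≤ ∑ x ∈ N, (B * τ) ^ (k + γ * n) := Finset.sum_le_sum hpt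
    _ = N.card * (B * τ) ^ (k + γ * n) := by rw [Finset.sum_const, nsmul_eq_mul]
    _ ≤ (2 ^ Fintype.card β * (3 / τ) ^ k) * (B * τ) ^ (k + γ * n) := by gcongr
    _ ≤ (2 ^ n * (3 / τ) ^ k) * (B * τ) ^ (k + γ * n) := by
        gcongr
        norm_num
    -- The entropy exponent k cancels against k small ball factors. The γn spare factors are at most
    -- (6eB)^(-n) by `hτB`, which beats 2^n (3B)^n.
    _ = 2 ^ n * (3 * B) ^ k * (B * τ) ^ (γ * n) := by
        rw [Real.rpow_add (by positivity), mul_assoc (2 ^ n), mul_assoc (2 ^ n), ← mul_assoc (_ ^ k),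
          ← Real.mul_rpow (by positivity) (by positivity)]
        congr 3
        field_simp
    _ ≤ 2 ^ n * (3 * B) ^ (n : ℝ) * ((6 * Real.exp 1 * B) ^ (-(1 / γ))) ^ (γ * n) := by
        gcongr
        linarith
    _ = 2 ^ n * (3 * B) ^ n * ((6 * Real.exp 1 * B) ^ n)⁻¹ := by
        rw [← Real.rpow_mul (by positivity), ← Real.rpow_natCast (6 * Real.exp 1 * B),
          ← Real.rpow_neg (by positivity), Real.rpow_natCast (3 * B)]
        congr 2
        field_simp
    _ = Real.exp (-n) := by
        rw [← mul_pow, ← inv_pow, ← mul_pow, Real.exp_neg, ← Real.exp_one_pow, ← inv_pow]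
        congr 1
        field_simp
        norm_num

omit [DecidableEq β] in
/-- Many rows see a fixed unit vector when all columns carry mass at least `ρ n`. -/
lemma exists_rows_of_colsum {a : α × β → ℝ} (ha : ∀ p, a p ^ 2 ≤ 1) {n : ℕ}
    (hα : Fintype.card α ≤ n) {ρ : ℝ} (hρ : 0 < ρ)
    (hcol : ∀ j, ρ * n ≤ ∑ i, a (i, j) ^ 2) {x : EuclideanSpace ℝ β} (hx : ‖x‖ = 1) :
    ∃ T : Finset α, ρ / 2 * n ≤ T.card ∧ ∀ i ∈ T, ρ / 2 ≤ ∑ j, a (i, j) ^ 2 * x j ^ 2 := by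
  classical
  have hx2 : ∑ j, x j ^ 2 = 1 := by
    have := EuclideanSpace.norm_sq_eq x
    rw [hx] at this
    simpa using this.symm
  refine ⟨Finset.univ.filter fun i => ρ / 2 ≤ ∑ j, a (i, j) ^ 2 * x j ^ 2, ?_,
    fun i hi => (Finset.mem_filter.mp hi).2⟩
  set T := Finset.univ.filter fun i => ρ / 2 ≤ ∑ j, a (i, j) ^ 2 * x j ^ 2 with hT
  have h1 : ρ * n ≤ ∑ i, ∑ j, a (i, j) ^ 2 * x j ^ 2 := by
    rw [Finset.sum_comm]
    calc ρ * n = ∑ j, ρ * n * x j ^ 2 := by rw [← Finset.mul_sum, hx2, mul_one]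
      _ ≤ _ := Finset.sum_le_sum fun j _ => by
        rw [← Finset.sum_mul]
        exact mul_le_mul_of_nonneg_right (hcol j) (sq_nonneg _)
  have h2 : ∀ i, ∑ j, a (i, j) ^ 2 * x j ^ 2 ≤ 1 := fun i => by
    rw [← hx2]
    exact Finset.sum_le_sum fun j _ => mul_le_of_le_one_left (sq_nonneg _) (ha _)
  -- The total is at least ρn, while rows in `T` contribute at most 1 each and the others at most
  -- ρ/2 each.
  have h3 : ∑ i, ∑ j, a (i, j) ^ 2 * x j ^ 2 ≤ T.card + n * (ρ / 2) := by
    rw [← Finset.sum_add_sum_compl T]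
    refine add_le_add ?_ ?_
    · calc _ ≤ ∑ i ∈ T, (1 : ℝ) := Finset.sum_le_sum fun i _ => h2 i
        _ = _ := by simp
    · calc _ ≤ ∑ i ∈ Tᶜ, ρ / 2 := Finset.sum_le_sum fun i hi => by
            simp only [hT, Finset.mem_compl, Finset.mem_filter, Finset.mem_univ, true_and, not_le] at hi
            exact hi.le
        _ = Tᶜ.card * (ρ / 2) := by rw [Finset.sum_const, nsmul_eq_mul]
        _ ≤ n * (ρ / 2) := by
            gcongr
            exact (Finset.card_le_univ _).trans hα
  linarith

end GaussMatrix

end SingularGaussian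

/-! ### Raising the sparsity level by expansion -/

namespace SingularGaussian

/-- In each step B is a constant times a power of the norm level L, and a scale meeting the
condition on τ in `GaussFam.sparse_union` can again be a power of L. This keeps the dependence on K
polynomial. -/
lemma exists_poly_scale {γ b E : ℝ} (hb : 0 < b) (hE : 0 ≤ E) (hγ : 0 < γ) :
    ∃ c C : ℝ, 0 < c ∧ 0 ≤ C ∧ ∀ L : ℝ, 1 ≤ L →
      (b * L ^ E) * (c * L ^ (-C)) ≤ (6 * Real.exp 1 * (b * L ^ E)) ^ (-(1 / γ)) := by
  refine ⟨b⁻¹ * (6 * Real.exp 1 * b) ^ (-(1 / γ)), E + E * (1 / γ), by positivity, by positivity,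
    fun L hL => le_of_eq ?_⟩
  have hL0 : 0 < L := by linarith
  have h1 : L ^ E * L ^ (-(E + E * (1 / γ))) = (L ^ E) ^ (-(1 / γ)) := by
    rw [← Real.rpow_add hL0, ← Real.rpow_mul hL0.le]
    congr 1; ring
  rw [← mul_assoc (6 * Real.exp 1),
    Real.mul_rpow (x := 6 * Real.exp 1 * b) (y := L ^ E) (by positivity) (by positivity), ← h1]
  field_simp

section GaussMatrix

variable {Ω : Type*} [MeasurableSpace Ω] {P : Measure Ω} [IsProbabilityMeasure P]
  {α β : Type*} [Fintype α] [Fintype β] [DecidableEq β]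

/-- Every set of at least `η n` columns is seen with weight `ζ n` by substantially more rows. -/
def Expanding (a : α × β → ℝ) (n : ℕ) (η γ w ζ : ℝ) : Prop :=
  ∀ S : Finset β, η * n ≤ S.card → ∃ R : Finset α, min (S.card + 2 * γ * n) (w * n) ≤ R.card ∧
    ∀ i ∈ R, ζ * n ≤ ∑ j ∈ S, a (i, j) ^ 2

/-- The event that a nearly sparse unit vector is almost annihilated by a bounded matrix. -/
def sparseEvent (X : α × β → Ω → ℝ) (n : ℕ) (L k τ : ℝ) : Set Ω :=
  {ω | matNorm (randMat X ω) ≤ L * √n ∧ ∃ x : EuclideanSpace ℝ β, ‖x‖ = 1 ∧ NearSparse k τ x ∧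
    ‖Matrix.toEuclideanLin (randMat X ω) x‖ ≤ τ * √n}

/-- No expansion is needed at this level: the column sums alone provide (ρ/2)n rows, which is k + γn
for k = (ρ/4)n and γ = ρ/4. -/
lemma GaussFam.sparseEvent_base {X : α × β → Ω → ℝ} {b a : α × β → ℝ} (hX : GaussFam P X b a)
    {n : ℕ} (hn : 0 < n) (hα : Fintype.card α ≤ n) (hβ : Fintype.card β ≤ n)
    (ha : ∀ p, a p ^ 2 ≤ 1) {ρ L τ B : ℝ} (hρ : 0 < ρ) (hρ1 : ρ ≤ 1)
    (hcol : ∀ j, ρ * n ≤ ∑ i, a (i, j) ^ 2) (hL : 1 ≤ L) (hτ : 0 < τ)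
    (hB : B = 8 * L / (√(ρ / 4) * √(ρ / 2)))
    (hτB : B * τ ≤ (6 * Real.exp 1 * B) ^ (-(1 / (ρ / 4)))) :
    P.real (sparseEvent X n L (ρ / 4 * n) τ) ≤ Real.exp (-n) := by
  have hn' : (0 : ℝ) < n := by exact_mod_cast hn
  have := hX.sparse_union hn hβ (γ := ρ / 4) (v := √(ρ / 2)) (k := ρ / 4 * n) (by positivity)
    (by linarith) (by positivity) (Real.sqrt_le_one.mpr (by linarith)) hL (by positivity)
    (by nlinarith) hτ hB hτB {x | ‖x‖ = 1 ∧ NearSparse (ρ / 4 * n) τ x} (fun x hx => hx.1)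
    (fun x hx => hx.2) (fun x hx => by
      obtain ⟨T, hT1, hT2⟩ := exists_rows_of_colsum ha hα hρ hcol hx.1
      refine ⟨T, by linarith, fun i hi => ?_⟩
      rw [Real.sq_sqrt (by positivity)]
      exact hT2 i hi)
  refine le_trans (measureReal_mono ?_ (measure_ne_top _ _)) this
  rintro ω ⟨h1, x, hx1, hx2, hx3⟩
  refine ⟨h1, x, ⟨hx1, hx2⟩, hx3.trans ?_⟩
  gcongr
  nlinarith

/-- A vector that is not nearly un-sparse at scale σ has more than un coordinates of size at least
σ/√n. Expansion gives at least (u + 2γ)n rows where these contribute variance at least ζσ², which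
exceeds the sparsity (u + γ)n of the net by γn. -/
lemma GaussFam.sparseEvent_step {X : α × β → Ω → ℝ} {b a : α × β → ℝ} (hX : GaussFam P X b a)
    {n : ℕ} (hn : 0 < n) (hβ : Fintype.card β ≤ n)
    {η γ w ζ u L σ τ B : ℝ} (hγ : 0 < γ) (hη : 0 ≤ η) (hζ : 0 < ζ) (hζ1 : ζ ≤ 1)
    (hexp : Expanding a n η γ w ζ) (hu : η ≤ u) (hw : u + 2 * γ ≤ w) (hw1 : w ≤ 1)
    (hL : 1 ≤ L) (hσ : 0 < σ) (hσ1 : σ ≤ 1) (hτ : 0 < τ)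
    (hB : B = 8 * L / (√γ * (√ζ * σ))) (hτB : B * τ ≤ (6 * Real.exp 1 * B) ^ (-(1 / γ)))
    (hτσ : τ ≤ σ) :
    P.real (sparseEvent X n L ((u + γ) * n) τ)
      ≤ P.real (sparseEvent X n L (u * n) σ) + Real.exp (-n) := by
  have hn' : (0 : ℝ) < n := by exact_mod_cast hn
  have hu0 : 0 ≤ u := hη.trans hu
  have := hX.sparse_union hn hβ (γ := γ) (v := √ζ * σ) (k := (u + γ) * n) hγ
    (by linarith) (by positivity) (mul_le_one₀ (Real.sqrt_le_one.mpr hζ1) hσ.le hσ1) hL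
    (by positivity) (by nlinarith) hτ hB hτB
    {x | ‖x‖ = 1 ∧ NearSparse ((u + γ) * n) τ x ∧ ¬ NearSparse (u * n) σ x} (fun x hx => hx.1)
    (fun x hx => hx.2.1) (fun x hx => by
      have hS := card_le_of_not_nearSparse hn hβ hx.2.2
      set S := Finset.univ.filter fun j => σ ^ 2 / n ≤ x j ^ 2 with hSdef
      obtain ⟨R, hR1, hR2⟩ := hexp S (by nlinarith)
      refine ⟨R, le_trans (le_min ?_ ?_) hR1, fun i hi => ?_⟩
      · linarith
      · nlinarith
      · rw [mul_pow, Real.sq_sqrt hζ.le]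
        calc ζ * σ ^ 2 = ζ * n * (σ ^ 2 / n) := by field_simp
          _ ≤ (∑ j ∈ S, a (i, j) ^ 2) * (σ ^ 2 / n) := by gcongr; exact hR2 i hi
          _ = ∑ j ∈ S, a (i, j) ^ 2 * (σ ^ 2 / n) := Finset.sum_mul _ _ _
          _ ≤ ∑ j ∈ S, a (i, j) ^ 2 * x j ^ 2 := by
            refine Finset.sum_le_sum fun j hj => ?_
            have := (Finset.mem_filter.mp hj).2
            gcongr
          _ ≤ _ := Finset.sum_le_sum_of_subset_of_nonneg (Finset.subset_univ _)
            fun j _ _ => by positivity)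
  refine le_trans (measureReal_mono ?_ (measure_ne_top _ _))
    ((measureReal_union_le _ _).trans (add_le_add le_rfl this))
  rintro ω ⟨h1, x, hx1, hx2, hx3⟩
  by_cases hx : NearSparse (u * n) σ x
  · left
    refine ⟨h1, x, hx1, hx, hx3.trans ?_⟩
    gcongr
  · right
    refine ⟨h1, x, ⟨hx1, hx2, hx⟩, hx3.trans ?_⟩
    gcongr
    nlinarith

end GaussMatrix

/-- No unit vector close to a very sparse one is almost annihilated. -/
theorem exists_sparse_base (ρ : ℝ) (hρ : 0 < ρ) (hρ1 : ρ ≤ 1) :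
    ∃ c C : ℝ, 0 < c ∧ c ≤ 1 ∧ 0 ≤ C ∧
      ∀ (Ω : Type*) [MeasurableSpace Ω] (P : Measure Ω) [IsProbabilityMeasure P]
        (α β : Type) [Fintype α] [Fintype β] [DecidableEq β] (X : α × β → Ω → ℝ)
        (b a : α × β → ℝ) (n : ℕ) (L : ℝ), GaussFam P X b a → 0 < n → Fintype.card α ≤ n →
        Fintype.card β ≤ n → (∀ p, a p ^ 2 ≤ 1) → (∀ j, ρ * n ≤ ∑ i, a (i, j) ^ 2) → 1 ≤ L →
        P.real (sparseEvent X n L (ρ / 4 * n) (c * L ^ (-C))) ≤ Real.exp (-n) := by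
  obtain ⟨c, C, hc, hC, h⟩ := exists_poly_scale (γ := ρ / 4) (b := 8 / (√(ρ / 4) * √(ρ / 2)))
    (E := 1) (by positivity) zero_le_one (by positivity)
  refine ⟨min c 1, C, by positivity, min_le_right _ _, hC, ?_⟩
  intro Ω _ P _ α β _ _ _ X b a n L hX hn hα hβ ha hcol hL
  have hL0 : 0 < L := by linarith
  exact hX.sparseEvent_base hn hα hβ ha hρ hρ1 hcol hL (τ := min c 1 * L ^ (-C))
    (by positivity) (B := 8 / (√(ρ / 4) * √(ρ / 2)) * L ^ (1 : ℝ))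
    (by rw [Real.rpow_one]; ring) (le_trans (by gcongr; exact min_le_left _ _) (h L hL))

/-- Iteration of the expansion step: no unit vector close to a `(ρ / 4 + l γ) n`-sparse one is almost
annihilated, up to exponentially small probability. -/
theorem exists_sparse_level (ρ γ ζ : ℝ) (hρ : 0 < ρ) (hρ1 : ρ ≤ 1) (hγ : 0 < γ) (hζ : 0 < ζ)
    (hζ1 : ζ ≤ 1) (l : ℕ) :
    ∃ c C : ℝ, 0 < c ∧ c ≤ 1 ∧ 0 ≤ C ∧
      ∀ (Ω : Type*) [MeasurableSpace Ω] (P : Measure Ω) [IsProbabilityMeasure P]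
        (α β : Type) [Fintype α] [Fintype β] [DecidableEq β] (X : α × β → Ω → ℝ)
        (b a : α × β → ℝ) (n : ℕ) (L w : ℝ), GaussFam P X b a → 0 < n → Fintype.card α ≤ n →
        Fintype.card β ≤ n → (∀ p, a p ^ 2 ≤ 1) → (∀ j, ρ * n ≤ ∑ i, a (i, j) ^ 2) →
        Expanding a n (ρ / 4) γ w ζ → w ≤ 1 → (l = 0 ∨ ρ / 4 + l * γ + γ ≤ w) → 1 ≤ L →
        P.real (sparseEvent X n L ((ρ / 4 + l * γ) * n) (c * L ^ (-C)))
          ≤ (l + 1) * Real.exp (-n) := by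
  induction l with
  | zero =>
    obtain ⟨c, C, hc, hc1, hC, h⟩ := exists_sparse_base ρ hρ hρ1
    refine ⟨c, C, hc, hc1, hC, ?_⟩
    intro Ω _ P _ α β _ _ _ X b a n L w hX hn hα hβ ha hcol _ _ _ hL
    simpa using h Ω P α β X b a n L hX hn hα hβ ha hcol hL
  | succ l ih =>
    obtain ⟨c₀, C₀, hc₀, hc₀1, hC₀, ih⟩ := ih
    -- The small ball parameter √ζ · c₀L^(-C₀) contains the previous scale, so B grows like L^(1 +
    -- C₀).
    obtain ⟨c, C, hc, hC, h⟩ := exists_poly_scale (γ := γ) (b := 8 / (√γ * (√ζ * c₀)))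
      (E := 1 + C₀) (by positivity) (by positivity) hγ
    refine ⟨min c c₀, C + C₀, by positivity, (min_le_right _ _).trans hc₀1, by positivity, ?_⟩
    intro Ω _ P _ α β _ _ _ X b a n L w hX hn hα hβ ha hcol hexp hw1 hw hL
    have hL0 : 0 < L := by linarith
    have hw' : ρ / 4 + (l + 1 : ℝ) * γ + γ ≤ w := by
      rcases hw with hw | hw
      · omega
      · exact_mod_cast hw
    have h0 := ih Ω P α β X b a n L w hX hn hα hβ ha hcol hexp hw1 (Or.inr (by linarith)) hL
    have hone : L ^ (-C₀) ≤ 1 := Real.rpow_le_one_of_one_le_of_nonpos hL (by linarith)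
    have hl : (0 : ℝ) ≤ l * γ := by positivity
    have h1 := hX.sparseEvent_step hn hβ hγ (by positivity) hζ hζ1 hexp (u := ρ / 4 + l * γ)
      (by linarith) (by linarith) hw1 hL (σ := c₀ * L ^ (-C₀)) (τ := min c c₀ * L ^ (-(C + C₀)))
      (by positivity) (mul_le_one₀ hc₀1 (by positivity) hone) (by positivity)
      (B := 8 / (√γ * (√ζ * c₀)) * L ^ (1 + C₀)) (by
        rw [Real.rpow_add hL0, Real.rpow_one, Real.rpow_neg hL0.le]
        field_simp)
      (le_trans (by
        gcongr
        · exact min_le_left _ _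
        · linarith) (h L hL)) (by
        gcongr
        · exact min_le_right _ _
        · linarith)
    have e : ρ / 4 + ((l + 1 : ℕ) : ℝ) * γ = ρ / 4 + l * γ + γ := by push_cast; ring
    rw [e]
    push_cast
    linarith

end SingularGaussian

/-! ### A tall Gaussian block with arbitrary mean -/

namespace SingularGaussian

section GaussMatrix

variable {Ω : Type*} [MeasurableSpace Ω] {P : Measure Ω} [IsProbabilityMeasure P]
  {α β : Type*} [Fintype α] [Fintype β] [DecidableEq β]
  {F : Type*} [NormedAddCommGroup F] [InnerProductSpace ℝ F] [FiniteDimensional ℝ F]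

lemma compress_add (U : F →ₗᵢ[ℝ] EuclideanSpace ℝ α) (A B : Matrix α β ℝ) :
    compress U (A + B) = compress U A + compress U B := by
  ext x
  simp [compress]

/-- As q ≤ D/3, the entropy (R + 2)^q grows at most like exp((R + 1)D/3), and the Gaussian tail in R
beats it. The constant 29 bounds the maximum of the resulting quadratic exponent. -/
lemma exp_level_bound (D q R : ℕ) (hqD : 3 * q ≤ D) (hD : 1 ≤ D) :
    ((R : ℝ) + 2) ^ q * Real.exp (-((R : ℝ) ^ 2 * D / 64)) ≤ Real.exp (29 * D) * (1 / 2) ^ R := by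
  have h1 : ((R : ℝ) + 2) ^ q ≤ Real.exp (((R : ℝ) + 1) * (D / 3)) := by
    calc ((R : ℝ) + 2) ^ q ≤ (Real.exp ((R : ℝ) + 1)) ^ q := by
          gcongr
          have := Real.add_one_le_exp ((R : ℝ) + 1)
          linarith
      _ = Real.exp (((R : ℝ) + 1) * q) := by rw [mul_comm, Real.exp_nat_mul]
      _ ≤ _ := by
          apply Real.exp_le_exp.mpr
          have : (3 : ℝ) * q ≤ D := by exact_mod_cast hqD
          have hR : (0 : ℝ) ≤ R := by positivity
          nlinarith
  have h2 : Real.exp (-(R : ℝ)) ≤ (1 / 2) ^ R := by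
    rw [show (-(R : ℝ)) = R * (-1) by ring, Real.exp_nat_mul]
    gcongr
    have := Real.exp_one_gt_d9
    rw [Real.exp_neg, one_div]
    gcongr
    linarith
  have hD' : (1 : ℝ) ≤ D := by exact_mod_cast hD
  have hR : (0 : ℝ) ≤ R := by positivity
  calc _ ≤ Real.exp (((R : ℝ) + 1) * (D / 3)) * Real.exp (-((R : ℝ) ^ 2 * D / 64)) := by gcongr
    _ ≤ Real.exp (29 * D) * Real.exp (-(R : ℝ)) := by
        rw [← Real.exp_add, ← Real.exp_add]
        apply Real.exp_le_exp.mpr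
        have h3 : ((R : ℝ) + 1) / 3 - (R : ℝ) ^ 2 / 64 + R - 29 ≤ 0 := by
          nlinarith [sq_nonneg ((R : ℝ) - 128 / 3)]
        nlinarith
    _ ≤ _ := by gcongr

/-- One level of the block estimate: the fluctuation has norm in `[R √D, (R + 1) √D)`. -/
lemma GaussFam.block_level {X : α × β → Ω → ℝ} {b a : α × β → ℝ} (hX : GaussFam P X b a)
    (ha : ∀ p, a p ^ 2 ≤ 1) (U : F →ₗᵢ[ℝ] EuclideanSpace ℝ α) {v t : ℝ} (hv : 0 < v)
    (ht : 0 < t) (ht1 : t ≤ 1)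
    (hcov : ∀ y : EuclideanSpace ℝ β, ‖y‖ = 1 → ∀ u : F,
      v ^ 2 * ‖u‖ ^ 2 ≤ ∑ p : α × β, a p ^ 2 * (U u p.1 * y p.2) ^ 2)
    {D q : ℕ} (hD : Module.finrank ℝ F = D) (hq : Fintype.card β = q) (hqD : 3 * q ≤ D)
    (hD1 : 1 ≤ D) (R : ℕ) :
    P.real {ω | (∃ y : EuclideanSpace ℝ β, ‖y‖ = 1 ∧ ‖compress U (randMat X ω) y‖ ≤ t * √D) ∧
      R * √D ≤ ‖compress U (Matrix.of fun i j => X (i, j) ω - b (i, j))‖ ∧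
      ‖compress U (Matrix.of fun i j => X (i, j) ω - b (i, j))‖ < (R + 1) * √D}
      ≤ (3 / t) ^ q * √((6 * t / v) ^ D) * 12 ^ D * Real.exp (29 * D) * (1 / 2) ^ R := by
  have hD' : (0 : ℝ) < D := by exact_mod_cast hD1
  have hsD : 0 < √(D : ℝ) := Real.sqrt_pos.mpr hD'
  set G : Ω → EuclideanSpace ℝ β →L[ℝ] F := fun ω =>
    compress U (Matrix.of fun i j => X (i, j) ω - b (i, j)) with hG
  set B : EuclideanSpace ℝ β →L[ℝ] F := compress U (Matrix.of fun i j => b (i, j)) with hB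
  have hM : ∀ ω, compress U (randMat X ω) = B + G ω := fun ω => by
    rw [hB, hG, ← compress_add]
    congr 1
    ext i j
    simp [randMat]
  have hR2 : (0 : ℝ) < R + 2 := by positivity
  set κ : ℝ := (R + 2) * √D with hκ
  have hκ0 : 0 < κ := by positivity
  -- The net is taken for the norm max(‖y‖, ‖B y‖/κ). Its dimension is still at most q, yet it
  -- controls the mean `B` however large ‖B‖ is: on this level a nearly annihilated unit vector y
  -- has ‖B y‖ ≤ κ.
  set Φ : EuclideanSpace ℝ β →ₗ[ℝ] EuclideanSpace ℝ β × F :=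
    LinearMap.prod LinearMap.id (κ⁻¹ • B.toLinearMap) with hΦ
  have hΦ1 : ∀ y, ‖Φ y‖ = max ‖y‖ (κ⁻¹ * ‖B y‖) := fun y => by
    change ‖(y, κ⁻¹ • B y)‖ = _
    rw [Prod.norm_def, norm_smul, norm_inv, Real.norm_of_nonneg hκ0.le]
  have hθ : 0 < t / (R + 2) := by positivity
  have hθ1 : t / (R + 2) ≤ 1 := by
    rw [div_le_one hR2]
    have : (0 : ℝ) ≤ R := by positivity
    linarith
  obtain ⟨N, hN1, hN2, hN3⟩ := exists_net_comap Φ {y | ‖y‖ = 1 ∧ ‖B y‖ ≤ κ} (fun y hy => by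
    rw [hΦ1]
    refine max_le hy.1.le ?_
    rw [inv_mul_le_iff₀ hκ0, mul_one]
    exact hy.2) hθ hθ1
  set p₁ : ℝ := (6 * t / v) ^ D with hp₁
  set p₂ : ℝ := 12 ^ (2 * D) * Real.exp (-((R : ℝ) ^ 2 * D / 32)) with hp₂
  have hp1 : ∀ y ∈ N, P.real {ω | ‖compress U (randMat X ω) y‖ ≤ 3 * t * √D} ≤ p₁ := fun y hy => by
    have h1 := hX.small_ball_compress U y hv (s := 3 * t) (by positivity) (hcov y (hN1 y hy).1)
    rw [hD] at h1
    refine h1.trans (le_of_eq ?_)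
    rw [hp₁]
    congr 1; ring
  have hp2 : P.real {ω | R * √D ≤ ‖G ω‖} ≤ p₂ := by
    rcases Nat.eq_zero_or_pos R with rfl | hR
    · refine measureReal_le_one.trans ?_
      rw [hp₂]
      simp only [CharP.cast_eq_zero, ne_eq, OfNat.ofNat_ne_zero, not_false_eq_true, zero_pow,
        zero_mul, zero_div, neg_zero, Real.exp_zero, mul_one]
      exact one_le_pow₀ (by norm_num)
    · have hR' : (0 : ℝ) < R := by exact_mod_cast hR
      -- The tail bound concerns the strict inequality 2s < ‖G‖, so s = R√D/4 leaves room when R >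
      -- 0.
      have h1 := hX.norm_compress_tail ha U (s := R * √D / 4) (by positivity)
      refine (measureReal_mono (fun ω hω => ?_) (measure_ne_top _ _)).trans (h1.trans ?_)
      · simp only [Set.mem_ofPred_eq] at hω ⊢
        have : 0 < R * √(D : ℝ) := by positivity
        refine lt_of_lt_of_le ?_ hω
        linarith
      · rw [hp₂, hD, hq]
        have h2 : -(R * √(D : ℝ) / 4) ^ 2 / 2 = -((R : ℝ) ^ 2 * D / 32) := by
          rw [div_pow, mul_pow, Real.sq_sqrt hD'.le]; ring
        rw [h2]
        gcongr
        · norm_num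
        · omega
  set E : Set Ω := {ω | (∃ y : EuclideanSpace ℝ β, ‖y‖ = 1 ∧
      ‖compress U (randMat X ω) y‖ ≤ t * √D) ∧ R * √D ≤ ‖G ω‖ ∧ ‖G ω‖ < (R + 1) * √D} with hE
  have hsub : E ⊆ ⋃ y ∈ N, ({ω | ‖compress U (randMat X ω) y‖ ≤ 3 * t * √D} ∩
      {ω | R * √D ≤ ‖G ω‖}) := by
    rintro ω ⟨⟨y, hy1, hy2⟩, hω1, hω2⟩
    have hBy : ‖B y‖ ≤ κ := by
      have e : B y = compress U (randMat X ω) y - G ω y := by rw [hM]; simp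
      rw [e]
      refine (norm_sub_le _ _).trans ?_
      have h1 := (G ω).le_opNorm y
      rw [hy1, mul_one] at h1
      have h2 : t * √(D : ℝ) ≤ √D := mul_le_of_le_one_left hsD.le ht1
      rw [hκ]
      linarith
    obtain ⟨y', hy', hyy'⟩ := hN2 y ⟨hy1, hBy⟩
    refine Set.mem_biUnion hy' ⟨?_, hω1⟩
    rw [hΦ1, max_le_iff, inv_mul_le_iff₀ hκ0] at hyy'
    have e : compress U (randMat X ω) y' = compress U (randMat X ω) y - B (y - y') - G ω (y - y') := by
      rw [hM]; simp only [map_sub, add_apply]; abel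
    simp only [Set.mem_ofPred_eq]
    rw [e]
    have h1 : ‖G ω (y - y')‖ ≤ t * √D := by
      calc _ ≤ ‖G ω‖ * ‖y - y'‖ := (G ω).le_opNorm _
        _ ≤ ((R + 2) * √D) * (t / (R + 2)) := by
          gcongr
          · exact hω2.le.trans (by gcongr; norm_num)
          · exact hyy'.1
        _ = _ := by field_simp
    have h2 : ‖B (y - y')‖ ≤ t * √D := by
      refine hyy'.2.trans (le_of_eq ?_)
      rw [hκ]; field_simp
    calc _ ≤ ‖compress U (randMat X ω) y‖ + ‖B (y - y')‖ + ‖G ω (y - y')‖ :=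
          (norm_sub_le _ _).trans (by gcongr; exact norm_sub_le _ _)
      _ ≤ _ := by linarith
  have hp₁0 : 0 ≤ p₁ := by positivity
  have hp₂0 : 0 ≤ p₂ := by positivity
  -- The two events need not be independent. The minimum of p₁ and p₂ is at most their geometric
  -- mean, which halves the small ball exponent to D/2.
  have hcap : ∀ y ∈ N, P.real ({ω | ‖compress U (randMat X ω) y‖ ≤ 3 * t * √D} ∩
      {ω | R * √D ≤ ‖G ω‖}) ≤ √p₁ * √p₂ := fun y hy => by
    have h1 : P.real ({ω | ‖compress U (randMat X ω) y‖ ≤ 3 * t * √D} ∩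
        {ω | R * √D ≤ ‖G ω‖}) ≤ p₁ :=
      (measureReal_mono Set.inter_subset_left (measure_ne_top _ _)).trans (hp1 y hy)
    have h2 : P.real ({ω | ‖compress U (randMat X ω) y‖ ≤ 3 * t * √D} ∩
        {ω | R * √D ≤ ‖G ω‖}) ≤ p₂ :=
      (measureReal_mono Set.inter_subset_right (measure_ne_top _ _)).trans hp2
    rw [← Real.sqrt_mul hp₁0]
    refine Real.le_sqrt_of_sq_le ?_
    rw [sq]
    exact mul_le_mul h1 h2 measureReal_nonneg hp₁0
  have hcard : (N.card : ℝ) ≤ (3 / t) ^ q * ((R : ℝ) + 2) ^ q := by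
    refine hN3.trans ?_
    have h1 : Module.finrank ℝ (LinearMap.range Φ) ≤ q := by
      refine (LinearMap.finrank_range_le Φ).trans ?_
      rw [finrank_euclideanSpace, hq]
    rw [← mul_pow]
    calc _ ≤ (3 / (t / (R + 2)) : ℝ) ^ q := by
          refine pow_le_pow_right₀ ?_ h1
          rw [le_div_iff₀ hθ]; linarith
      _ = _ := by congr 1; field_simp
  have hs2 : √p₂ = 12 ^ D * Real.exp (-((R : ℝ) ^ 2 * D / 64)) := by
    rw [hp₂, Real.sqrt_eq_iff_mul_self_eq (by positivity) (by positivity), two_mul, pow_add]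
    rw [show -((R : ℝ) ^ 2 * D / 32) = -((R : ℝ) ^ 2 * D / 64) + -((R : ℝ) ^ 2 * D / 64) by ring,
      Real.exp_add]
    ring
  calc P.real E ≤ _ := measureReal_mono hsub (measure_ne_top _ _)
    _ ≤ ∑ y ∈ N, P.real ({ω | ‖compress U (randMat X ω) y‖ ≤ 3 * t * √D} ∩
      {ω | R * √D ≤ ‖G ω‖}) := measureReal_biUnion_finset_le _ _
    _ ≤ ∑ y ∈ N, √p₁ * √p₂ := Finset.sum_le_sum hcap
    _ = N.card * (√p₁ * √p₂) := by rw [Finset.sum_const, nsmul_eq_mul]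
    _ ≤ ((3 / t) ^ q * ((R : ℝ) + 2) ^ q) * (√p₁ * √p₂) := by gcongr
    _ = ((3 / t) ^ q * √p₁ * 12 ^ D) *
        (((R : ℝ) + 2) ^ q * Real.exp (-((R : ℝ) ^ 2 * D / 64))) := by rw [hs2]; ring
    _ ≤ ((3 / t) ^ q * √p₁ * 12 ^ D) * (Real.exp (29 * D) * (1 / 2) ^ R) := by
        exact mul_le_mul_of_nonneg_left (exp_level_bound D q R hqD hD1) (by positivity)
    _ = _ := by ring

/-- Smallest singular value of a compressed Gaussian matrix with few columns and arbitrary mean. -/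
lemma GaussFam.block_bound {X : α × β → Ω → ℝ} {b a : α × β → ℝ} (hX : GaussFam P X b a)
    (ha : ∀ p, a p ^ 2 ≤ 1) (U : F →ₗᵢ[ℝ] EuclideanSpace ℝ α) {v t : ℝ} (hv : 0 < v)
    (hv1 : v ≤ 1) (ht : 0 < t) (ht1 : t ≤ 1)
    (hcov : ∀ y : EuclideanSpace ℝ β, ‖y‖ = 1 → ∀ u : F,
      v ^ 2 * ‖u‖ ^ 2 ≤ ∑ p : α × β, a p ^ 2 * (U u p.1 * y p.2) ^ 2)
    {D q : ℕ} (hD : Module.finrank ℝ F = D) (hq : Fintype.card β = q) (hqD : 3 * q ≤ D)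
    (hD1 : 1 ≤ D) :
    P.real {ω | ∃ y : EuclideanSpace ℝ β, ‖y‖ = 1 ∧ ‖compress U (randMat X ω) y‖ ≤ t * √D}
      ≤ (432 * Real.exp 29 / v) ^ D * t ^ ((D : ℝ) / 2 - q) := by
  have hD' : (0 : ℝ) < D := by exact_mod_cast hD1
  have hsD : 0 < √(D : ℝ) := Real.sqrt_pos.mpr hD'
  set G : Ω → EuclideanSpace ℝ β →L[ℝ] F := fun ω =>
    compress U (Matrix.of fun i j => X (i, j) ω - b (i, j)) with hG
  set E : ℕ → Set Ω := fun R => {ω | (∃ y : EuclideanSpace ℝ β, ‖y‖ = 1 ∧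
      ‖compress U (randMat X ω) y‖ ≤ t * √D) ∧ R * √D ≤ ‖G ω‖ ∧ ‖G ω‖ < (R + 1) * √D} with hE
  set Q : ℝ := (3 / t) ^ q * √((6 * t / v) ^ D) * 12 ^ D * Real.exp (29 * D) with hQ
  have hQ0 : 0 ≤ Q := by positivity
  have hlev : ∀ R, P (E R) ≤ ENNReal.ofReal (Q * (1 / 2) ^ R) := fun R => by
    rw [← ofReal_measureReal]
    exact ENNReal.ofReal_le_ofReal
      (hX.block_level ha U hv ht ht1 hcov hD hq hqD hD1 R)
  have hsub : {ω | ∃ y : EuclideanSpace ℝ β, ‖y‖ = 1 ∧ ‖compress U (randMat X ω) y‖ ≤ t * √D} ⊆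
      ⋃ R, E R := by
    intro ω hω
    refine Set.mem_iUnion.mpr ⟨⌊‖G ω‖ / √D⌋₊, hω, ?_, ?_⟩
    · rw [← le_div_iff₀ hsD]
      exact Nat.floor_le (by positivity)
    · rw [← div_lt_iff₀ hsD]
      exact Nat.lt_floor_add_one _
  have hsum : P {ω | ∃ y : EuclideanSpace ℝ β, ‖y‖ = 1 ∧ ‖compress U (randMat X ω) y‖ ≤ t * √D}
      ≤ ENNReal.ofReal (Q * 2) := by
    refine (measure_mono hsub).trans ((measure_iUnion_le _).trans
      ((ENNReal.tsum_le_tsum hlev).trans ?_))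
    rw [← ENNReal.ofReal_tsum_of_nonneg (fun R => by positivity)
      (summable_geometric_two.mul_left Q), tsum_mul_left, tsum_geometric_two]
  have hreal := ENNReal.toReal_le_of_le_ofReal (by positivity) hsum
  refine hreal.trans ?_
  have h1 : √((6 * t / v) ^ D) = (6 / v) ^ ((D : ℝ) / 2) * t ^ ((D : ℝ) / 2) := by
    rw [Real.sqrt_eq_rpow, ← Real.rpow_natCast, ← Real.rpow_mul (by positivity),
      ← Real.mul_rpow (by positivity) (by positivity)]
    congr 1 <;> ring
  have h6v : 1 ≤ 6 / v := by rw [le_div_iff₀ hv]; linarith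
  have h2 : (6 / v) ^ ((D : ℝ) / 2) ≤ (6 / v) ^ D := by
    rw [← Real.rpow_natCast]
    exact Real.rpow_le_rpow_of_exponent_le h6v (by linarith)
  have h3 : (3 / t) ^ q ≤ 3 ^ D * t ^ (-(q : ℝ)) := by
    rw [div_pow, Real.rpow_neg ht.le, Real.rpow_natCast, div_eq_mul_inv]
    gcongr
    · norm_num
    · omega
  have h4 : (2 : ℝ) ≤ 2 ^ D := by
    calc (2 : ℝ) = 2 ^ 1 := by norm_num
      _ ≤ 2 ^ D := pow_le_pow_right₀ (by norm_num) hD1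
  -- 432 = 3 · 6 · 12 · 2 collects the net, the small ball, the norm tail and the sum over levels.
  calc Q * 2 ≤ ((3 ^ D * t ^ (-(q : ℝ))) * ((6 / v) ^ D * t ^ ((D : ℝ) / 2)) * 12 ^ D
        * Real.exp (29 * D)) * 2 ^ D := by
        rw [hQ, h1]
        gcongr
    _ = _ := by
        rw [Real.rpow_sub ht, Real.rpow_neg ht.le, mul_comm (29 : ℝ), Real.exp_nat_mul,
          show 432 * Real.exp 29 / v = 3 * (6 / v) * 12 * Real.exp 29 * 2 by ring]
        simp only [mul_pow]
        ring

end GaussMatrix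

end SingularGaussian

/-! ### Splitting off columns: linear algebra and independence -/

namespace SingularGaussian

lemma exists_submodule_finrank_eq {E : Type*} [NormedAddCommGroup E] [InnerProductSpace ℝ E]
    [FiniteDimensional ℝ E] (K : Submodule ℝ E) {D : ℕ} (hD : D ≤ Module.finrank ℝ K) :
    ∃ K' : Submodule ℝ E, K' ≤ K ∧ Module.finrank ℝ K' = D := by
  obtain ⟨f, hf⟩ := exists_linearIndependent_of_le_finrank hD
  have hf' : LinearIndependent ℝ (fun i => (f i : E)) :=
    hf.map' K.subtype (Submodule.ker_subtype K)
  refine ⟨Submodule.span ℝ (Set.range fun i => (f i : E)), ?_, ?_⟩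
  · rw [Submodule.span_le]
    rintro _ ⟨i, rfl⟩
    exact (f i).2
  · rw [finrank_span_eq_card hf', Fintype.card_fin]

/-- The column space has dimension at most the number of columns, so its orthogonal complement has
room for D dimensions. -/
lemma exists_orthogonal_submodule {α β : Type*} [Fintype α] [Fintype β] [DecidableEq β]
    (A : Matrix α β ℝ) {D : ℕ} (hD : D + Fintype.card β ≤ Fintype.card α) :
    ∃ K : Submodule ℝ (EuclideanSpace ℝ α), Module.finrank ℝ K = D ∧
      ∀ u ∈ K, ∀ x, inner ℝ u (Matrix.toEuclideanLin A x) = 0 := by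
  set R := LinearMap.range (Matrix.toEuclideanLin A)
  have h1 := R.finrank_add_finrank_orthogonal
  have h2 : Module.finrank ℝ R ≤ _ := LinearMap.finrank_range_le (Matrix.toEuclideanLin A)
  rw [finrank_euclideanSpace] at h1 h2
  obtain ⟨K, hK, hKD⟩ := exists_submodule_finrank_eq Rᗮ (D := D) (by omega)
  refine ⟨K, hKD, fun u hu x => ?_⟩
  rw [real_inner_comm]
  exact (Submodule.mem_orthogonal _ _).mp (hK hu) _ ⟨x, rfl⟩

lemma inner_toEuclideanLin {α β : Type*} [Fintype α] [Fintype β] [DecidableEq α] [DecidableEq β]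
    (A : Matrix α β ℝ) (x : EuclideanSpace ℝ β) (y : EuclideanSpace ℝ α) :
    inner ℝ y (Matrix.toEuclideanLin A x) = inner ℝ (Matrix.toEuclideanLin A.transpose y) x := by
  simp only [PiLp.inner_apply, Matrix.toLpLin_apply, Matrix.mulVec, dotProduct,
    RCLike.inner_apply, conj_trivial, Finset.sum_mul, Finset.mul_sum, Matrix.transpose_apply]
  rw [Finset.sum_comm]
  exact Finset.sum_congr rfl fun i _ => Finset.sum_congr rfl fun j _ => by ring

lemma continuous_toEuclideanLin {α β : Type*} [Fintype α] [Fintype β] [DecidableEq β]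
    (x : EuclideanSpace ℝ β) :
    Continuous fun A : Matrix α β ℝ => Matrix.toEuclideanLin A x := by
  simp_rw [Matrix.toLpLin_apply]
  exact (PiLp.continuous_toLp 2 _).comp (continuous_id.matrix_mulVec continuous_const)

lemma toEuclideanLin_split {α β : Type*} [Fintype β] [DecidableEq β]
    (A : Matrix α β ℝ) (J : Finset β) (x : EuclideanSpace ℝ β) :
    Matrix.toEuclideanLin A x =
      Matrix.toEuclideanLin (A.submatrix id ((↑) : J → β)) (coordRestrict J x) +
      Matrix.toEuclideanLin (A.submatrix id ((↑) : ↥Jᶜ → β)) (coordRestrict Jᶜ x) := by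
  ext i
  simp only [Matrix.toLpLin_apply, Matrix.mulVec, dotProduct, PiLp.add_apply, Matrix.submatrix_apply,
    id_eq]
  rw [← Finset.sum_add_sum_compl J, ← Finset.sum_coe_sort J, ← Finset.sum_coe_sort Jᶜ]
  rfl

/-- Deleting columns and transposing does not increase the operator norm. -/
lemma matNorm_transpose_submatrix_le {α β : Type*} [Fintype α] [Fintype β] [DecidableEq α]
    [DecidableEq β] (A : Matrix α β ℝ) (J : Finset β) :
    matNorm (A.submatrix id ((↑) : J → β)).transpose ≤ matNorm A := by
  refine ContinuousLinearMap.opNorm_le_bound _ (norm_nonneg _) fun z => ?_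
  set w : EuclideanSpace ℝ J := Matrix.toEuclideanLin (A.submatrix id ((↑) : J → β)).transpose z
    with hw
  change ‖w‖ ≤ _
  set x : EuclideanSpace ℝ β := WithLp.toLp 2 fun j => if h : j ∈ J then w ⟨j, h⟩ else 0 with hx
  have hxJ : coordRestrict J x = w := by
    ext i
    change (if h : (i : β) ∈ J then w ⟨i, h⟩ else 0) = _
    simp
  have hxJc : coordRestrict Jᶜ x = 0 := by
    ext i
    change (if h : (i : β) ∈ J then w ⟨i, h⟩ else 0) = _
    have := Finset.mem_compl.mp i.2
    simp [this]
  have hxn : ‖x‖ = ‖w‖ := by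
    have h := norm_sq_eq_add_compl J x
    rw [hxJ, hxJc, norm_zero] at h
    have h' : ‖x‖ ^ 2 = ‖w‖ ^ 2 := by rw [h]; ring
    exact (sq_eq_sq₀ (norm_nonneg _) (norm_nonneg _)).mp h'
  have h1 : ‖w‖ ^ 2 = inner ℝ z (Matrix.toEuclideanLin A x) := by
    rw [toEuclideanLin_split A J x, hxJ, hxJc, map_zero, add_zero, inner_toEuclideanLin, ← hw,
      real_inner_self_eq_norm_sq]
  have h2 : ‖w‖ ^ 2 ≤ ‖z‖ * (matNorm A * ‖w‖) := by
    rw [h1]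
    refine (real_inner_le_norm _ _).trans ?_
    gcongr
    rw [← hxn]
    exact norm_toEuclideanLin_le A x
  by_contra hc
  push Not at hc
  have h0 : 0 ≤ matNorm A * ‖z‖ := mul_nonneg (norm_nonneg _) (norm_nonneg _)
  change matNorm A * ‖z‖ < ‖w‖ at hc
  nlinarith

section Independence

variable {Ω : Type*} [MeasurableSpace Ω] {P : Measure Ω} [IsProbabilityMeasure P]

/-- Fubini: a bound uniform in the frozen value of Z survives integration over Z. It serves to
freeze the columns outside a block. -/
lemma measureReal_le_of_indepFun {𝓨 𝓩 : Type*} [MeasurableSpace 𝓨] [MeasurableSpace 𝓩]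
    {Y : Ω → 𝓨} {Z : Ω → 𝓩} (hY : Measurable Y) (hZ : Measurable Z) (h : IndepFun Y Z P)
    {S : Set (𝓨 × 𝓩)} (hS : MeasurableSet S) {p : ℝ} (hp : 0 ≤ p)
    (hb : ∀ z, P.real {ω | (Y ω, z) ∈ S} ≤ p) : P.real {ω | (Y ω, Z ω) ∈ S} ≤ p := by
  have : IsProbabilityMeasure (P.map Y) := Measure.isProbabilityMeasure_map hY.aemeasurable
  have : IsProbabilityMeasure (P.map Z) := Measure.isProbabilityMeasure_map hZ.aemeasurable
  refine ENNReal.toReal_le_of_le_ofReal hp ?_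
  have h1 : P {ω | (Y ω, Z ω) ∈ S} = P.map (fun ω => (Y ω, Z ω)) S :=
    (Measure.map_apply (hY.prodMk hZ) hS).symm
  rw [h1, (indepFun_iff_map_prod_eq_prod_map_map hY.aemeasurable hZ.aemeasurable).mp h,
    Measure.prod_apply_symm hS]
  calc ∫⁻ z, P.map Y ((fun y => (y, z)) ⁻¹' S) ∂P.map Z ≤ ∫⁻ _, ENNReal.ofReal p ∂P.map Z := by
        refine lintegral_mono fun z => ?_
        rw [Measure.map_apply hY (measurable_prodMk_right hS)]
        rw [← ofReal_measureReal]
        exact ENNReal.ofReal_le_ofReal (hb z)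
    _ = ENNReal.ofReal p := by simp

variable {α β : Type*} [Fintype α] [Fintype β] [DecidableEq β]

omit [IsProbabilityMeasure P] in
lemma GaussFam.indepFun_columns [DecidableEq α] {X : α × β → Ω → ℝ} {b a : α × β → ℝ}
    (hX : GaussFam P X b a) (J : Finset β) :
    IndepFun (fun ω (i : α) (j : J) => X (i, (j : β)) ω)
      (fun ω (i : α) (j : ↥Jᶜ) => X (i, (j : β)) ω) P := by
  have hd : Disjoint ((Finset.univ : Finset α) ×ˢ J) ((Finset.univ : Finset α) ×ˢ Jᶜ) :=
    Finset.disjoint_product.mpr (Or.inr disjoint_compl_right)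
  have h := hX.indep.indepFun_finset _ _ hd hX.meas
  refine h.comp
    (φ := fun f : (((Finset.univ : Finset α) ×ˢ J : Finset (α × β)) → ℝ) =>
      fun (i : α) (j : J) => f ⟨(i, j), by simp⟩)
    (ψ := fun f : (((Finset.univ : Finset α) ×ˢ Jᶜ : Finset (α × β)) → ℝ) =>
      fun (i : α) (j : ↥Jᶜ) => f ⟨(i, j), by simp⟩) ?_ ?_
  · exact measurable_pi_lambda _ fun i => measurable_pi_lambda _ fun j => measurable_pi_apply _
  · exact measurable_pi_lambda _ fun i => measurable_pi_lambda _ fun j => measurable_pi_apply _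

end Independence

end SingularGaussian

/-! ### Distance from a block to the span of the other columns -/

namespace SingularGaussian

section Block

variable {Ω : Type*} [MeasurableSpace Ω] {P : Measure Ω} [IsProbabilityMeasure P]
  {α β : Type*} [Fintype α] [Fintype β] [DecidableEq α] [DecidableEq β]

omit [DecidableEq β] in
/-- The covariance of a Gaussian block restricted to a spread subspace. -/
lemma covariance_lower_bound {a : α × β → ℝ} (ha : ∀ p, a p ^ 2 ≤ 1) {n : ℕ}
    (hα : Fintype.card α = n) {ρ k τ : ℝ} (hρ : 0 < ρ)
    (hk : (1 - ρ / 2) * n ≤ k) (hcol : ∀ j, ρ * n ≤ ∑ i, a (i, j) ^ 2)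
    (K : Submodule ℝ (EuclideanSpace ℝ α))
    (hK : ∀ u ∈ K, ‖u‖ = 1 → ¬ NearSparse k τ u)
    (y : EuclideanSpace ℝ β) (hy : ‖y‖ = 1) (u : K) :
    (√(ρ / 2) * τ) ^ 2 * ‖u‖ ^ 2 ≤ ∑ p : α × β, a p ^ 2 * (K.subtypeₗᵢ u p.1 * y p.2) ^ 2 := by
  obtain ⟨T, hT1, hT2⟩ := exists_rows_of_colsum ha hα.le hρ hcol hy
  rw [mul_pow, Real.sq_sqrt (by positivity)]
  -- `Tᶜ` has at most k elements and no unit vector of `K` is nearly sparse, so each u in `K` keeps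
  -- norm at least τ‖u‖ on `T`.
  have hspread : τ ^ 2 * ‖u‖ ^ 2 ≤ ∑ i ∈ T, (u : EuclideanSpace ℝ α) i ^ 2 := by
    by_cases hu : u = 0
    · simp [hu]
    have hu' : 0 < ‖u‖ := norm_pos_iff.mpr hu
    have h1 := hK ((‖u‖⁻¹ • u : K) : EuclideanSpace ℝ α) (Subtype.mem _) (by
      rw [← Submodule.coe_norm, norm_smul, norm_inv, norm_norm, inv_mul_cancel₀ hu'.ne'])
    have h2 : τ ^ 2 < ∑ i ∈ T, ((‖u‖⁻¹ • u : K) : EuclideanSpace ℝ α) i ^ 2 := by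
      by_contra hc
      push Not at hc
      refine h1 ⟨Tᶜ, ?_, by rw [compl_compl]; exact hc⟩
      rw [Finset.card_compl, hα, Nat.cast_sub (hα ▸ Finset.card_le_univ T)]
      linarith
    have h3 : ∀ i, ((‖u‖⁻¹ • u : K) : EuclideanSpace ℝ α) i ^ 2
        = (‖u‖ ^ 2)⁻¹ * (u : EuclideanSpace ℝ α) i ^ 2 := fun i => by
      rw [Submodule.coe_smul, PiLp.smul_apply, smul_eq_mul, mul_pow, inv_pow]
    simp_rw [h3] at h2
    rw [← Finset.mul_sum, lt_inv_mul_iff₀ (by positivity)] at h2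
    linarith
  calc ρ / 2 * τ ^ 2 * ‖u‖ ^ 2 ≤ ρ / 2 * ∑ i ∈ T, (u : EuclideanSpace ℝ α) i ^ 2 := by
        rw [mul_assoc]; gcongr
    _ = ∑ i ∈ T, ρ / 2 * (u : EuclideanSpace ℝ α) i ^ 2 := Finset.mul_sum _ _ _
    _ ≤ ∑ i ∈ T, (∑ j, a (i, j) ^ 2 * y j ^ 2) * (u : EuclideanSpace ℝ α) i ^ 2 := by
        refine Finset.sum_le_sum fun i hi => ?_
        gcongr
        exact hT2 i hi
    _ ≤ ∑ i, (∑ j, a (i, j) ^ 2 * y j ^ 2) * (u : EuclideanSpace ℝ α) i ^ 2 :=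
        Finset.sum_le_sum_of_subset_of_nonneg (Finset.subset_univ _) fun i _ _ => by positivity
    _ = _ := by
        rw [Fintype.sum_prod_type]
        refine Finset.sum_congr rfl fun i _ => ?_
        rw [Finset.sum_mul]
        refine Finset.sum_congr rfl fun j _ => ?_
        simp only [Submodule.coe_subtypeₗᵢ, Submodule.subtype_apply]
        ring

/-- Pairs of a block and a complementary matrix such that some unit vector of the block is mapped
close to the column space of the complement, while this column space is in general position. -/
def badBlockSet (J : Finset β) (n : ℕ) (s k τ : ℝ) : Set ((α → J → ℝ) × (α → ↥Jᶜ → ℝ)) :=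
  {p | ∃ (x₁ : EuclideanSpace ℝ J) (x₂ : EuclideanSpace ℝ ↥Jᶜ), ‖x₁‖ = 1 ∧
      ‖Matrix.toEuclideanLin (Matrix.of p.1) x₁ + Matrix.toEuclideanLin (Matrix.of p.2) x₂‖ < s} ∩
    {p | ∃ u : EuclideanSpace ℝ α, ‖u‖ = 1 ∧ NearSparse k τ u ∧
      ‖Matrix.toEuclideanLin (Matrix.of p.2).transpose u‖ < τ * √n}ᶜ

/-- Because of the strict inequalities each existential is a union of open conditions, so the set is
a difference of two open sets. -/
lemma measurableSet_badBlockSet (J : Finset β) (n : ℕ) (s k τ : ℝ) :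
    MeasurableSet (badBlockSet (α := α) J n s k τ) := by
  refine MeasurableSet.inter (IsOpen.measurableSet ?_) (IsOpen.measurableSet ?_).compl
  · have e : {p : (α → J → ℝ) × (α → ↥Jᶜ → ℝ) |
        ∃ (x₁ : EuclideanSpace ℝ J) (x₂ : EuclideanSpace ℝ ↥Jᶜ), ‖x₁‖ = 1 ∧
        ‖Matrix.toEuclideanLin (Matrix.of p.1) x₁ + Matrix.toEuclideanLin (Matrix.of p.2) x₂‖ < s}
        = ⋃ (x₁ : EuclideanSpace ℝ J) (x₂ : EuclideanSpace ℝ ↥Jᶜ) (_ : ‖x₁‖ = 1),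
          {p | ‖Matrix.toEuclideanLin (Matrix.of p.1) x₁ +
            Matrix.toEuclideanLin (Matrix.of p.2) x₂‖ < s} := by
      ext p; simp
    rw [e]
    refine isOpen_iUnion fun x₁ => isOpen_iUnion fun x₂ => isOpen_iUnion fun _ =>
      isOpen_lt (Continuous.norm (Continuous.add ?_ ?_)) continuous_const
    · exact (continuous_toEuclideanLin x₁).comp continuous_fst
    · exact (continuous_toEuclideanLin x₂).comp continuous_snd
  · have e : {p : (α → J → ℝ) × (α → ↥Jᶜ → ℝ) | ∃ u : EuclideanSpace ℝ α, ‖u‖ = 1 ∧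
        NearSparse k τ u ∧ ‖Matrix.toEuclideanLin (Matrix.of p.2).transpose u‖ < τ * √n}
        = ⋃ (u : EuclideanSpace ℝ α) (_ : ‖u‖ = 1) (_ : NearSparse k τ u),
          {p | ‖Matrix.toEuclideanLin (Matrix.of p.2).transpose u‖ < τ * √n} := by
      ext p; simp only [Set.mem_iUnion, Set.mem_ofPred_eq, exists_prop]
    rw [e]
    refine isOpen_iUnion fun u => isOpen_iUnion fun _ => isOpen_iUnion fun _ =>
      isOpen_lt (Continuous.norm ?_) continuous_const
    exact (continuous_toEuclideanLin u).comp ((continuous_id.matrix_transpose).comp continuous_snd)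

/-- A block of columns is unlikely to be mapped close to the span of the other columns. -/
lemma GaussFam.block_event {X : α × β → Ω → ℝ} {b a : α × β → ℝ} (hX : GaussFam P X b a)
    (ha : ∀ p, a p ^ 2 ≤ 1) {n : ℕ} (hn : 0 < n) (hα : Fintype.card α = n)
    {ρ k τ t L : ℝ} (hρ : 0 < ρ) (hρ1 : ρ ≤ 1) (hk : (1 - ρ / 2) * n ≤ k)
    (hcol : ∀ j, ρ * n ≤ ∑ i, a (i, j) ^ 2) (hτ : 0 < τ) (hτ1 : τ ≤ 1) (ht : 0 < t) (ht1 : t ≤ 1)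
    (J : Finset β) {D q : ℕ} (hJ : J.card = q) (hDJ : D + Jᶜ.card ≤ n) (hqD : 3 * q ≤ D)
    (hD1 : 1 ≤ D) :
    P.real {ω | matNorm (randMat X ω) ≤ L * √n ∧ ∃ x : EuclideanSpace ℝ β,
        ‖coordRestrict J x‖ = 1 ∧ ‖Matrix.toEuclideanLin (randMat X ω) x‖ < t * √D}
      ≤ (432 * Real.exp 29 / (√(ρ / 2) * τ)) ^ D * t ^ ((D : ℝ) / 2 - q) +
        P.real (sparseEvent (fun p : ↥Jᶜ × α => X (p.2, (p.1 : β))) n L k τ) := by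
  set Y : Ω → α → J → ℝ := fun ω (i : α) (j : J) => X (i, (j : β)) ω with hY
  set Z : Ω → α → ↥Jᶜ → ℝ := fun ω (i : α) (j : ↥Jᶜ) => X (i, (j : β)) ω with hZ
  have hYm : Measurable Y :=
    measurable_pi_lambda _ fun i => measurable_pi_lambda _ fun j => hX.meas _
  have hZm : Measurable Z :=
    measurable_pi_lambda _ fun i => measurable_pi_lambda _ fun j => hX.meas _
  have hsub : {ω | matNorm (randMat X ω) ≤ L * √n ∧ ∃ x : EuclideanSpace ℝ β,
        ‖coordRestrict J x‖ = 1 ∧ ‖Matrix.toEuclideanLin (randMat X ω) x‖ < t * √D} ⊆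
      {ω | (Y ω, Z ω) ∈ badBlockSet J n (t * √D) k τ} ∪
        sparseEvent (fun p : ↥Jᶜ × α => X (p.2, (p.1 : β))) n L k τ := by
    rintro ω ⟨hω, x, hx1, hx2⟩
    by_cases hbad : ∃ u : EuclideanSpace ℝ α, ‖u‖ = 1 ∧ NearSparse k τ u ∧
      ‖Matrix.toEuclideanLin (Matrix.of (Z ω)).transpose u‖ < τ * √n
    · obtain ⟨u, hu1, hu2, hu3⟩ := hbad
      right
      exact ⟨(matNorm_transpose_submatrix_le (randMat X ω) Jᶜ).trans hω, u, hu1, hu2, hu3.le⟩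
    · left
      refine ⟨⟨coordRestrict J x, coordRestrict Jᶜ x, hx1, ?_⟩, hbad⟩
      rw [toEuclideanLin_split _ J] at hx2
      exact hx2
  refine (measureReal_mono hsub (measure_ne_top _ _)).trans
    ((measureReal_union_le _ _).trans (add_le_add ?_ le_rfl))
  refine measureReal_le_of_indepFun hYm hZm (hX.indepFun_columns J)
    (measurableSet_badBlockSet J n (t * √D) k τ) (by positivity) fun z => ?_
  by_cases hz : ∃ u : EuclideanSpace ℝ α, ‖u‖ = 1 ∧ NearSparse k τ u ∧
      ‖Matrix.toEuclideanLin (Matrix.of z).transpose u‖ < τ * √n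
  · have : {ω | (Y ω, z) ∈ badBlockSet J n (t * √D) k τ} = ∅ := by
      ext ω
      simp only [Set.mem_ofPred_eq, Set.mem_empty_iff_false, iff_false]
      exact fun h => h.2 hz
    rw [this, measureReal_empty]
    positivity
  -- The transpose of `z` annihilates every vector orthogonal to the frozen columns, so for good `z`
  -- no such unit vector is nearly sparse.
  · obtain ⟨K, hKD, hK⟩ := exists_orthogonal_submodule (Matrix.of z : Matrix α ↥Jᶜ ℝ) (D := D)
      (by rw [Fintype.card_coe, hα]; exact hDJ)
    have hKs : ∀ u ∈ K, ‖u‖ = 1 → ¬ NearSparse k τ u := by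
      intro u hu hu1 hus
      refine hz ⟨u, hu1, hus, ?_⟩
      have : Matrix.toEuclideanLin (Matrix.of z).transpose u = 0 := by
        refine ext_inner_right ℝ fun x => ?_
        rw [← inner_toEuclideanLin, hK u hu x, inner_zero_left]
      rw [this, norm_zero]
      have : (0 : ℝ) < n := by exact_mod_cast hn
      positivity
    have hg : Function.Injective (fun p : α × J => (p.1, (p.2 : β))) := by
      rintro ⟨i, j⟩ ⟨i', j'⟩ h
      simp only [Prod.mk.injEq] at h
      exact Prod.ext h.1 (Subtype.ext h.2)
    have h1 := (hX.precomp hg).block_bound (fun p => ha _) K.subtypeₗᵢ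
      (v := √(ρ / 2) * τ) (t := t) (by positivity)
      (mul_le_one₀ (Real.sqrt_le_one.mpr (by linarith)) hτ.le hτ1) ht ht1
      (fun y hy u => covariance_lower_bound (a := fun p : α × J => a (p.1, (p.2 : β)))
        (fun p => ha _) hα hρ hk (fun j => hcol (j : β)) K hKs y hy u)
      hKD (by rw [Fintype.card_coe, hJ]) hqD hD1
    refine (measureReal_mono (fun ω hω => ?_) (measure_ne_top _ _)).trans h1
    obtain ⟨⟨x₁, x₂, hx1, hx2⟩, -⟩ := hω
    refine ⟨x₁, hx1, le_trans ?_ hx2.le⟩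
    set A : Matrix α J ℝ := randMat (fun p : α × J => X (p.1, (p.2 : β))) ω with hA
    -- Compression to `K` kills the contribution of the frozen columns, so the compressed vector is
    -- no longer than the full sum.
    have e : ‖compress K.subtypeₗᵢ A x₁‖ ^ 2 =
        inner ℝ (K.subtypeₗᵢ (compress K.subtypeₗᵢ A x₁))
          (Matrix.toEuclideanLin A x₁ + Matrix.toEuclideanLin (Matrix.of z) x₂) := by
      rw [inner_add_right, hK (K.subtypeₗᵢ (compress K.subtypeₗᵢ A x₁)) (Subtype.mem _), add_zero, ← real_inner_self_eq_norm_sq]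
      exact LinearMap.adjoint_inner_right K.subtypeₗᵢ.toLinearMap _ _
    have h2 := real_inner_le_norm (K.subtypeₗᵢ (compress K.subtypeₗᵢ A x₁))
      (Matrix.toEuclideanLin A x₁ + Matrix.toEuclideanLin (Matrix.of z) x₂)
    rw [← e, LinearIsometry.norm_map, sq] at h2
    change _ ≤ ‖Matrix.toEuclideanLin A x₁ + Matrix.toEuclideanLin (Matrix.of z) x₂‖
    by_contra hc
    push Not at hc
    nlinarith [norm_nonneg (Matrix.toEuclideanLin A x₁ + Matrix.toEuclideanLin (Matrix.of z) x₂)]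

end Block

end SingularGaussian

/-! ### Averaging over blocks of columns -/

namespace SingularGaussian

/-- If every point of `E` lies in at least `M` of the sets `B i`, then `M * P E ≤ ∑ P (B i)`. -/
lemma mul_measureReal_le_sum_of_multiplicity {Ω ι : Type*} [MeasurableSpace Ω] {P : Measure Ω}
    [IsProbabilityMeasure P] (s : Finset ι) (B : ι → Set Ω) (E : Set Ω) (M : ℕ)
    (h : ∀ ω ∈ E, ∃ s' ⊆ s, M ≤ s'.card ∧ ∀ i ∈ s', ω ∈ B i) :
    (M : ℝ) * P.real E ≤ ∑ i ∈ s, P.real (B i) := by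
  classical
  -- `f` counts the sets containing ω; measurable hulls are used because the `B i` need not be
  -- measurable.
  set f : Ω → ENNReal := fun ω => ∑ i ∈ s, (toMeasurable P (B i)).indicator 1 ω with hf
  have hfm : Measurable f := Finset.measurable_sum _ fun i _ =>
    measurable_one.indicator (measurableSet_toMeasurable _ _)
  have h1 : (M : ENNReal) * P E ≤ ∑ i ∈ s, P (B i) := by
    calc (M : ENNReal) * P E ≤ M * P {ω | (M : ENNReal) ≤ f ω} := by
          gcongr
          intro ω hω
          obtain ⟨s', hs', hM, hB⟩ := h ω hω
          have : ∑ i ∈ s', (toMeasurable P (B i)).indicator (1 : Ω → ENNReal) ω = s'.card := by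
            rw [Finset.sum_congr rfl (g := fun _ => (1 : ENNReal))]
            · simp
            · intro i hi
              exact Set.indicator_of_mem (subset_toMeasurable _ _ (hB i hi)) _
          calc (M : ENNReal) ≤ s'.card := by exact_mod_cast hM
            _ = _ := this.symm
            _ ≤ f ω := Finset.sum_le_sum_of_subset hs'
      _ ≤ ∫⁻ ω, f ω ∂P := mul_meas_ge_le_lintegral hfm _
      _ = ∑ i ∈ s, P (B i) := by
          rw [lintegral_finsetSum _ fun i _ =>
            measurable_one.indicator (measurableSet_toMeasurable _ _)]
          refine Finset.sum_congr rfl fun i _ => ?_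
          rw [lintegral_indicator_one (measurableSet_toMeasurable _ _), measure_toMeasurable]
  have h2 := ENNReal.toReal_mono (ENNReal.sum_ne_top.mpr fun i _ => measure_ne_top _ _) h1
  rw [ENNReal.toReal_mul, ENNReal.toReal_natCast,
    ENNReal.toReal_sum fun i _ => measure_ne_top _ _] at h2
  exact h2

/-- Up to the common q!, the left side is at most m^q, while q ≤ M/2 makes each factor of the
falling factorial of M at least M/2. This compares all blocks with those inside the set of large
coordinates. -/
lemma choose_le_mul_choose {m M q : ℕ} {A : ℝ} (hq : 2 * q ≤ M) (hM : 0 < M)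
    (hA : 2 * (m : ℝ) ≤ A * M) : (m.choose q : ℝ) ≤ A ^ q * M.choose q := by
  have hM' : (0 : ℝ) < M := by exact_mod_cast hM
  have hf : (0 : ℝ) < q.factorial := by exact_mod_cast q.factorial_pos
  have h1 : (m.choose q : ℝ) * q.factorial ≤ (m : ℝ) ^ q := by
    rw [mul_comm]
    exact_mod_cast (Nat.descFactorial_eq_factorial_mul_choose m q) ▸ Nat.descFactorial_le_pow m q
  have h2 : ((M : ℝ) / 2) ^ q ≤ M.choose q * q.factorial := by
    have h3 : (M + 1 - q) ^ q ≤ q.factorial * M.choose q :=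
      (Nat.descFactorial_eq_factorial_mul_choose M q) ▸ Nat.pow_sub_le_descFactorial M q
    have h4 : ((M : ℝ) / 2) ≤ ((M + 1 - q : ℕ) : ℝ) := by
      rw [Nat.cast_sub (by omega)]
      have : (2 : ℝ) * q ≤ M := by exact_mod_cast hq
      push_cast
      linarith
    calc ((M : ℝ) / 2) ^ q ≤ ((M + 1 - q : ℕ) : ℝ) ^ q := by gcongr
      _ ≤ _ := by rw [mul_comm]; exact_mod_cast h3
  have hA0 : 0 ≤ A := by
    by_contra hc
    push Not at hc
    have : (0 : ℝ) ≤ m := by positivity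
    nlinarith
  refine le_of_mul_le_mul_right (h1.trans ?_) hf
  calc (m : ℝ) ^ q ≤ (A * (M / 2)) ^ q := by
        gcongr
        linarith
    _ = A ^ q * (M / 2) ^ q := mul_pow _ _ _
    _ ≤ A ^ q * (M.choose q * q.factorial) := by gcongr
    _ = _ := by ring

section Averaging

variable {Ω : Type*} [MeasurableSpace Ω] {P : Measure Ω} [IsProbabilityMeasure P]
  {α β : Type*} [Fintype α] [Fintype β] [DecidableEq β]

/-- Reduction of the least singular value to random blocks of columns. -/
lemma measureReal_smin_le_of_blocks (X : α × β → Ω → ℝ) {n q D : ℕ} (hn : 0 < n)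
    (hβ : Fintype.card β ≤ n) {L η τ s t p : ℝ} (hη : 0 < η) (hτ : 0 < τ) (hq : 0 < q)
    (hp0 : 0 ≤ p) (hqn : 2 * q ≤ η * n) (hsτ : s ≤ τ * √n) (hst : s ≤ t * √D * (τ * √q / √n))
    (hp : ∀ J : Finset β, J.card = q →
      P.real {ω | matNorm (randMat X ω) ≤ L * √n ∧ ∃ x : EuclideanSpace ℝ β,
        ‖coordRestrict J x‖ = 1 ∧ ‖Matrix.toEuclideanLin (randMat X ω) x‖ < t * √D} ≤ p) :
    P.real {ω | matNorm (randMat X ω) ≤ L * √n ∧ ∃ x : EuclideanSpace ℝ β,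
        ‖x‖ = 1 ∧ ‖Matrix.toEuclideanLin (randMat X ω) x‖ < s}
      ≤ P.real (sparseEvent X n L (η * n) τ) + (2 / η) ^ q * p := by
  have hn' : (0 : ℝ) < n := by exact_mod_cast hn
  have hq' : (0 : ℝ) < q := by exact_mod_cast hq
  set B : Finset β → Set Ω := fun J => {ω | matNorm (randMat X ω) ≤ L * √n ∧
    ∃ x : EuclideanSpace ℝ β, ‖coordRestrict J x‖ = 1 ∧
      ‖Matrix.toEuclideanLin (randMat X ω) x‖ < t * √D} with hB
  set E : Set Ω := {ω | matNorm (randMat X ω) ≤ L * √n ∧ ∃ x : EuclideanSpace ℝ β,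
        ‖x‖ = 1 ∧ ‖Matrix.toEuclideanLin (randMat X ω) x‖ < s} with hE
  set M : ℕ := ⌈η * n⌉₊ with hM
  have hMge : η * n ≤ M := Nat.le_ceil _
  have hM0 : 0 < M := Nat.ceil_pos.mpr (by positivity)
  have h2q : 2 * q ≤ M := by exact_mod_cast hqn.trans hMge
  have hmult : ∀ ω ∈ E \ sparseEvent X n L (η * n) τ, ∃ s' ⊆ (Finset.univ : Finset β).powersetCard q,
      M.choose q ≤ s'.card ∧ ∀ J ∈ s', ω ∈ B J := by
    rintro ω ⟨⟨hω, x, hx1, hx2⟩, hsp⟩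
    have hns : ¬ NearSparse (η * n) τ x := fun hx =>
      hsp ⟨hω, x, hx1, hx, hx2.le.trans hsτ⟩
    have hcard := card_le_of_not_nearSparse hn hβ hns
    set T := Finset.univ.filter fun j => τ ^ 2 / n ≤ x j ^ 2 with hT
    -- Every q-subset of the large coordinates carries squared mass at least qτ²/n, so x rescaled to
    -- norm one on it witnesses `B J`.
    refine ⟨T.powersetCard q, Finset.powersetCard_mono (Finset.subset_univ _), ?_, ?_⟩
    · rw [Finset.card_powersetCard]
      exact Nat.choose_le_choose q (Nat.ceil_le.mpr hcard.le)
    · intro J hJ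
      rw [Finset.mem_powersetCard] at hJ
      have hxJ : q * (τ ^ 2 / n) ≤ ‖coordRestrict J x‖ ^ 2 := by
        rw [norm_sq_coordRestrict, ← hJ.2, ← nsmul_eq_mul]
        exact Finset.card_nsmul_le_sum _ _ _ fun j hj => (Finset.mem_filter.mp (hJ.1 hj)).2
      have hxJ' : τ * √q / √n ≤ ‖coordRestrict J x‖ := by
        refine abs_le_of_sq_le_sq' ?_ (norm_nonneg _) |>.2
        rw [div_pow, mul_pow, Real.sq_sqrt hq'.le, Real.sq_sqrt hn'.le]
        calc _ = q * (τ ^ 2 / n) := by ring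
          _ ≤ _ := hxJ
      have hpos : 0 < τ * √q / √n := by positivity
      have hxpos : 0 < ‖coordRestrict J x‖ := lt_of_lt_of_le hpos hxJ'
      have ht0 : 0 ≤ t * √D := by
        by_contra hc
        push Not at hc
        have : t * √D * (τ * √q / √n) < 0 := mul_neg_of_neg_of_pos hc hpos
        linarith [norm_nonneg (Matrix.toEuclideanLin (randMat X ω) x)]
      refine ⟨hω, ‖coordRestrict J x‖⁻¹ • x, ?_, ?_⟩
      · rw [map_smul, norm_smul, norm_inv, norm_norm, inv_mul_cancel₀ hxpos.ne']
      · rw [map_smul, norm_smul, norm_inv, norm_norm, inv_mul_lt_iff₀ hxpos]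
        calc _ < s := hx2
          _ ≤ t * √D * (τ * √q / √n) := hst
          _ ≤ ‖coordRestrict J x‖ * (t * √D) := by
            rw [mul_comm]
            exact mul_le_mul_of_nonneg_right hxJ' ht0
  have h1 := mul_measureReal_le_sum_of_multiplicity (P := P) _ B _ _ hmult
  have hMc : (0 : ℝ) < M.choose q := by
    exact_mod_cast Nat.choose_pos (by omega)
  have h2 : P.real (E \ sparseEvent X n L (η * n) τ) ≤ (2 / η) ^ q * p := by
    have hsum : ∑ J ∈ (Finset.univ : Finset β).powersetCard q, P.real (B J)
        ≤ ((2 / η) ^ q * M.choose q) * p := by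
      calc _ ≤ ∑ J ∈ (Finset.univ : Finset β).powersetCard q, p :=
            Finset.sum_le_sum fun J hJ => hp J (Finset.mem_powersetCard.mp hJ).2
        _ = ((Fintype.card β).choose q : ℝ) * p := by
            rw [Finset.sum_const, Finset.card_powersetCard, nsmul_eq_mul, Finset.card_univ]
        _ ≤ _ := by
            refine mul_le_mul_of_nonneg_right (choose_le_mul_choose h2q hM0 ?_) hp0
            have : (Fintype.card β : ℝ) ≤ n := by exact_mod_cast hβ
            rw [div_mul_eq_mul_div, le_div_iff₀ hη]
            nlinarith
    refine le_of_mul_le_mul_left (h1.trans (hsum.trans (le_of_eq ?_))) hMc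
    ring
  have h3 : E ⊆ sparseEvent X n L (η * n) τ ∪ (E \ sparseEvent X n L (η * n) τ) := by
    rw [Set.union_sdiff_self]
    exact Set.subset_union_right
  exact (measureReal_mono h3 (measure_ne_top _ _)).trans
    ((measureReal_union_le _ _).trans (add_le_add le_rfl h2))

end Averaging

end SingularGaussian

/-! ### Almost square matrices and the choice of constants -/

namespace SingularGaussian

lemma matNorm_nonneg {α β : Type*} [Fintype α] [Fintype β] [DecidableEq β] (A : Matrix α β ℝ) :
    0 ≤ matNorm A := norm_nonneg _

lemma matNorm_add_le {α β : Type*} [Fintype α] [Fintype β] [DecidableEq β] (A B : Matrix α β ℝ) :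
    matNorm (A + B) ≤ matNorm A + matNorm B := by
  unfold matNorm
  rw [map_add, map_add]
  exact norm_add_le _ _

lemma norm_compress_id {α β : Type*} [Fintype α] [Fintype β] [DecidableEq β] (A : Matrix α β ℝ) :
    ‖compress (LinearIsometry.id (R := ℝ) (E := EuclideanSpace ℝ α)) A‖ = matNorm A := by
  unfold matNorm
  congr 1
  ext1 x
  refine ext_inner_left ℝ fun u => ?_
  exact LinearMap.adjoint_inner_right (LinearIsometry.id (R := ℝ)
    (E := EuclideanSpace ℝ α)).toLinearMap _ _

/-- The centred part exceeds 8√n with probability at most 12^(2n) e^(-8n) ≤ e^(-n), since 144 ≤ e⁷;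
the mean adds at most K√n. -/
lemma GaussFam.matNorm_tail {Ω : Type*} [MeasurableSpace Ω] {P : Measure Ω} [IsProbabilityMeasure P]
    {α β : Type*} [Fintype α] [Fintype β] [DecidableEq β] {X : α × β → Ω → ℝ} {b a : α × β → ℝ}
    (hX : GaussFam P X b a) (ha : ∀ p, a p ^ 2 ≤ 1) {n : ℕ}
    (hα : Fintype.card α ≤ n) (hβ : Fintype.card β ≤ n) {K : ℝ}
    (hb : matNorm (Matrix.of fun i j => b (i, j)) ≤ K * √n) :
    P.real {ω | (K + 8) * √n < matNorm (randMat X ω)} ≤ Real.exp (-n) := by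
  have h1 := hX.norm_compress_tail ha (LinearIsometry.id (R := ℝ) (E := EuclideanSpace ℝ α))
    (s := 4 * √n) (by positivity)
  simp_rw [norm_compress_id] at h1
  refine (measureReal_mono (fun ω hω => ?_) (measure_ne_top _ _)).trans (h1.trans ?_)
  · simp only [Set.mem_ofPred_eq] at hω ⊢
    have h2 := matNorm_add_le (Matrix.of fun i j => X (i, j) ω - b (i, j))
      (Matrix.of fun i j => b (i, j))
    have e : (Matrix.of fun i j => X (i, j) ω - b (i, j)) + (Matrix.of fun i j => b (i, j))
        = randMat X ω := by
      ext i j; simp [randMat]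
    rw [e] at h2
    linarith
  · rw [finrank_euclideanSpace, mul_pow, Real.sq_sqrt (by positivity)]
    calc (12 : ℝ) ^ (Fintype.card α + Fintype.card β) * Real.exp (-(4 ^ 2 * n) / 2)
        ≤ 12 ^ (2 * n) * Real.exp (-(4 ^ 2 * n) / 2) := by
          gcongr
          · norm_num
          · omega
      _ = (12 ^ 2 * Real.exp (-8)) ^ n := by
          rw [mul_pow, ← pow_mul, ← Real.exp_nat_mul]
          congr 2
          ring
      _ ≤ (Real.exp (-1)) ^ n := by
          gcongr
          have h7 : Real.exp (-8) = Real.exp (-1) * (Real.exp 1 ^ 7)⁻¹ := by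
            rw [← Real.exp_nat_mul, ← Real.exp_neg, ← Real.exp_add]
            norm_num
          have h8 : (144 : ℝ) ≤ Real.exp 1 ^ 7 := by
            have := Real.exp_one_gt_d9
            calc (144 : ℝ) ≤ 2.7 ^ 7 := by norm_num
              _ ≤ _ := by gcongr; linarith
          rw [h7, mul_left_comm]
          refine mul_le_of_le_one_right (Real.exp_pos _).le ?_
          rw [← div_eq_mul_inv, div_le_one (by positivity)]
          linarith
      _ = Real.exp (-n) := by rw [← Real.exp_nat_mul]; congr 1; ring

/-- The exponent is (d - q)/2 ≥ d/4. The factor (H A²)^(-4) in front of t, raised to d/4, is (H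
A²)^(-d) and cancels H^q A^D ≤ H^d A^(2d). -/
lemma block_exponent_bound {d q D : ℕ} (hq : 2 * q ≤ d) (hD : D = d + q) {A H t : ℝ} (hA : 1 ≤ A)
    (hH : 1 ≤ H) (ht : 0 < t) (ht1 : t ≤ 1) :
    H ^ q * (A ^ D * (((H * A ^ 2) ^ 4)⁻¹ * t) ^ ((D : ℝ) / 2 - q)) ≤ t ^ ((d : ℝ) / 4) := by
  have hB : 1 ≤ H * A ^ 2 := one_le_mul_of_one_le_of_one_le hH (one_le_pow₀ hA)
  have hB0 : 0 < H * A ^ 2 := by linarith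
  have hθ1 : ((H * A ^ 2) ^ 4)⁻¹ ≤ 1 := inv_le_one_of_one_le₀ (one_le_pow₀ hB)
  have hexp : (d : ℝ) / 4 ≤ (D : ℝ) / 2 - q := by
    have : (2 : ℝ) * q ≤ d := by exact_mod_cast hq
    rw [hD]; push_cast; linarith
  have h1 : (((H * A ^ 2) ^ 4)⁻¹ * t) ^ ((D : ℝ) / 2 - q) ≤
      ((H * A ^ 2) ^ d)⁻¹ * t ^ ((d : ℝ) / 4) := by
    calc _ ≤ (((H * A ^ 2) ^ 4)⁻¹ * t) ^ ((d : ℝ) / 4) :=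
          Real.rpow_le_rpow_of_exponent_ge (by positivity) (mul_le_one₀ hθ1 ht.le ht1) hexp
      _ = _ := by
          rw [Real.mul_rpow (by positivity) ht.le]
          congr 1
          rw [← Real.rpow_natCast _ 4, ← Real.rpow_neg hB0.le, ← Real.rpow_mul hB0.le,
            ← Real.rpow_natCast _ d, ← Real.rpow_neg hB0.le]
          congr 1
          push_cast
          ring
  have h2 : H ^ q ≤ H ^ d := pow_le_pow_right₀ hH (by omega)
  have h3 : A ^ D ≤ (A ^ 2) ^ d := by
    rw [← pow_mul]
    exact pow_le_pow_right₀ hA (by omega)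
  calc _ ≤ H ^ d * ((A ^ 2) ^ d * (((H * A ^ 2) ^ d)⁻¹ * t ^ ((d : ℝ) / 4))) := by gcongr
    _ = t ^ ((d : ℝ) / 4) := by
        rw [mul_pow]
        field_simp

/-- Least singular value bound conditional on control of the sparse vectors. -/
lemma GaussFam.smin_le_of_sparseEvents {Ω : Type*} [MeasurableSpace Ω] {P : Measure Ω}
    [IsProbabilityMeasure P] {n m d q : ℕ} {X : Fin n × Fin m → Ω → ℝ} {b a : Fin n × Fin m → ℝ}
    (hX : GaussFam P X b a) (ha : ∀ p, a p ^ 2 ≤ 1) (hn : 0 < n) (hd : n = m + d) (hqm : q ≤ m)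
    (h2q : 2 * q ≤ d) (hq : 0 < q) {ρ τ₁ τ₂ t L s k pz : ℝ} (hρ : 0 < ρ) (hρ1 : ρ ≤ 1)
    (hdρ : (d : ℝ) ≤ ρ / 4 * n) (hk : (1 - ρ / 2) * n ≤ k)
    (hcol : ∀ j, ρ * n ≤ ∑ i, a (i, j) ^ 2) (hτ₁ : 0 < τ₁) (hτ₂ : 0 < τ₂) (hτ₂1 : τ₂ ≤ 1)
    (ht : 0 < t) (ht1 : t ≤ 1) (hsτ : s ≤ τ₁ * √n)
    (hst : s ≤ t * √(d + q : ℕ) * (τ₁ * √q / √n)) (hpz : 0 ≤ pz)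
    (hz : ∀ J : Finset (Fin m), J.card = q →
      P.real (sparseEvent (fun p : ↥Jᶜ × Fin n => X (p.2, (p.1 : Fin m))) n L k τ₂) ≤ pz) :
    P.real {ω | ∃ x : EuclideanSpace ℝ (Fin m), ‖x‖ = 1 ∧
        ‖Matrix.toEuclideanLin (randMat X ω) x‖ < s}
      ≤ P.real {ω | L * √n < matNorm (randMat X ω)} + (P.real (sparseEvent X n L (ρ / 4 * n) τ₁) +
        (2 / (ρ / 4)) ^ q * ((432 * Real.exp 29 / (√(ρ / 2) * τ₂)) ^ (d + q) *
          t ^ (((d + q : ℕ) : ℝ) / 2 - q) + pz)) := by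
  have h2q' : (2 : ℝ) * q ≤ d := by exact_mod_cast h2q
  have hblock : ∀ J : Finset (Fin m), J.card = q →
      P.real {ω | matNorm (randMat X ω) ≤ L * √n ∧ ∃ x : EuclideanSpace ℝ (Fin m),
        ‖coordRestrict J x‖ = 1 ∧
          ‖Matrix.toEuclideanLin (randMat X ω) x‖ < t * √(d + q : ℕ)}
      ≤ (432 * Real.exp 29 / (√(ρ / 2) * τ₂)) ^ (d + q) * t ^ (((d + q : ℕ) : ℝ) / 2 - q) + pz := by
    intro J hJq
    have hJc : Jᶜ.card = m - q := by rw [Finset.card_compl, hJq, Fintype.card_fin]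
    exact (hX.block_event ha hn (Fintype.card_fin n) (k := k) (τ := τ₂)
      (D := d + q) hρ hρ1 hk hcol hτ₂ hτ₂1 ht ht1 J hJq
      (by omega) (by omega) (by omega)).trans (add_le_add le_rfl (hz J hJq))
  have havg := measureReal_smin_le_of_blocks (P := P) X (L := L) (η := ρ / 4) (τ := τ₁) (s := s)
    hn (by rw [Fintype.card_fin]; omega) (by positivity) hτ₁ hq (by positivity)
    (by linarith) hsτ hst hblock
  have hsub : {ω | ∃ x : EuclideanSpace ℝ (Fin m), ‖x‖ = 1 ∧
      ‖Matrix.toEuclideanLin (randMat X ω) x‖ < s} ⊆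
      {ω | L * √n < matNorm (randMat X ω)} ∪ {ω | matNorm (randMat X ω) ≤ L * √n ∧
        ∃ x : EuclideanSpace ℝ (Fin m), ‖x‖ = 1 ∧
          ‖Matrix.toEuclideanLin (randMat X ω) x‖ < s} := by
    intro ω hω
    rcases lt_or_ge (L * √n) (matNorm (randMat X ω)) with h | h
    · exact Or.inl h
    · exact Or.inr ⟨h, hω⟩
  exact (measureReal_mono hsub (measure_ne_top P _)).trans
    ((measureReal_union_le _ _).trans (add_le_add le_rfl havg))

/-- The first bound uses d ≤ n; the second rests on √((d + q)q) ≥ d/2, which follows from q ≥ d/4.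
-/
lemma scale_bounds {n d q : ℕ} (hn : 0 < n) (hdn : d ≤ n) (hdq : d ≤ 4 * q) (h2q : 2 * q ≤ d)
    {t τ s : ℝ} (ht : 0 ≤ t) (ht1 : t ≤ 1) (hτ : 0 ≤ τ) (hs : s ≤ t * τ * (d / (2 * √n))) :
    s ≤ τ * √n ∧ s ≤ t * √(d + q : ℕ) * (τ * √q / √n) := by
  have hn' : (0 : ℝ) < n := by exact_mod_cast hn
  have hdn' : (d : ℝ) ≤ n := by exact_mod_cast hdn
  have hsn : 0 < √(n : ℝ) := Real.sqrt_pos.mpr hn'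
  constructor
  · refine hs.trans ?_
    have h1 : (d : ℝ) / (2 * √n) ≤ √n := by
      rw [div_le_iff₀ (by positivity)]
      nlinarith [Real.mul_self_sqrt hn'.le]
    calc t * τ * (d / (2 * √n)) ≤ 1 * τ * √n := by gcongr
      _ = _ := by ring
  · refine hs.trans ?_
    have h1 : (d : ℝ) / 2 ≤ √(d + q : ℕ) * √q := by
      rw [← Real.sqrt_mul (by positivity)]
      refine Real.le_sqrt_of_sq_le ?_
      have h4 : (d : ℝ) ≤ 4 * q := by exact_mod_cast hdq
      have h2 : (2 : ℝ) * q ≤ d := by exact_mod_cast h2q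
      push_cast
      nlinarith
    calc t * τ * (d / (2 * √n)) = t * τ / √n * (d / 2) := by field_simp
      _ ≤ t * τ / √n * (√(d + q : ℕ) * √q) := by gcongr
      _ = _ := by ring

/-- Bookkeeping with L = 9K: A = A₀L^(C₂) enters to the power -8 and τ₁ brings L^(-C₁). The extra
K⁻¹ only keeps the final exponent positive. -/
lemma scale_eq {H A₀ c₁ C₁ C₂ K : ℝ} (hK : 1 ≤ K) :
    K ^ (-(8 * C₂ + C₁ + 1)) * (((H * A₀ ^ 2) ^ 4)⁻¹ * c₁ / 2 * 9 ^ (-(8 * C₂ + C₁))) =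
      ((H * (A₀ * (9 * K) ^ C₂) ^ 2) ^ 4)⁻¹ * (c₁ * (9 * K) ^ (-C₁)) / 2 * K⁻¹ := by
  have hK0 : 0 < K := by linarith
  have hL0 : 0 < 9 * K := by linarith
  have e1 : ((H * (A₀ * (9 * K) ^ C₂) ^ 2) ^ 4)⁻¹
      = ((H * A₀ ^ 2) ^ 4)⁻¹ * (9 * K) ^ (-(8 * C₂)) := by
    rw [Real.rpow_neg hL0.le, ← mul_inv]
    congr 1
    rw [show 8 * C₂ = C₂ * (8 : ℕ) by push_cast; ring, Real.rpow_mul hL0.le, Real.rpow_natCast]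
    ring
  have e2 : (9 * K) ^ (-(8 * C₂)) * (9 * K) ^ (-C₁)
      = 9 ^ (-(8 * C₂ + C₁)) * K ^ (-(8 * C₂ + C₁)) := by
    rw [← Real.rpow_add hL0, ← Real.mul_rpow (by norm_num) hK0.le]
    congr 1; ring
  have e3 : K ^ (-(8 * C₂ + C₁ + 1)) = K ^ (-(8 * C₂ + C₁)) * K⁻¹ := by
    rw [neg_add, Real.rpow_add hK0, Real.rpow_neg_one]
  rw [e1, e3]
  linear_combination (-(((H * A₀ ^ 2) ^ 4)⁻¹ * c₁ / 2 * K⁻¹)) * e2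

/-- The sum over blocks multiplies the sparse error by H^q ≤ e^(n/2), and the l + 3 error terms are
absorbed by e^(n/4). -/
lemma exp_error_bound {n q : ℕ} {l : ℝ} {H S a₁ a₂ B : ℝ} (hH : 1 ≤ H) (hl : 0 ≤ l)
    (hq : q * Real.log H ≤ n / 2) (hn : 4 * (l + 3) ≤ n) (h1 : a₁ ≤ Real.exp (-n))
    (h2 : a₂ ≤ Real.exp (-n)) (hB : H ^ q * B ≤ S) :
    a₁ + (a₂ + H ^ q * (B + (l + 1) * Real.exp (-n))) ≤ S + Real.exp (-(1 / 4) * n) := by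
  have hHq : H ^ q ≤ Real.exp (n / 2) := by
    rw [← Real.exp_log (by linarith : 0 < H), ← Real.exp_nat_mul]
    exact Real.exp_le_exp.mpr (by simpa using hq)
  have hlast : (l + 3 : ℝ) ≤ Real.exp (n / 4) := by
    have h1 := Real.add_one_le_exp ((n : ℝ) / 4)
    linarith
  have h1H : 1 ≤ H ^ q := one_le_pow₀ hH
  have hE : H ^ q * Real.exp (-n) * (l + 3) ≤ Real.exp (-(1 / 4) * n) := by
    calc H ^ q * Real.exp (-n) * (l + 3) ≤ Real.exp (n / 2) * Real.exp (-n) * Real.exp (n / 4) := by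
          gcongr
      _ = _ := by rw [← Real.exp_add, ← Real.exp_add]; congr 1; ring
  have hen : Real.exp (-(n : ℝ)) ≤ H ^ q * Real.exp (-n) :=
    le_mul_of_one_le_left (Real.exp_pos _).le h1H
  rw [mul_add]
  have : H ^ q * ((l + 1) * Real.exp (-(n : ℝ))) = H ^ q * Real.exp (-n) * (l + 3) -
    2 * (H ^ q * Real.exp (-n)) := by ring
  linarith

/-- Least singular value bound for almost square Gaussian matrices with spread variance profile. -/
theorem exists_almost_square_bound (ρ γ ζ : ℝ) (hρ : 0 < ρ) (hρ1 : ρ ≤ 1) (hγ : 0 < γ)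
    (hγρ : γ ≤ ρ / 4) (hζ : 0 < ζ) (hζ1 : ζ ≤ 1) :
    ∃ (c C ε : ℝ) (n₀ : ℕ), 0 < c ∧ 0 < C ∧ 0 < ε ∧
      ∀ (Ω : Type*) [MeasurableSpace Ω] (P : Measure Ω) [IsProbabilityMeasure P] (n m : ℕ)
        (X : Fin n × Fin m → Ω → ℝ) (b a : Fin n × Fin m → ℝ) (K t : ℝ), GaussFam P X b a →
        n₀ ≤ n → m + 4 ≤ n → (n : ℝ) - m ≤ ε * n → (∀ p, a p ^ 2 ≤ 1) →
        (∀ j, ρ * n ≤ ∑ i, a (i, j) ^ 2) →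
        (∀ J : Finset (Fin m), (J.card : ℝ) ≤ (n : ℝ) - m →
          (∀ i, ρ * n ≤ ∑ j : ↥Jᶜ, a (i, (j : Fin m)) ^ 2) ∧
          Expanding (fun p : ↥Jᶜ × Fin n => a (p.2, (p.1 : Fin m))) n (ρ / 4) γ
            (1 - ρ / 2 + 2 * γ) ζ) →
        1 ≤ K → matNorm (Matrix.of fun i j => b (i, j)) ≤ K * √n → 0 < t → t ≤ 1 →
        P.real {ω | ∃ x : EuclideanSpace ℝ (Fin m), ‖x‖ = 1 ∧
            ‖Matrix.toEuclideanLin (randMat X ω) x‖ < c * t * K ^ (-C) * (((n : ℝ) - m) / √n)}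
          ≤ t ^ (((n : ℝ) - m) / 4) + Real.exp (-(1 / 4) * n) := by
  -- The number of expansion steps. Steps of γ overshoot 1 - ρ/2 by at most γ, and expansion has to
  -- work one γ further, whence the cap 1 - ρ/2 + 2γ.
  obtain ⟨l, hl1, hl2⟩ : ∃ l : ℕ, 1 - ρ / 2 ≤ ρ / 4 + l * γ ∧
      ρ / 4 + l * γ + γ ≤ 1 - ρ / 2 + 2 * γ := by
    refine ⟨⌈(1 - ρ / 2 - ρ / 4) / γ⌉₊, ?_, ?_⟩
    · have := Nat.le_ceil ((1 - ρ / 2 - ρ / 4) / γ)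
      rw [div_le_iff₀ hγ] at this
      linarith
    · have := (Nat.ceil_lt_add_one (a := (1 - ρ / 2 - ρ / 4) / γ)
        (div_nonneg (by linarith) hγ.le)).le
      rw [← sub_le_iff_le_add, le_div_iff₀ hγ] at this
      linarith
  obtain ⟨c₁, C₁, hc₁, hc₁1, hC₁, hx⟩ := exists_sparse_base ρ hρ hρ1
  obtain ⟨c₂, C₂, hc₂, hc₂1, hC₂, hz⟩ := exists_sparse_level ρ γ ζ hρ hρ1 hγ hζ hζ1 l
  obtain ⟨H, hH⟩ : ∃ H : ℝ, H = 2 / (ρ / 4) := ⟨_, rfl⟩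
  have hH8 : 8 ≤ H := by rw [hH, le_div_iff₀ (by positivity)]; linarith
  have hlogH : 0 < Real.log H := Real.log_pos (by linarith)
  obtain ⟨A₀, hA₀⟩ : ∃ A₀ : ℝ, A₀ = 432 * Real.exp 29 / (√(ρ / 2) * c₂) := ⟨_, rfl⟩
  have hA₀1 : 1 ≤ A₀ := by
    rw [hA₀, le_div_iff₀ (by positivity), one_mul]
    have h1 : √(ρ / 2) * c₂ ≤ 1 := mul_le_one₀ (Real.sqrt_le_one.mpr (by linarith)) hc₂.le hc₂1
    have h2 : 1 ≤ Real.exp 29 := Real.one_le_exp (by norm_num)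
    linarith
  have hA₀pos : 0 < A₀ := by linarith
  -- In ε, the bound ρ/4 keeps d below the number of large coordinates, and 1/(2 log H) gives H^d ≤
  -- e^(n/2).
  refine ⟨((H * A₀ ^ 2) ^ 4)⁻¹ * c₁ / 2 * 9 ^ (-(8 * C₂ + C₁)), 8 * C₂ + C₁ + 1,
    min (ρ / 4) (1 / (2 * Real.log H)), 4 * (l + 3) + 1, by positivity, by positivity,
    by positivity, ?_⟩
  intro Ω _ P _ n m X b a K t hX hn₀ hmn hd ha hcol hJ hK hb ht ht1
  have hn : 0 < n := by omega
  have hn' : (0 : ℝ) < n := by exact_mod_cast hn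
  obtain ⟨d, hnd⟩ : ∃ d, n = m + d := ⟨n - m, by omega⟩
  have hdd : (n : ℝ) - m = d := by rw [hnd]; push_cast; ring
  rw [hdd] at hd hJ ⊢
  -- The gap d ≥ 4 makes q = ⌊d/2⌋ positive and at least d/4.
  obtain ⟨q, hq0, h2q, hd4q⟩ : ∃ q : ℕ, 0 < q ∧ 2 * q ≤ d ∧ d ≤ 4 * q :=
    ⟨d / 2, by omega, by omega, by omega⟩
  -- 9K ≥ K + 8, the norm level of `GaussFam.matNorm_tail`.
  obtain ⟨L, hL⟩ : ∃ L : ℝ, L = 9 * K := ⟨_, rfl⟩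
  have hL1 : 1 ≤ L := by linarith
  have hL0 : 0 < L := by linarith
  have hK0 : 0 < K := by linarith
  obtain ⟨τ₁, hτ₁⟩ : ∃ τ₁ : ℝ, τ₁ = c₁ * L ^ (-C₁) := ⟨_, rfl⟩
  obtain ⟨τ₂, hτ₂⟩ : ∃ τ₂ : ℝ, τ₂ = c₂ * L ^ (-C₂) := ⟨_, rfl⟩
  have hτ₁0 : 0 < τ₁ := by rw [hτ₁]; positivity
  have hτ₂0 : 0 < τ₂ := by rw [hτ₂]; positivity
  have hτ₂1 : τ₂ ≤ 1 := by
    rw [hτ₂]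
    exact mul_le_one₀ hc₂1 (by positivity) (Real.rpow_le_one_of_one_le_of_nonpos hL1 (by linarith))
  obtain ⟨A, hA⟩ : ∃ A : ℝ, A = 432 * Real.exp 29 / (√(ρ / 2) * τ₂) := ⟨_, rfl⟩
  have hAL : A = A₀ * L ^ C₂ := by
    rw [hA, hA₀, hτ₂, Real.rpow_neg hL0.le]
    field_simp
  have hA1 : 1 ≤ A := by
    rw [hAL]
    exact one_le_mul_of_one_le_of_one_le hA₀1 (Real.one_le_rpow hL1 hC₂)
  obtain ⟨θ, hθ⟩ : ∃ θ : ℝ, θ = ((H * A ^ 2) ^ 4)⁻¹ := ⟨_, rfl⟩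
  have hHA : 1 ≤ H * A ^ 2 := one_le_mul_of_one_le_of_one_le (by linarith) (one_le_pow₀ hA1)
  have hθ0 : 0 < θ := by rw [hθ]; positivity
  have hθ1 : θ ≤ 1 := by rw [hθ]; exact inv_le_one_of_one_le₀ (one_le_pow₀ hHA)
  have hθt : θ * t ≤ 1 := mul_le_one₀ hθ1 ht.le ht1
  have hdρ : (d : ℝ) ≤ ρ / 4 * n := hd.trans (by gcongr; exact min_le_left _ _)
  have hdlog : (d : ℝ) * Real.log H ≤ n / 2 := by
    have := hd.trans (mul_le_mul_of_nonneg_right (min_le_right (ρ / 4) (1 / (2 * Real.log H))) hn'.le)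
    calc (d : ℝ) * Real.log H ≤ (1 / (2 * Real.log H) * n) * Real.log H := by gcongr
      _ = n / 2 := by field_simp
  have h2q' : (2 : ℝ) * q ≤ d := by exact_mod_cast h2q
  have hqm : q ≤ m := by
    have h0 := mul_le_mul_of_nonneg_right (by linarith : ρ / 4 ≤ 1 / 4) hn'.le
    have h1 : (d : ℝ) + d ≤ n := by linarith
    have h2 : d + d ≤ n := by exact_mod_cast h1
    omega
  have hs : ((H * A₀ ^ 2) ^ 4)⁻¹ * c₁ / 2 * 9 ^ (-(8 * C₂ + C₁)) * t * K ^ (-(8 * C₂ + C₁ + 1)) *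
      (d / √n) ≤ θ * t * τ₁ * (d / (2 * √n)) := by
    have e : ((H * A₀ ^ 2) ^ 4)⁻¹ * c₁ / 2 * 9 ^ (-(8 * C₂ + C₁)) * t * K ^ (-(8 * C₂ + C₁ + 1)) *
        (d / √n) = (θ * t * τ₁ * (d / (2 * √n))) * K⁻¹ := by
      rw [hθ, hτ₁, hAL, hL]
      linear_combination (t * (d / √n)) * scale_eq (H := H) (A₀ := A₀) (c₁ := c₁) (C₁ := C₁)
        (C₂ := C₂) hK
    rw [e]
    exact mul_le_of_le_one_right (by positivity) (inv_le_one_of_one_le₀ hK)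
  obtain ⟨hsτ, hst⟩ := scale_bounds hn (by omega) hd4q h2q (mul_pos hθ0 ht).le hθt hτ₁0.le hs
  have hmain := hX.smin_le_of_sparseEvents ha hn hnd hqm h2q hq0 (L := L)
    (k := (ρ / 4 + l * γ) * n) (pz := (l + 1) * Real.exp (-n)) hρ hρ1 hdρ (by gcongr) hcol
    hτ₁0 hτ₂0 hτ₂1 (mul_pos hθ0 ht) hθt hsτ hst (by positivity) (by
      intro J hJq
      obtain ⟨hrow, hexp⟩ := hJ J (by rw [hJq]; linarith)
      have hJc : Jᶜ.card = m - q := by rw [Finset.card_compl, hJq, Fintype.card_fin]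
      have hg : Function.Injective (fun p : ↥Jᶜ × Fin n => (p.2, (p.1 : Fin m))) := by
        rintro ⟨i, j⟩ ⟨i', j'⟩ h
        simp only [Prod.mk.injEq] at h
        exact Prod.ext (Subtype.ext h.2) h.1
      rw [hτ₂]
      exact hz Ω P ↥Jᶜ (Fin n) _ _ _ n L (1 - ρ / 2 + 2 * γ) (hX.precomp hg) hn
        (by rw [Fintype.card_coe, hJc]; omega) (by rw [Fintype.card_fin]) (fun p => ha _) hrow hexp
        (by linarith) (Or.inr hl2) hL1)
  have hbase := hx Ω P (Fin n) (Fin m) X b a n L hX hn (by rw [Fintype.card_fin])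
    (by rw [Fintype.card_fin]; omega) ha hcol hL1
  rw [← hτ₁] at hbase
  have hnorm := hX.matNorm_tail ha (by rw [Fintype.card_fin]) (by rw [Fintype.card_fin]; omega) hb
  have hnorm' : P.real {ω | L * √n < matNorm (randMat X ω)} ≤ Real.exp (-n) := by
    refine (measureReal_mono (fun ω hω => ?_) (measure_ne_top _ _)).trans hnorm
    simp only [Set.mem_ofPred_eq] at hω ⊢
    refine lt_of_le_of_lt ?_ hω
    gcongr
    linarith
  rw [← hH, ← hA] at hmain
  refine hmain.trans (exp_error_bound (by linarith) (by positivity) ?_ ?_ hnorm' hbase ?_)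
  · exact (mul_le_mul_of_nonneg_right (by linarith) hlogH.le).trans hdlog
  · have : (4 * (l + 3) + 1 : ℝ) ≤ n := by exact_mod_cast hn₀
    linarith
  · rw [hθ]
    exact block_exponent_bound h2q rfl hA1 (by linarith) ht ht1

end SingularGaussian

/-! ### From broad connectedness to expansion -/

namespace SingularGaussian

section Graph

variable {n m : ℕ} {a : Matrix (Fin n) (Fin m) ℝ} {r δ κ : ℝ}

lemma sq_le_one_of_profile (hr : 0 < r) (ha : ∀ i j, a i j = 0 ∨ a i j ∈ Set.Icc r 1)
    (i : Fin n) (j : Fin m) : a i j ^ 2 ≤ 1 := by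
  rcases ha i j with h | h
  · simp [h]
  · exact pow_le_one₀ (hr.le.trans h.1) h.2

lemma sq_ge_of_profile (hr : 0 < r) (ha : ∀ i j, a i j = 0 ∨ a i j ∈ Set.Icc r 1)
    {i : Fin n} {j : Fin m} (h : a i j ≠ 0) : r ^ 2 ≤ a i j ^ 2 := by
  rcases ha i j with h' | h'
  · exact absurd h' h
  · exact pow_le_pow_left₀ hr.le h'.1 2

/-- A sum of squares dominates `r ^ 2` times the number of nonzero entries. -/
lemma mul_card_le_sum_sq {ι : Type*} (s : Finset ι) (f : ι → ℝ) {T : Finset ι} (hT : T ⊆ s)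
    (hf : ∀ i ∈ T, r ^ 2 ≤ f i ^ 2) : r ^ 2 * T.card ≤ ∑ i ∈ s, f i ^ 2 := by
  calc r ^ 2 * T.card = ∑ i ∈ T, r ^ 2 := by rw [Finset.sum_const, nsmul_eq_mul, mul_comm]
    _ ≤ ∑ i ∈ T, f i ^ 2 := Finset.sum_le_sum hf
    _ ≤ _ := Finset.sum_le_sum_of_subset_of_nonneg hT fun i _ _ => sq_nonneg _

/-- A column has at least δn > 0 and at most n nonzero entries, and a nonzero entry lies in [r, 1].
So the hypotheses are contradictory when δ > 1 or r > 1. -/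
lemma BroadlyConnected.le_one (h : BroadlyConnected δ κ (matrixGraph a)) (hδ : 0 < δ)
    (hn : 0 < n) (hm : 0 < m) (ha : ∀ i j, a i j = 0 ∨ a i j ∈ Set.Icc r 1) : δ ≤ 1 ∧ r ≤ 1 := by
  have hn' : (0 : ℝ) < n := by exact_mod_cast hn
  have h1 := h.deg_right ⟨0, hm⟩
  have h2 : Set.ncard {j | matrixGraph a j ⟨0, hm⟩} ≤ n := by
    simpa using Set.ncard_le_card {j | matrixGraph a j ⟨0, hm⟩}
  constructor
  · have h2' : (Set.ncard {j | matrixGraph a j ⟨0, hm⟩} : ℝ) ≤ n := by exact_mod_cast h2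
    nlinarith
  · have h3 : 0 < Set.ncard {j | matrixGraph a j ⟨0, hm⟩} := by
      have : (0 : ℝ) < Set.ncard {j | matrixGraph a j ⟨0, hm⟩} := lt_of_lt_of_le (by positivity) h1
      exact_mod_cast this
    obtain ⟨i, hi⟩ := Set.nonempty_of_ncard_ne_zero h3.ne'
    rcases ha i ⟨0, hm⟩ with h' | h'
    · exact absurd h' hi
    · exact h'.1.trans h'.2

lemma BroadlyConnected.column_sum (h : BroadlyConnected δ κ (matrixGraph a)) (hr : 0 < r)
    (ha : ∀ i j, a i j = 0 ∨ a i j ∈ Set.Icc r 1) (j : Fin m) :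
    r ^ 2 * (δ * n) ≤ ∑ i, a i j ^ 2 := by
  classical
  have h1 := h.deg_right j
  rw [Set.ncard_eq_toFinset_card'] at h1
  refine (mul_le_mul_of_nonneg_left h1 (sq_nonneg r)).trans
    (mul_card_le_sum_sq _ (fun i => a i j) (Finset.subset_univ _) fun i hi => ?_)
  exact sq_ge_of_profile hr ha (Set.mem_toFinset.mp hi)

/-- Deleting the columns `J` removes at most |J| of the at least δm nonzero entries of a row. -/
lemma BroadlyConnected.row_sum (h : BroadlyConnected δ κ (matrixGraph a)) (hr : 0 < r)
    (ha : ∀ i j, a i j = 0 ∨ a i j ∈ Set.Icc r 1) (J : Finset (Fin m)) (i : Fin n) :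
    r ^ 2 * (δ * m - J.card) ≤ ∑ j : ↥Jᶜ, a i (j : Fin m) ^ 2 := by
  classical
  have h1 := h.deg_left i
  rw [Set.ncard_eq_toFinset_card'] at h1
  set T := {j | matrixGraph a i j}.toFinset with hT
  have h2 : (T.card : ℝ) - J.card ≤ (T \ J).card := by
    have := Finset.le_card_sdiff J T
    have h3 : T.card ≤ (T \ J).card + J.card := by omega
    have : (T.card : ℝ) ≤ (T \ J).card + J.card := by exact_mod_cast h3
    linarith
  rw [Finset.sum_coe_sort Jᶜ (fun j => a i j ^ 2)]
  refine (mul_le_mul_of_nonneg_left (by linarith) (sq_nonneg r)).trans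
    (mul_card_le_sum_sq (T := T \ J) _ (fun j => a i j) (fun j hj => ?_) fun j hj => ?_)
  · exact Finset.mem_compl.mpr (Finset.mem_sdiff.mp hj).2
  · have := (Finset.mem_sdiff.mp hj).1
    exact sq_ge_of_profile hr ha (Set.mem_toFinset.mp this)

/-- Deleting `J` loses at most |J| neighbours, and the surplus κ|S| ≥ κηn pays for this loss and for
the gain 2γn. -/
lemma BroadlyConnected.expanding (h : BroadlyConnected δ κ (matrixGraph a)) (hr : 0 < r)
    (ha : ∀ i j, a i j = 0 ∨ a i j ∈ Set.Icc r 1) (hκ : 0 ≤ κ) (hδ : 0 < δ) {η γ w : ℝ}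
    (hn : 4 ≤ δ * η * n) (J : Finset (Fin m))
    (h1 : 2 * γ * n + J.card ≤ κ * η * n) (h2 : w * n + J.card ≤ m) :
    Expanding (fun p : ↥Jᶜ × Fin n => a p.2 (p.1 : Fin m)) n η γ w (r ^ 2 * (δ * η / 4)) := by
  classical
  intro S hS
  have h3 := h.expansion S
  rw [Set.ncard_eq_toFinset_card'] at h3
  set I := (broadNeighbors δ (matrixGraph a) S).toFinset with hI
  refine ⟨Finset.univ.filter fun j : ↥Jᶜ => (j : Fin m) ∈ I, ?_, ?_⟩
  · have hcard : (I \ J).card = (Finset.univ.filter fun j : ↥Jᶜ => (j : Fin m) ∈ I).card := by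
      rw [← Finset.card_map ⟨_, Subtype.coe_injective⟩ (s := Finset.univ.filter _)]
      congr 1
      ext j
      simp only [Finset.mem_sdiff, Finset.mem_map, Finset.mem_filter, Finset.mem_univ, true_and,
        Function.Embedding.coeFn_mk, Subtype.exists, Finset.mem_compl]
      constructor
      · rintro ⟨hj, hj'⟩
        exact ⟨j, hj', hj, rfl⟩
      · rintro ⟨j', hj', hj, rfl⟩
        exact ⟨hj, hj'⟩
    rw [← hcard]
    have h4 : (I.card : ℝ) ≤ (I \ J).card + J.card := by
      have := Finset.le_card_sdiff J I
      have h5 : I.card ≤ (I \ J).card + J.card := by omega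
      exact_mod_cast h5
    have h6 := mul_le_mul_of_nonneg_left hS hκ
    rcases min_le_iff.mp h3 with h5 | h5
    · refine (min_le_left _ _).trans ?_
      linarith
    · refine (min_le_right _ _).trans ?_
      linarith
  · intro j hj
    have hjI : (j : Fin m) ∈ broadNeighbors δ (matrixGraph a) S := by
      simpa [hI] using hj
    have h4 : ⌊(δ / 2) * (S.card : ℝ)⌋₊ ≤ Set.ncard {i | i ∈ S ∧ matrixGraph a i j} := hjI
    rw [Set.ncard_eq_toFinset_card'] at h4
    set T := {i | i ∈ S ∧ matrixGraph a i (j : Fin m)}.toFinset with hT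
    -- The floor costs 1, paid for by δηn ≥ 4 on lowering δ/2 to δ/4.
    have h5 : (δ / 2) * (S.card : ℝ) - 1 ≤ T.card :=
      (Nat.sub_one_lt_floor _).le.trans (by exact_mod_cast h4)
    have h6 := mul_le_mul_of_nonneg_left hS hδ.le
    have h7 : δ * η / 4 * n ≤ T.card := by linarith
    rw [mul_assoc]
    refine (mul_le_mul_of_nonneg_left h7 (sq_nonneg r)).trans
      (mul_card_le_sum_sq _ (fun i => a i j) (fun i hi => ?_) fun i hi => ?_)
    · have : i ∈ S ∧ matrixGraph a i j := by simpa [hT] using hi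
      exact this.1
    · have : i ∈ S ∧ matrixGraph a i j := by simpa [hT] using hi
      exact sq_ge_of_profile hr ha this.2

end Graph

/-- The almost square bound for broadly connected variance profiles. -/
theorem exists_almost_square_bound_of_broadlyConnected (r δ κ : ℝ) (hr : 0 < r) (hr1 : r ≤ 1)
    (hδ : 0 < δ) (hδ1 : δ ≤ 1) (hκ : 0 < κ) (hκδ : κ < δ / 2) :
    ∃ (c C ε : ℝ) (n₀ : ℕ), 0 < c ∧ 0 < C ∧ 0 < ε ∧ ε ≤ 1 ∧
      ∀ (Ω : Type*) [MeasurableSpace Ω] (P : Measure Ω) [IsProbabilityMeasure P] (n m : ℕ)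
        (X : Fin n × Fin m → Ω → ℝ) (b a : Matrix (Fin n) (Fin m) ℝ) (K t : ℝ),
        GaussFam P X (fun p => b p.1 p.2) (fun p => a p.1 p.2) →
        n₀ ≤ n → m + 4 ≤ n → (n : ℝ) - m ≤ ε * n →
        (∀ i j, a i j = 0 ∨ a i j ∈ Set.Icc r 1) → BroadlyConnected δ κ (matrixGraph a) →
        1 ≤ K → matNorm b ≤ K * √n → 0 < t → t ≤ 1 →
        P.real {ω | ∃ x : EuclideanSpace ℝ (Fin m), ‖x‖ = 1 ∧
            ‖Matrix.toEuclideanLin (randMat X ω) x‖ < c * t * K ^ (-C) * (((n : ℝ) - m) / √n)}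
          ≤ t ^ (((n : ℝ) - m) / 4) + Real.exp (-(1 / 4) * n) := by
  -- One ρ serves both directions: columns carry at least r²δn, and rows with d columns deleted at
  -- least r²(δm - d) ≥ r²δn/4.
  obtain ⟨ρ, hρ⟩ : ∃ ρ : ℝ, ρ = r ^ 2 * (δ / 4) := ⟨_, rfl⟩
  have hr2 : r ^ 2 ≤ 1 := pow_le_one₀ hr.le hr1
  have hρ0 : 0 < ρ := by rw [hρ]; positivity
  have hρδ : ρ ≤ δ / 4 := by rw [hρ]; exact mul_le_of_le_one_left (by positivity) hr2
  have hρ1 : ρ ≤ 1 := by linarith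
  have hκρ : 0 < κ * ρ := by positivity
  have hκρ1 : κ * ρ ≤ 1 / 2 * ρ := by gcongr; linarith
  have hκρ2 : κ * ρ ≤ 1 / 2 * (δ / 4) := hκρ1.trans (by gcongr)
  -- With η = ρ/4 the surplus is κρn/4: half of it is 2γn for γ = κρ/16, the other half covers up to
  -- κρn/8 deleted columns.
  obtain ⟨c, C, ε, n₀, hc, hC, hε, h⟩ := exists_almost_square_bound ρ (κ * ρ / 16)
    (r ^ 2 * (δ * (ρ / 4) / 4)) hρ0 hρ1 (by positivity) (by linarith) (by positivity)
    (mul_le_one₀ hr2 (by positivity) (by nlinarith))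
  refine ⟨c, C, min ε (κ * ρ / 8), max n₀ ⌈4 / (δ * (ρ / 4))⌉₊, hc, hC, by positivity,
    (min_le_right _ _).trans (by linarith), ?_⟩
  intro Ω _ P _ n m X b a K t hX hn hmn hd ha hbc hK hb ht ht1
  have hnn : (0 : ℝ) ≤ n := by positivity
  have hdε : (n : ℝ) - m ≤ ε * n := hd.trans (by gcongr; exact min_le_left _ _)
  have hdκ : (n : ℝ) - m ≤ κ * ρ / 8 * n := hd.trans (by gcongr; exact min_le_right _ _)
  have hδn : κ * ρ * n ≤ 1 / 2 * (δ / 4) * n := by gcongr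
  have hρn : κ * ρ * n ≤ 1 / 2 * ρ * n := by gcongr
  have hδ1n : δ * n ≤ n := mul_le_of_le_one_left hnn hδ1
  have hmul : δ * (n - m) ≤ 1 * (κ * ρ / 8 * n) := by
    refine (mul_le_mul_of_nonneg_left hdκ hδ.le).trans ?_
    gcongr
  refine h Ω P n m X _ _ K t hX ((le_max_left _ _).trans hn) hmn hdε
    (fun p => sq_le_one_of_profile hr ha _ _) (fun j => ?_) (fun J hJ => ⟨fun i => ?_, ?_⟩) hK hb
    ht ht1
  · refine le_trans ?_ (hbc.column_sum hr ha j)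
    rw [hρ, mul_assoc]
    gcongr
    linarith
  · refine le_trans ?_ (hbc.row_sum hr ha J i)
    rw [hρ, mul_assoc]
    refine mul_le_mul_of_nonneg_left ?_ (sq_nonneg r)
    have : 0 ≤ δ * n := by positivity
    linarith
  · refine hbc.expanding hr ha hκ.le hδ ?_ J ?_ ?_
    · have h1 := Nat.ceil_le.mp ((le_max_right _ _).trans hn)
      rw [div_le_iff₀ (by positivity)] at h1
      linarith
    · linarith
    · linarith

end SingularGaussian

namespace SingularGaussian

/-! ### The least singular value as a minimum -/

section SingularValue

/-- The smallest singular value is attained at a unit vector. -/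
lemma exists_norm_toEuclideanLin_eq_singularValue {n m : ℕ} (hm : 0 < m)
    (A : Matrix (Fin n) (Fin m) ℝ) :
    ∃ x : EuclideanSpace ℝ (Fin m), ‖x‖ = 1 ∧
      ‖Matrix.toEuclideanLin A x‖ = singularValue A m := by
  set T := Matrix.toEuclideanLin A with hT
  have hlt : m - 1 < Module.finrank ℝ (EuclideanSpace ℝ (Fin m)) := by
    rw [finrank_euclideanSpace_fin]; omega
  obtain ⟨v, hv⟩ := (T.hasEigenvalue_adjoint_comp_self_sq_singularValues hlt).exists_hasEigenvector
  have hv0 : ‖v‖ ≠ 0 := norm_ne_zero_iff.mpr hv.2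
  have hs := T.singularValues_nonneg (m - 1)
  have hsq : ‖T v‖ ^ 2 = (T.singularValues (m - 1) * ‖v‖) ^ 2 := by
    have h1 := hv.apply_eq_smul
    rw [LinearMap.comp_apply] at h1
    rw [← real_inner_self_eq_norm_sq, ← LinearMap.adjoint_inner_left, h1, inner_smul_left,
      real_inner_self_eq_norm_sq, mul_pow]
    simp
  have hTv : ‖T v‖ = T.singularValues (m - 1) * ‖v‖ :=
    (pow_left_inj₀ (norm_nonneg _) (by positivity) two_ne_zero).mp hsq
  refine ⟨‖v‖⁻¹ • v, ?_, ?_⟩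
  · rw [norm_smul, norm_inv, norm_norm, inv_mul_cancel₀ hv0]
  · rw [map_smul, norm_smul, norm_inv, norm_norm, hTv, singularValue, mul_comm, mul_assoc,
      mul_inv_cancel₀ hv0, mul_one]

end SingularValue

/-! ### Adjoining columns -/

section Padding

lemma extend_of_notMem_range {β β' : Type*} {f : β → β'} {j : β'} (hj : j ∉ Set.range f)
    (g : β → ℝ) (e : β' → ℝ) : Function.extend f g e j = e j :=
  Function.extend_apply' g e j hj

variable {α β β' : Type*} [Fintype β] [Fintype β'] [DecidableEq β] [DecidableEq β']

/-- Extending a vector by zero does not change its norm nor its image. -/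
lemma exists_extend_eq {f : β → β'} (hf : Function.Injective f) (A : Matrix α β' ℝ)
    (x : EuclideanSpace ℝ β) :
    ∃ y : EuclideanSpace ℝ β', ‖y‖ = ‖x‖ ∧
      Matrix.toEuclideanLin A y = Matrix.toEuclideanLin (A.submatrix id f) x := by
  refine ⟨WithLp.toLp 2 (Function.extend f x 0), ?_, ?_⟩
  · rw [EuclideanSpace.norm_eq, EuclideanSpace.norm_eq]
    congr 1
    refine (Fintype.sum_of_injective f hf _ _ (fun i hi => ?_) fun i => ?_).symm
    · simp [extend_of_notMem_range hi]
    · simp [hf.extend_apply]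
  · ext i
    simp only [Matrix.ofLp_toLpLin, Matrix.toLin'_apply, Matrix.mulVec, dotProduct]
    refine (Fintype.sum_of_injective f hf _ _ (fun i hi => ?_) fun i => ?_).symm
    · simp [extend_of_notMem_range hi]
    · simp [hf.extend_apply]

lemma matNorm_extend_zero_le [Fintype α] {f : β → β'} (hf : Function.Injective f) (A : Matrix α β ℝ) :
    matNorm (Matrix.of fun i => Function.extend f (A i) 0) ≤ matNorm A := by
  refine ContinuousLinearMap.opNorm_le_bound _ (matNorm_nonneg _) fun y => ?_
  obtain ⟨z, hz⟩ : ∃ z : EuclideanSpace ℝ β, z = WithLp.toLp 2 fun j => y (f j) := ⟨_, rfl⟩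
  have h1 : Matrix.toEuclideanLin (Matrix.of fun i => Function.extend f (A i) 0) y
      = Matrix.toEuclideanLin A z := by
    ext i
    simp only [Matrix.ofLp_toLpLin, Matrix.toLin'_apply, Matrix.mulVec, dotProduct]
    refine (Fintype.sum_of_injective f hf _ _ (fun j hj => ?_) fun j => ?_).symm
    · simp [extend_of_notMem_range hj]
    · simp [hf.extend_apply, hz]
  have h2 : ‖z‖ ≤ ‖y‖ := by
    rw [EuclideanSpace.norm_eq, EuclideanSpace.norm_eq]
    refine Real.sqrt_le_sqrt ?_
    have : ∑ j, ‖z j‖ ^ 2 = ∑ j ∈ Finset.univ.map ⟨f, hf⟩, ‖y j‖ ^ 2 := by simp [hz]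
    rw [this]
    exact Finset.sum_le_sum_of_subset_of_nonneg (Finset.subset_univ _) fun _ _ _ => sq_nonneg _
  rw [LinearMap.coe_toContinuousLinearMap', h1]
  exact (norm_toEuclideanLin_le A z).trans (mul_le_mul_of_nonneg_left h2 (matNorm_nonneg _))

lemma ncard_add_le_of_extend {m m' : ℕ} {f : Fin m → Fin m'} (hf : Function.Injective f)
    (hm : m ≤ m') {T : Set (Fin m)} {U : Set (Fin m')} (hT : ∀ j ∈ T, f j ∈ U)
    (hU : ∀ j, j ∉ Set.range f → j ∈ U) : (T.ncard : ℝ) + (m' - m) ≤ U.ncard := by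
  have h1 : (f '' T ∪ (Set.range f)ᶜ).ncard ≤ U.ncard := by
    refine Set.ncard_le_ncard (Set.union_subset ?_ hU)
    rintro _ ⟨j, hj, rfl⟩
    exact hT j hj
  rw [Set.ncard_union_eq (by
    rw [Set.disjoint_compl_right_iff_subset]; exact Set.image_subset_range _ _),
    Set.ncard_image_of_injective _ hf] at h1
  have h2 : (Set.range f)ᶜ.ncard = m' - m := by
    rw [Set.ncard_compl, ← Set.image_univ, Set.ncard_image_of_injective _ hf]
    simp
  rw [h2] at h1
  have h3 : ((T.ncard + (m' - m) : ℕ) : ℝ) ≤ U.ncard := by exact_mod_cast h1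
  rwa [Nat.cast_add, Nat.cast_sub hm] at h3

/-- Adjoining columns without zeros preserves broad connectedness. -/
lemma BroadlyConnected.extend_one {n m m' : ℕ} {δ κ : ℝ} {a : Matrix (Fin n) (Fin m) ℝ}
    (h : BroadlyConnected δ κ (matrixGraph a)) (hδ1 : δ ≤ 1) {f : Fin m → Fin m'}
    (hf : Function.Injective f) (hm : m ≤ m') :
    BroadlyConnected δ κ (matrixGraph (Matrix.of fun i => Function.extend f (a i) 1)) := by
  have hin : ∀ i j, matrixGraph (Matrix.of fun i => Function.extend f (a i) 1) i (f j)
      ↔ matrixGraph a i j := fun i j => by simp [matrixGraph, hf.extend_apply]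
  have hout : ∀ i j, j ∉ Set.range f →
      matrixGraph (Matrix.of fun i => Function.extend f (a i) 1) i j := fun i j hj => by
    simp [matrixGraph, extend_of_notMem_range hj]
  have hmm : (0 : ℝ) ≤ m' - m := by
    have : (m : ℝ) ≤ m' := by exact_mod_cast hm
    linarith
  refine ⟨fun j => ?_, fun i => ?_, fun J => ?_⟩
  · by_cases hj : j ∈ Set.range f
    · obtain ⟨j, rfl⟩ := hj
      simpa only [hin] using h.deg_right j
    · simp only [hout _ j hj]
      have : δ * n ≤ n := mul_le_of_le_one_left (by positivity) hδ1
      simpa [Set.ncard_univ] using this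
  · have h1 := ncard_add_le_of_extend hf hm
      (T := {j | matrixGraph a i j})
      (U := {j | matrixGraph (Matrix.of fun i => Function.extend f (a i) 1) i j})
      (fun j hj => (hin i j).mpr hj) (fun j hj => hout i j hj)
    have h2 := h.deg_left i
    nlinarith
  · have h1 := ncard_add_le_of_extend hf hm
      (T := broadNeighbors δ (matrixGraph a) J)
      (U := broadNeighbors δ (matrixGraph (Matrix.of fun i => Function.extend f (a i) 1)) J)
      (fun j hj => ?_) (fun j hj => ?_)
    · have h2 := h.expansion J
      rcases min_le_iff.mp h2 with h3 | h3
      · exact (min_le_left _ _).trans (by linarith)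
      · exact (min_le_right _ _).trans (by linarith)
    · have hj' : ⌊(δ / 2) * (J.card : ℝ)⌋₊ ≤ Set.ncard {i | i ∈ J ∧ matrixGraph a i j} := hj
      show _ ≤ Set.ncard {i | i ∈ J ∧ _}
      simpa only [hin] using hj'
    -- A new column is adjacent to all of `J`, hence meets the threshold ⌊(δ/2)|J|⌋ as δ ≤ 1.
    · show _ ≤ Set.ncard {i | i ∈ J ∧ _}
      simp only [hout _ j hj, and_true]
      rw [show {i | i ∈ J} = (J : Set (Fin n)) from rfl, Set.ncard_coe_finset]
      refine Nat.floor_le_of_le ?_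
      refine mul_le_of_le_one_left (by positivity) (by linarith)

end Padding

/-! ### Transfer to the product measure -/

section Law

/-- The product measure of the laws `N(b i, (a i)²)`. -/
noncomputable def gaussPi {ι : Type*} [Fintype ι] (b a : ι → ℝ) : Measure (ι → ℝ) :=
  Measure.pi fun i => gaussianReal (b i) (Real.toNNReal (a i ^ 2))

instance {ι : Type*} [Fintype ι] (b a : ι → ℝ) : IsProbabilityMeasure (gaussPi b a) := by
  unfold gaussPi; infer_instance

lemma gaussFam_gaussPi {ι : Type*} [Fintype ι] (b a : ι → ℝ) :
    GaussFam (gaussPi b a) (fun i w => w i) b a where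
  meas i := measurable_pi_apply i
  indep := iIndepFun_pi (X := fun _ x => x) fun _ => aemeasurable_id
  law i := (measurePreserving_eval
    (fun i => gaussianReal (b i) (Real.toNNReal (a i ^ 2))) i).map_eq

lemma GaussFam.map_eq_gaussPi {Ω ι : Type*} [MeasurableSpace Ω] {P : Measure Ω}
    [IsProbabilityMeasure P] [Fintype ι] {X : ι → Ω → ℝ} {b a : ι → ℝ} (h : GaussFam P X b a) :
    P.map (fun ω i => X i ω) = gaussPi b a := by
  rw [(iIndepFun_iff_map_fun_eq_pi_map fun i => (h.meas i).aemeasurable).mp h.indep]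
  simp only [h.law]
  rfl

variable {Ω : Type*} [MeasurableSpace Ω] {P : Measure Ω} {n m : ℕ}
  {W : Ω → Matrix (Fin n) (Fin m) ℝ} {b a : Matrix (Fin n) (Fin m) ℝ}

/-- The entries are only almost everywhere measurable, so probabilities are moved to the product
space, where the coordinates are measurable. As an inequality this holds for arbitrary `S`. -/
lemma IsIndepGaussianMatrix.measureReal_le [IsProbabilityMeasure P]
    (h : IsIndepGaussianMatrix P W b a)
    (S : Set (Fin n × Fin m → ℝ)) :
    P.real {ω | (fun p : Fin n × Fin m => W ω p.1 p.2) ∈ S}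
      ≤ (gaussPi (fun p => b p.1 p.2) (fun p => a p.1 p.2)).real S := by
  have hm : ∀ p : Fin n × Fin m, AEMeasurable (fun ω => W ω p.1 p.2) P :=
    fun p => (h.law p.1 p.2).aemeasurable
  have h1 := (iIndepFun_iff_map_fun_eq_pi_map hm).mp h.indep
  simp only [(h.law _ _).map_eq] at h1
  refine ENNReal.toReal_mono (measure_ne_top _ _) ?_
  rw [gaussPi, ← h1]
  exact Measure.le_map_apply (aemeasurable_pi_lambda _ hm) S

lemma IsIndepGaussianMatrix.expectedMatrix_eq (h : IsIndepGaussianMatrix P W b a) :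
    expectedMatrix P W = b := by
  ext i j
  rw [expectedMatrix, (h.law i j).integral_eq, integral_id_gaussianReal]

/-- The matrices that shrink some unit vector below length `s`. -/
def shrinkSet (n m : ℕ) (s : ℝ) : Set (Fin n × Fin m → ℝ) :=
  {w | ∃ x : EuclideanSpace ℝ (Fin m), ‖x‖ = 1 ∧
    ‖Matrix.toEuclideanLin (Matrix.of fun i j => w (i, j)) x‖ < s}

lemma isOpen_shrinkSet (n m : ℕ) (s : ℝ) : IsOpen (shrinkSet n m s) := by
  have : shrinkSet n m s = ⋃ x ∈ {x : EuclideanSpace ℝ (Fin m) | ‖x‖ = 1},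
      {w | ‖Matrix.toEuclideanLin (Matrix.of fun i j => w (i, j)) x‖ < s} := by
    ext w; simp [shrinkSet]
  rw [this]
  refine isOpen_biUnion fun x _ => isOpen_lt ?_ continuous_const
  refine ((continuous_toEuclideanLin x).comp ?_).norm
  exact continuous_matrix fun i j => continuous_apply (i, j)

/-- Any increase of s turns the closed condition into the open one of `shrinkSet`. -/
lemma IsIndepGaussianMatrix.singularValue_le [IsProbabilityMeasure P]
    (h : IsIndepGaussianMatrix P W b a) (hm : 0 < m) {s s' : ℝ} (hs : s < s') :
    P.real {ω | singularValue (W ω) m ≤ s}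
      ≤ (gaussPi (fun p => b p.1 p.2) (fun p => a p.1 p.2)).real (shrinkSet n m s') := by
  refine le_trans (measureReal_mono (fun ω hω => ?_) (measure_ne_top _ _)) (h.measureReal_le _)
  obtain ⟨x, hx, hx'⟩ := exists_norm_toEuclideanLin_eq_singularValue hm (W ω)
  exact ⟨x, hx, (hx'.trans_le hω).trans_lt hs⟩

/-- Adjoining columns only makes it easier to shrink a unit vector. -/
lemma gaussPi_shrinkSet_le_extend (n m m' : ℕ) (b a : Matrix (Fin n) (Fin m) ℝ)
    {f : Fin m → Fin m'} (hf : Function.Injective f) (c d : Fin m' → ℝ) (s : ℝ) :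
    (gaussPi (fun p => b p.1 p.2) (fun p => a p.1 p.2)).real (shrinkSet n m s)
      ≤ (gaussPi (fun p : Fin n × Fin m' => (Matrix.of fun i => Function.extend f (b i) c) p.1 p.2)
        (fun p => (Matrix.of fun i => Function.extend f (a i) d) p.1 p.2)).real
          (shrinkSet n m' s) := by
  have h1 := (gaussFam_gaussPi
    (fun p : Fin n × Fin m' => (Matrix.of fun i => Function.extend f (b i) c) p.1 p.2)
    (fun p => (Matrix.of fun i => Function.extend f (a i) d) p.1 p.2)).precomp
    (g := fun p : Fin n × Fin m => (p.1, f p.2))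
    (fun p q hpq => Prod.ext (Prod.mk.inj hpq).1 (hf (Prod.mk.inj hpq).2))
  simp only [Matrix.of_apply, hf.extend_apply] at h1
  have hmeas : Measurable fun (w : Fin n × Fin m' → ℝ) (p : Fin n × Fin m) => w (p.1, f p.2) :=
    measurable_pi_lambda _ fun p => measurable_pi_apply _
  rw [← h1.map_eq_gaussPi, measureReal_def, Measure.map_apply hmeas
    (isOpen_shrinkSet n m s).measurableSet]
  refine ENNReal.toReal_mono (measure_ne_top _ _) (measure_mono ?_)
  rintro w ⟨x, hx, hx'⟩
  obtain ⟨y, hy, hy'⟩ := exists_extend_eq hf (Matrix.of fun i j => w (i, j)) x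
  refine ⟨y, hy.trans hx, ?_⟩
  rw [hy']
  exact hx'

end Law

end SingularGaussian

/-! ### Matrices far from square, and conclusion -/

namespace SingularGaussian

/-- The number of columns used when the matrix is far from square. -/
lemma exists_column_count {ε : ℝ} {n m : ℕ} (hn : 8 ≤ ε * n)
    (hd : ε * n < (n : ℝ) - m) :
    ∃ m' : ℕ, m ≤ m' ∧ m' + 4 ≤ n ∧ (n : ℝ) - m' ≤ ε * n ∧ ε * n / 2 ≤ (n : ℝ) - m' := by
  have hm0 : (0 : ℝ) ≤ m := by positivity
  have h1 := Nat.le_ceil ((n : ℝ) - ε * n)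
  have h2 := Nat.ceil_lt_add_one (show 0 ≤ (n : ℝ) - ε * n by linarith)
  refine ⟨⌈(n : ℝ) - ε * n⌉₊, ?_, ?_, by linarith, by linarith⟩
  · have : (m : ℝ) ≤ ⌈(n : ℝ) - ε * n⌉₊ := by linarith
    exact_mod_cast this
  · have : ((⌈(n : ℝ) - ε * n⌉₊ + 4 : ℕ) : ℝ) ≤ n := by push_cast; linarith
    exact_mod_cast this

/-- At t = e⁻⁸ the power term is e^(-2d), exponentially small in n once d ≥ εn/2; εn ≥ 8 absorbs the
factor 2 from adding two terms. -/
lemma exp_rpow_add_exp_le {ε d : ℝ} (hε1 : ε ≤ 1) {n : ℕ} (hn : 8 ≤ ε * n) (hd : ε * n / 2 ≤ d) :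
    Real.exp (-8) ^ (d / 4) + Real.exp (-(1 / 4) * n) ≤ Real.exp (-(ε / 8) * n) := by
  have h1 : Real.exp (-8) ^ (d / 4) ≤ Real.exp (-(ε / 4 * n)) := by
    rw [← Real.exp_mul]
    gcongr
    linarith
  have h2 : Real.exp (-(1 / 4) * n) ≤ Real.exp (-(ε / 4 * n)) := by
    gcongr
    nlinarith
  have h3 : 2 ≤ Real.exp (ε / 8 * n) := by
    have := Real.add_one_le_exp (ε / 8 * n)
    linarith
  have h4 : Real.exp (-(ε / 8) * n) = Real.exp (ε / 8 * n) * Real.exp (-(ε / 4 * n)) := by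
    rw [← Real.exp_add]
    congr 1
    ring
  have h5 := mul_le_mul_of_nonneg_right h3 (Real.exp_pos (-(ε / 4 * n))).le
  linarith

/-- The bound on the smallest singular value, for `r, δ ≤ 1`. -/
theorem exists_singularValue_bound (r δ κ : ℝ) (hr : 0 < r) (hr1 : r ≤ 1) (hδ : 0 < δ)
    (hδ1 : δ ≤ 1) (hκ : 0 < κ) (hκδ : κ < δ / 2) :
    ∃ (c c' C : ℝ) (n₀ : ℕ), 0 < c ∧ 0 < c' ∧ 0 < C ∧
      ∀ (n m : ℕ), n₀ ≤ n → 0 < m → m + 4 ≤ n →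
      ∀ (Ω : Type*) [MeasurableSpace Ω] (P : Measure Ω) [IsProbabilityMeasure P]
        (W : Ω → Matrix (Fin n) (Fin m) ℝ) (b a : Matrix (Fin n) (Fin m) ℝ),
        IsIndepGaussianMatrix P W b a → (∀ i j, a i j = 0 ∨ a i j ∈ Set.Icc r 1) →
        BroadlyConnected δ κ (matrixGraph a) →
        ∀ K : ℝ, 1 ≤ K → opNorm b ≤ K * √(n : ℝ) → ∀ t : ℝ, 0 < t → t ≤ 1 →
          P.real {ω | singularValue (W ω) m ≤ c * t * K ^ (-C) * (((n : ℝ) - m) / √(n : ℝ))}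
            ≤ t ^ (((n : ℝ) - m) / 4) + Real.exp (-c' * n) := by
  obtain ⟨c, C, ε, n₀, hc, hC, hε, hε1, h⟩ :=
    exists_almost_square_bound_of_broadlyConnected r δ κ hr hr1 hδ hδ1 hκ hκδ
  have core : ∀ (n m : ℕ) (b a : Matrix (Fin n) (Fin m) ℝ) (K t : ℝ), n₀ ≤ n → m + 4 ≤ n →
      (n : ℝ) - m ≤ ε * n → (∀ i j, a i j = 0 ∨ a i j ∈ Set.Icc r 1) →
      BroadlyConnected δ κ (matrixGraph a) → 1 ≤ K → matNorm b ≤ K * √n → 0 < t → t ≤ 1 →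
      (gaussPi (fun p => b p.1 p.2) (fun p => a p.1 p.2)).real
          (shrinkSet n m (c * t * K ^ (-C) * (((n : ℝ) - m) / √n)))
        ≤ t ^ (((n : ℝ) - m) / 4) + Real.exp (-(1 / 4) * n) :=
    fun n m b a K t h1 h2 h3 h4 h5 h6 h7 h8 h9 =>
      h (Fin n × Fin m → ℝ) (gaussPi (fun p => b p.1 p.2) (fun p => a p.1 p.2)) n m
        (fun p w => w p) b a K t (gaussFam_gaussPi _ _) h1 h2 h3 h4 h5 h6 h7 h8 h9
  -- e⁻⁸ is the value of t used after padding, and ε/8 makes up for n - m' being as small as εn/2.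
  -- Together they make the threshold strictly smaller in both cases.
  refine ⟨c * Real.exp (-8) * (ε / 8), ε / 8, C, max n₀ ⌈8 / ε⌉₊, by positivity, by positivity,
    hC, ?_⟩
  intro n m hn hm hmn Ω _ P _ W b a hW ha hbc K hK hb t ht ht1
  have hnε : 8 ≤ ε * n := by
    have h1 := Nat.ceil_le.mp ((le_max_right _ _).trans hn)
    rwa [div_le_iff₀ hε, mul_comm] at h1
  have hn₀ : n₀ ≤ n := (le_max_left _ _).trans hn
  have hn0 : (0 : ℝ) < n := by
    by_contra! hneg
    nlinarith
  have hmn' : (m : ℝ) + 4 ≤ n := by exact_mod_cast hmn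
  have hK0 : 0 < K := by linarith
  have hKC : 0 < K ^ (-C) := Real.rpow_pos_of_pos hK0 _
  have hsq : 0 < √(n : ℝ) := Real.sqrt_pos.mpr hn0
  have he8 : Real.exp (-8) ≤ 1 := Real.exp_le_one_iff.mpr (by norm_num)
  rcases le_or_gt ((n : ℝ) - m) (ε * n) with hd | hd
  · have hlt : c * Real.exp (-8) * (ε / 8) * t * K ^ (-C) * (((n : ℝ) - m) / √(n : ℝ))
        < c * t * K ^ (-C) * (((n : ℝ) - m) / √(n : ℝ)) := by
      have hpos : 0 < ((n : ℝ) - m) / √(n : ℝ) := div_pos (by linarith) hsq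
      have hsmall : Real.exp (-8) * (ε / 8) < 1 :=
        (mul_le_of_le_one_left (by positivity) he8).trans_lt (by linarith)
      have hfac : 0 < c * t * K ^ (-C) * (((n : ℝ) - m) / √(n : ℝ)) := by positivity
      calc _ = Real.exp (-8) * (ε / 8) * (c * t * K ^ (-C) * (((n : ℝ) - m) / √(n : ℝ))) := by ring
        _ < 1 * (c * t * K ^ (-C) * (((n : ℝ) - m) / √(n : ℝ))) :=
          mul_lt_mul_of_pos_right hsmall hfac
        _ = _ := one_mul _
    refine (hW.singularValue_le hm hlt).trans
      ((core n m b a K t hn₀ hmn hd ha hbc hK hb ht ht1).trans ?_)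
    gcongr
    nlinarith
  -- Far from square: pad with columns of mean 0 and variance 1, and use the almost square bound at
  -- t = e⁻⁸.
  · obtain ⟨m', hmm, hmn4, hd1, hd2⟩ := exists_column_count hnε hd
    have hf := Fin.castLE_injective hmm
    have hlt : c * Real.exp (-8) * (ε / 8) * t * K ^ (-C) * (((n : ℝ) - m) / √(n : ℝ))
        < c * Real.exp (-8) * K ^ (-C) * (((n : ℝ) - m') / √(n : ℝ)) := by
      have hm0 : (0 : ℝ) ≤ m := by positivity
      have h1 : ε / 8 * t * ((n : ℝ) - m) < (n : ℝ) - m' := by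
        calc ε / 8 * t * ((n : ℝ) - m) ≤ ε / 8 * 1 * n := by gcongr <;> linarith
          _ < (n : ℝ) - m' := by linarith
      calc _ = c * Real.exp (-8) * K ^ (-C) * (ε / 8 * t * ((n : ℝ) - m) / √(n : ℝ)) := by ring
        _ < _ := by gcongr
    refine (hW.singularValue_le hm hlt).trans
      ((gaussPi_shrinkSet_le_extend n m m' b a hf 0 1 _).trans
        ((core n m' _ _ K _ hn₀ hmn4 hd1 (fun i j => ?_) (hbc.extend_one hδ1 hf hmm) hK
          ((matNorm_extend_zero_le hf b).trans hb) (Real.exp_pos _) he8).trans ?_))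
    · by_cases hj : j ∈ Set.range (Fin.castLE hmm)
      · obtain ⟨j, rfl⟩ := hj
        simpa [hf.extend_apply] using ha i j
      · simp [extend_of_notMem_range hj, hr1]
    · have h6 : 0 ≤ t ^ (((n : ℝ) - m) / 4) := by positivity
      linarith [exp_rpow_add_exp_le hε1 hnε hd2]

end SingularGaussian

theorem mainTheorem4 (r δ κ : ℝ) (hr : 0 < r) (hδ : 0 < δ) (hκ : 0 < κ) (hκδ : κ < δ / 2) :
    ∃ (c c' C : ℝ) (n₀ : ℕ), 0 < c ∧ 0 < c' ∧ 0 < C ∧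
      ∀ (n m : ℕ), n₀ ≤ n → (n : ℝ) / 2 < m → m + 4 ≤ n →
      ∀ (Ω : Type*) [MeasurableSpace Ω] (P : MeasureTheory.Measure Ω)
        [MeasureTheory.IsProbabilityMeasure P]
        (W : Ω → Matrix (Fin n) (Fin m) ℝ) (b a : Matrix (Fin n) (Fin m) ℝ),
        SingularGaussian.IsIndepGaussianMatrix P W b a →
        (∀ i j, a i j = 0 ∨ a i j ∈ Set.Icc r 1) →
        SingularGaussian.BroadlyConnected δ κ (SingularGaussian.matrixGraph a) →
        ∀ K : ℝ, 1 ≤ K →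
          SingularGaussian.opNorm (SingularGaussian.expectedMatrix P W) ≤ K * √(n : ℝ) →
          ∀ t : ℝ, 0 < t →
            P.real {ω | SingularGaussian.singularValue (W ω) m
                ≤ c * t * K ^ (-C) * (((n : ℝ) - m) / √(n : ℝ))}
              ≤ t ^ (((n : ℝ) - m) / 4) + Real.exp (-c' * n) := by
  by_cases h1 : δ ≤ 1 ∧ r ≤ 1
  · obtain ⟨c, c', C, n₀, hc, hc', hC, h⟩ :=
      SingularGaussian.exists_singularValue_bound r δ κ hr h1.2 hδ h1.1 hκ hκδ
    refine ⟨c, c', C, n₀, hc, hc', hC, ?_⟩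
    intro n m hn hnm hmn Ω _ P _ W b a hW ha hbc K hK hb t ht
    have hm : 0 < m := by
      have : (0 : ℝ) < m := lt_of_le_of_lt (by positivity) hnm
      exact_mod_cast this
    rcases le_total t 1 with ht1 | ht1
    · rw [hW.expectedMatrix_eq] at hb
      exact h n m hn hm hmn Ω P W b a hW ha hbc K hK hb t ht ht1
    -- For t ≥ 1 the right-hand side is at least 1.
    · have hmn' : (m : ℝ) + 4 ≤ n := by exact_mod_cast hmn
      have h2 := Real.one_le_rpow ht1 (show 0 ≤ ((n : ℝ) - m) / 4 by linarith)
      exact measureReal_le_one.trans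
        (h2.trans (le_add_of_nonneg_right (Real.exp_pos _).le))
  -- If δ > 1 or r > 1 no matrix satisfies the hypotheses, so any constants will do.
  · refine ⟨1, 1, 1, 0, one_pos, one_pos, one_pos, ?_⟩
    intro n m _ hnm hmn Ω _ P _ W b a _ ha hbc
    have hm : 0 < m := by
      have : (0 : ℝ) < m := lt_of_le_of_lt (by positivity) hnm
      exact_mod_cast this
    exact absurd (hbc.le_one hδ (by omega) hm ha) h1
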